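/- Let $G$ be a Lie group with Lie algebra $\mathfrak g$, let $p\colon P\to M$ be a smooth principal $G$-bundle (with right action, and fundamental vector fields $Y_z$, $z\in\mathfrak g$), and let $\hat E$ be an exact Courant algebroid $0\to T^*P\to\hat E\xrightarrow{\pi}TP\to 0$ with Dorfman bracket $[\cdot,\cdot]$ and metric $\langle\cdot,\cdot\rangle$, normalized by $[e,e]=\tfrac12\pi^*d\langle e,e\rangle$. Let $\rho\colon\mathfrak g\to\Gamma(\hat E)$ be a $G$-equivariant lifted action, that is, an algebra morphism with $\pi\rho(z)=Y_z$, such that $z\mapsto[\rho(z),\cdot]$ is the infinitesimal action of a right $G$-action on $\hat E$ by Courant algebroid automorphisms covering the action on $P$, and such that $\rho(\operatorname{Ad}(g)z)=g\cdot\rho(z)$. Suppose that $\hat E$ admits a $G$-equivariant isotropic splitting $TP\to\hat E$, and that the quadratic form $c(z)=-\langle\rho(z),\rho(z)\rangle$ on $\mathfrak g$ is (constant on $P$ and) nondegenerate. Let $K=\rho(\mathfrak g)\subset\hat E$; then $K\cap K^\perp=0$. Let $E=K^\perp/G$ be the reduced Courant algebroid over $M$: its sections are the $G$-invariant sections of $K^\perp$,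 and its bracket, metric and anchor $\pi\colon E\to T$ (where $T=TM$) are those induced from $\hat E$. The bundle $T^*=T^*M$ is embedded in $E$ by $\xi\mapsto\tfrac12\pi^*\xi$ (so $\langle\xi,e\rangle=\tfrac12\xi(\pi e)$), and $\pi_Q\colon E\to E/T^*\cong TP/G$ denotes the projection. A smooth isotropic splitting $\lambda\colon T\to E$ gives an isomorphism $T\oplus\operatorname{ad}P\oplus T^*\to E$, $X+r+\xi\mapsto\lambda(X)+s(r)+\xi$, where $s(r)$ is the element of $(\operatorname{im}\lambda)^\perp$ with $\pi_Q(s(r))=r$. It determines a connection $A$ on $P$, whose horizontal lift is $\pi_Q\circ\lambda\colon T\to TP/G$, and so an isomorphism $E\cong TP/G\oplus T^*$. We say that $\lambda$ is a splitting provided by $A$. The curvature is $F(X,Y)=-A[A^\perp X,A^\perp Y]$, where $A^\perp$ is the horizontal projection, and $\nabla^A_Zr=[A^\perp Z,r]$ on sections $r$ of $\operatorname{ad}P$. A subbundle $V_+\subset E$ on which the metric is nondegenerate (of any signature) is an admissible metric if $V_+\cap T^*=0$ and $\operatorname{rk}V_+=\operatorname{rk}E-\dim M$. Its orthogonal decomposition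 $V_+=(V_+\cap\operatorname{Ker}\pi)\oplus(V_+\cap\operatorname{Ker}\pi)^\perp$ gives an isomorphism $\pi_\perp\colon(V_+\cap\operatorname{Ker}\pi)^\perp\to T$; let $g$ be the induced metric on $T$ (so $g(X,Y)=\langle\pi_\perp^{-1}X,\pi_\perp^{-1}Y\rangle$) and $\lambda(X)=\pi_\perp^{-1}(X)-g(X)$ the splitting provided by $V_+$. 1. Every admissible metric $V_+$ determines in this way a unique pair $(g,\lambda)$ of a (pseudo-Riemannian, smooth) metric $g$ on $M$ and a smooth isotropic splitting $\lambda$, the splitting $\lambda$ determines a unique connection $A$ on $P$, and $$V_+=\{X+g(X)+r : X\in T,\ r\in\operatorname{ad}P\}$$ in the splitting $\lambda$. There is a unique $3$-form $H\in\Omega^3(M)$ such that, in the isomorphism $E\cong TP/G\oplus T^*$ given by $\lambda$, the bracket of $E$ is $$[X+\xi,Y+\eta]=[X,Y]+L_{pX}\eta-i_{pY}d\xi+i_{pY}i_{pX}H+2c(\nabla^A(AX),AY)+2c(F(X,\cdot),AY)-2c(F(Y,\cdot),AX),$$ and it satisfies $dH=c(F\wedge F)$. 2. Conversely, let $g$ be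 a metric on $M$ of arbitrary signature and $A$ a connection on $P$. There is a subbundle $V_+\subset E$ that has the form $\{X+g(X)+r : X\in T,\ r\in\operatorname{ad}P\}$ in some splitting provided by $A$. The subbundles of this form are exactly the admissible metrics whose metric and connection, as in 1, are $g$ and $A$; and they form a single orbit under the transformations $e\mapsto e+i_{\pi(e)}b$ of $E$, $b\in\Omega^2(M)$. -/

import Mathlib

open scoped Manifold ContDiff Bundle
open Bundle VectorField

set_option linter.unusedSectionVars false

noncomputable section

namespace TransitiveCourant

/-! ## Vector fields, forms and metrics on a manifold -/

section Manifold

variable {EM : Type*} [NormedAddCommGroup EM] [NormedSpace ℝ EM]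
  {M : Type*} [TopologicalSpace M] [ChartedSpace EM M] [IsManifold 𝓘(ℝ, EM) ∞ M]

/-- Not necessarily smooth vector fields on `M`. -/
abbrev RoughField (EM : Type*) [NormedAddCommGroup EM] [NormedSpace ℝ EM]
    (M : Type*) [TopologicalSpace M] [ChartedSpace EM M] : Type _ :=
  (m : M) → TangentSpace 𝓘(ℝ, EM) m

/-- Smoothness of a vector field. -/
def IsSmoothField (X : RoughField EM M) : Prop :=
  ContMDiff 𝓘(ℝ, EM) 𝓘(ℝ, EM).tangent ∞
    (fun m => (⟨m, X m⟩ : TangentBundle 𝓘(ℝ, EM) M))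

/-- Smoothness of a function with values in a normed space. -/
abbrev IsSmoothFun {W : Type*} [NormedAddCommGroup W] [NormedSpace ℝ W] (f : M → W) : Prop :=
  ContMDiff 𝓘(ℝ, EM) 𝓘(ℝ, W) ∞ f

/-- The derivative `X(f)` of a function along a vector field. -/
def dirDeriv (X : RoughField EM M) (f : M → ℝ) (m : M) : ℝ :=
  mfderiv 𝓘(ℝ, EM) 𝓘(ℝ, ℝ) f m (X m)

/-- The Lie bracket of vector fields. -/
abbrev lieBr (X Y : RoughField EM M) : RoughField EM M := mlieBracket 𝓘(ℝ, EM) X Y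

/-- `(L_X η)(Z) = X(η(Z)) - η([X, Z])` for a 1-form `η`. -/
def lieDerivOneForm (X : RoughField EM M)
    (η : (m : M) → Module.Dual ℝ (TangentSpace 𝓘(ℝ, EM) m)) (Z : RoughField EM M) (m : M) : ℝ :=
  dirDeriv X (fun m => η m (Z m)) m - η m (lieBr X Z m)

/-- `dξ(Y, Z) = Y(ξ(Z)) - Z(ξ(Y)) - ξ([Y, Z])` for a 1-form `ξ`. -/
def extDerivOneForm (ξ : (m : M) → Module.Dual ℝ (TangentSpace 𝓘(ℝ, EM) m))
    (Y Z : RoughField EM M) (m : M) : ℝ :=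
  dirDeriv Y (fun m => ξ m (Z m)) m - dirDeriv Z (fun m => ξ m (Y m)) m - ξ m (lieBr Y Z m)

variable (EM M) in
/-- A smooth differential 3-form; smoothness is tested on smooth vector fields. -/
@[ext] structure ThreeForm where
  toFun : (m : M) → (TangentSpace 𝓘(ℝ, EM) m) [⋀^Fin 3]→ₗ[ℝ] ℝ
  smooth : ∀ X : Fin 3 → RoughField EM M, (∀ i, IsSmoothField (X i)) →
    IsSmoothFun (EM := EM) (fun m => toFun m (fun i => X i m))

/-- The exterior derivative of a 3-form, evaluated on four vector fields:
`dH(X₀,…,X₃) = ∑ᵢ (-1)ⁱ Xᵢ(H(…,X̂ᵢ,…)) + ∑_{i<j} (-1)^{i+j} H([Xᵢ,Xⱼ],…,X̂ᵢ,…,X̂ⱼ,…)`.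
In the double sum the pair `i ≤ j` in `Fin 3` stands for the pair of positions `i < j + 1`, which is
the reason for the sign in front of it. -/
def ThreeForm.extDeriv (H : ThreeForm EM M) (X : Fin 4 → RoughField EM M) (m : M) : ℝ :=
  (∑ i : Fin 4, (-1 : ℝ) ^ (i : ℕ) *
      dirDeriv (X i) (fun m => H.toFun m (i.removeNth (fun k => X k m))) m) -
    ∑ i : Fin 3, ∑ j ∈ Finset.Ici i, (-1 : ℝ) ^ ((i : ℕ) + (j : ℕ)) *
      H.toFun m (Matrix.vecCons (lieBr (X i.castSucc) (X j.succ) m)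
        (j.removeNth (i.castSucc.removeNth (fun k => X k m))))

variable (EM M) in
/-- A smooth differential 2-form, written as a field of alternating bilinear forms. -/
@[ext] structure TwoForm where
  toFun : (m : M) → LinearMap.BilinForm ℝ (TangentSpace 𝓘(ℝ, EM) m)
  alt : ∀ m X, toFun m X X = 0
  smooth : ∀ X Y : RoughField EM M, IsSmoothField X → IsSmoothField Y →
    IsSmoothFun (EM := EM) (fun m => toFun m (X m) (Y m))

variable (EM M) in
/-- A smooth metric on the tangent bundle, nondegenerate and of arbitrary signature. -/
@[ext] structure PseudoMetric where
  toFun : (m : M) → LinearMap.BilinForm ℝ (TangentSpace 𝓘(ℝ, EM) m)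
  symm : ∀ m X Y, toFun m X Y = toFun m Y X
  nondeg : ∀ m, (toFun m).Nondegenerate
  smooth : ∀ X Y : RoughField EM M, IsSmoothField X → IsSmoothField Y →
    IsSmoothFun (EM := EM) (fun m => toFun m (X m) (Y m))

end Manifold

/-! ## Principal bundles and connections -/

/-- A smooth principal `G`-bundle `P → M`, with `G` acting on the right. -/
structure PrincipalBundle (EG G EM M EP P : Type*)
    [NormedAddCommGroup EG] [NormedSpace ℝ EG]
    [TopologicalSpace G] [ChartedSpace EG G] [Group G]
    [NormedAddCommGroup EM] [NormedSpace ℝ EM] [TopologicalSpace M] [ChartedSpace EM M]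
    [NormedAddCommGroup EP] [NormedSpace ℝ EP] [TopologicalSpace P] [ChartedSpace EP P] where
  proj : P → M
  act : P → G → P
  act_one : ∀ p, act p 1 = p
  act_mul : ∀ p g h, act (act p g) h = act p (g * h)
  proj_act : ∀ p g, proj (act p g) = proj p
  contMDiff_proj : ContMDiff 𝓘(ℝ, EP) 𝓘(ℝ, EM) ∞ proj
  contMDiff_act : ContMDiff (𝓘(ℝ, EP).prod 𝓘(ℝ, EG)) 𝓘(ℝ, EP) ∞ (fun x : P × G => act x.1 x.2)
  /-- Around every point there is a smooth equivariant trivialization. -/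
  locally_trivial : ∀ m : M, ∃ (U : Set M) (φ : OpenPartialHomeomorph P (M × G)),
    IsOpen U ∧ m ∈ U ∧ φ.source = proj ⁻¹' U ∧ φ.target = U ×ˢ Set.univ ∧
    ContMDiffOn 𝓘(ℝ, EP) (𝓘(ℝ, EM).prod 𝓘(ℝ, EG)) ∞ φ φ.source ∧
    ContMDiffOn (𝓘(ℝ, EM).prod 𝓘(ℝ, EG)) 𝓘(ℝ, EP) ∞ φ.symm φ.target ∧
    ∀ p ∈ φ.source, (φ p).1 = proj p ∧ ∀ g, φ (act p g) = ((φ p).1, (φ p).2 * g)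

section LieGroup

variable {EG : Type*} [NormedAddCommGroup EG] [NormedSpace ℝ EG]
  {G : Type*} [TopologicalSpace G] [ChartedSpace EG G] [Group G]

/-- The Lie algebra of `G`. -/
abbrev LieAlg (EG : Type*) [NormedAddCommGroup EG] [NormedSpace ℝ EG]
    (G : Type*) [TopologicalSpace G] [ChartedSpace EG G] [Group G] : Type _ :=
  GroupLieAlgebra 𝓘(ℝ, EG) G

/-- The adjoint action of `G` on its Lie algebra, `Ad(g) z = d/dt (g exp(tz) g⁻¹)` at `t = 0`.
(The derivative lies in the tangent space at `g * 1 * g⁻¹ = 1`.) -/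
def adjoint (g : G) (z : LieAlg EG G) : LieAlg EG G :=
  (mfderiv 𝓘(ℝ, EG) 𝓘(ℝ, EG) (fun h : G => g * h * g⁻¹) 1 z : EG)

end LieGroup

variable {EG : Type*} [NormedAddCommGroup EG] [NormedSpace ℝ EG]
  {G : Type*} [TopologicalSpace G] [ChartedSpace EG G] [Group G]
  {EM : Type*} [NormedAddCommGroup EM] [NormedSpace ℝ EM]
  {M : Type*} [TopologicalSpace M] [ChartedSpace EM M]
  {EP : Type*} [NormedAddCommGroup EP] [NormedSpace ℝ EP]
  {P : Type*} [TopologicalSpace P] [ChartedSpace EP P]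

namespace PrincipalBundle

variable (B : PrincipalBundle EG G EM M EP P)

/-- The fibre of `P` over `m`. -/
abbrev Fibre (m : M) : Type _ := {p : P // B.proj p = m}

/-- The right translation of a point of a fibre. -/
abbrev actFibre {m : M} (p : B.Fibre m) (g : G) : B.Fibre m :=
  ⟨B.act p.1 g, (B.proj_act p.1 g).trans p.2⟩

/-- The fundamental vector field `Y_z` of `z ∈ 𝔤`, `Y_z(p) = d/dt (p · exp(tz))` at `t = 0`.
(The derivative lies in the tangent space at `p · 1 = p`.) -/
def fund (z : LieAlg EG G) : RoughField EP P :=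
  fun p => (mfderiv 𝓘(ℝ, EG) 𝓘(ℝ, EP) (fun g : G => B.act p g) 1 z : EP)

/-- The differential of the right translation by `g`. -/
def dact (g : G) (p : P) :
    TangentSpace 𝓘(ℝ, EP) p →L[ℝ] TangentSpace 𝓘(ℝ, EP) (B.act p g) :=
  mfderiv 𝓘(ℝ, EP) 𝓘(ℝ, EP) (fun q : P => B.act q g) p

/-- The differential of the projection at a point of the fibre over `m`.
(It takes values in the tangent space of `M` at `proj p = m`.) -/
def dproj {m : M} (p : B.Fibre m) :
    TangentSpace 𝓘(ℝ, EP) p.1 →ₗ[ℝ] TangentSpace 𝓘(ℝ, EM) m :=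
  (mfderiv 𝓘(ℝ, EP) 𝓘(ℝ, EM) B.proj p.1 : EP →L[ℝ] EM).toLinearMap

end PrincipalBundle


namespace PrincipalBundle

variable (B : PrincipalBundle EG G EM M EP P)

lemma nonempty_fibre (m : M) : Nonempty (B.Fibre m) := by
  obtain ⟨U, φ, -, hm, hs, ht, -, -, hφ⟩ := B.locally_trivial m
  have h1 : ((m, 1) : M × G) ∈ φ.target := by rw [ht]; exact ⟨hm, trivial⟩
  have h2 := φ.map_target h1
  refine ⟨⟨φ.symm (m, 1), ?_⟩⟩
  rw [← (hφ _ h2).1, φ.right_inv h1]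

theorem exists_actFibre {m : M} (p q : B.Fibre m) : ∃ g, q = B.actFibre p g := by
  obtain ⟨U, φ, -, hm, hs, ht, -, -, hφ⟩ := B.locally_trivial m
  have hp : p.1 ∈ φ.source := by rw [hs]; simpa [p.2] using hm
  have hq : q.1 ∈ φ.source := by rw [hs]; simpa [q.2] using hm
  refine ⟨(φ p.1).2⁻¹ * (φ q.1).2, Subtype.ext ?_⟩
  have hpg : B.act p.1 ((φ p.1).2⁻¹ * (φ q.1).2) ∈ φ.source := by
    rw [hs]; simpa [B.proj_act, p.2] using hm
  refine φ.injOn hq hpg ?_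
  change φ q.1 = φ (B.act p.1 _)
  rw [(hφ _ hp).2, (hφ _ hp).1, p.2]
  refine Prod.ext ?_ ?_
  · rw [(hφ _ hq).1, q.2]
  · simp

lemma dproj_fund {m : M} (p : B.Fibre m) (z : LieAlg EG G) :
    B.dproj p (B.fund z p.1) = 0 := by
  have hact : MDifferentiableAt 𝓘(ℝ, EG) 𝓘(ℝ, EP) (fun g : G => B.act p.1 g) 1 :=
    (B.contMDiff_act.comp (contMDiff_const.prodMk contMDiff_id)).mdifferentiable (by simp) 1
  have key : ∀ q, q = B.act p.1 1 →
      (mfderiv 𝓘(ℝ, EP) 𝓘(ℝ, EM) B.proj q : EP →L[ℝ] EM)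
        (mfderiv 𝓘(ℝ, EG) 𝓘(ℝ, EP) (fun g : G => B.act p.1 g) 1 z : EP) = 0 := by
    rintro q rfl
    have h := mfderiv_comp_apply (I := 𝓘(ℝ, EG)) (I' := 𝓘(ℝ, EP)) (I'' := 𝓘(ℝ, EM)) (1 : G)
      (g := B.proj) (B.contMDiff_proj.mdifferentiable (by simp) _) hact z
    have h' : B.proj ∘ (fun g : G => B.act p.1 g) = fun _ => B.proj p.1 :=
      funext fun g => B.proj_act p.1 g
    rw [h', mfderiv_const] at h
    exact h.symm
  exact key p.1 (B.act_one p.1).symm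

lemma dproj_dact {m : M} (p : B.Fibre m) (g : G) (v : TangentSpace 𝓘(ℝ, EP) p.1) :
    B.dproj (B.actFibre p g) (B.dact g p.1 v) = B.dproj p v := by
  have hact : MDifferentiableAt 𝓘(ℝ, EP) 𝓘(ℝ, EP) (fun q : P => B.act q g) p.1 :=
    (B.contMDiff_act.comp (contMDiff_id.prodMk contMDiff_const)).mdifferentiable (by simp) p.1
  have h := mfderiv_comp_apply (I := 𝓘(ℝ, EP)) (I' := 𝓘(ℝ, EP)) (I'' := 𝓘(ℝ, EM)) p.1
    (g := B.proj) (B.contMDiff_proj.mdifferentiable (by simp) _) hact v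
  have h' : B.proj ∘ (fun q : P => B.act q g) = B.proj := funext fun q => B.proj_act q g
  rw [h'] at h
  exact h.symm

/-- A point of the fibre over `m`. -/
def pt (m : M) : B.Fibre m := (B.nonempty_fibre m).some

end PrincipalBundle

variable [IsManifold 𝓘(ℝ, EM) ∞ M] [IsManifold 𝓘(ℝ, EP) ∞ P]

/-- A connection on `P`, as an equivariant `𝔤`-valued 1-form `A` with `A(Y_z) = z`. -/
@[ext] structure Connection (B : PrincipalBundle EG G EM M EP P) where
  toFun : (p : P) → TangentSpace 𝓘(ℝ, EP) p →ₗ[ℝ] LieAlg EG G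
  apply_fund : ∀ p z, toFun p (B.fund z p) = z
  equivariant : ∀ p g v, toFun (B.act p g) (B.dact g p v) = adjoint g⁻¹ (toFun p v)
  smooth : ∀ X : RoughField EP P, IsSmoothField X →
    IsSmoothFun (EM := EP) (W := EG) (fun p => toFun p (X p))

namespace Connection

variable {B : PrincipalBundle EG G EM M EP P} (A : Connection B)

/-- The vertical vector field `p ↦ Y_{r(p)}(p)` of a function `r : P → 𝔤`. -/
def _root_.TransitiveCourant.PrincipalBundle.vert (B : PrincipalBundle EG G EM M EP P)
    (r : P → LieAlg EG G) : RoughField EP P := fun p => B.fund (r p) p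

/-- The horizontal part `A^⊥ X = X - Y_{A(X)}` of a vector field on `P`. -/
def hor (X : RoughField EP P) : RoughField EP P :=
  fun p => X p - B.vert (fun q => A.toFun q (X q)) p

/-- The curvature `F(X, Y) = -A([A^⊥ X, A^⊥ Y])`. -/
def curv (X Y : RoughField EP P) (p : P) : LieAlg EG G :=
  -A.toFun p (lieBr (A.hor X) (A.hor Y) p)

/-- The covariant derivative on `ad P` in terms of functions `r : P → 𝔤`: the vertical field of
`∇^A_Z r` is `[A^⊥ Z, Y_r]`, for a field `Z` on `P` that lifts a field on `M`. -/
def cov (Z : RoughField EP P) (r : P → LieAlg EG G) (p : P) : LieAlg EG G :=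
  A.toFun p (lieBr (A.hor Z) (B.vert r) p)

/-- The 4-form `c(F ∧ F)`, as a (basic) form on `P`:
the sum of `± c(F(Xᵢ, Xⱼ), F(Xₖ, Xₗ))` over the `(2,2)`-shuffles of four vector fields. -/
def curvSq (c : LinearMap.BilinForm ℝ (LieAlg EG G)) (X : Fin 4 → RoughField EP P) (p : P) : ℝ :=
  2 * (c (A.curv (X 0) (X 1) p) (A.curv (X 2) (X 3) p)
    - c (A.curv (X 0) (X 2) p) (A.curv (X 1) (X 3) p)
    + c (A.curv (X 0) (X 3) p) (A.curv (X 1) (X 2) p))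

end Connection

/-- The vector field `Z'` on `P` lifts the vector field `Z` on `M`. -/
def PrincipalBundle.IsLift (B : PrincipalBundle EG G EM M EP P) (Z' : RoughField EP P)
    (Z : RoughField EM M) : Prop :=
  ∀ m (p : B.Fibre m), B.dproj p (Z' p.1) = Z m

/-- `dH = c(F ∧ F)`. As `c(F ∧ F)` is a basic form on `P`, the equality is evaluated on smooth
vector fields on `M` and arbitrary smooth lifts of them to `P`. -/
def StructureEq (B : PrincipalBundle EG G EM M EP P) (A : Connection B)
    (c : LinearMap.BilinForm ℝ (LieAlg EG G)) (H : ThreeForm EM M) : Prop :=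
  ∀ (X : Fin 4 → RoughField EM M) (X' : Fin 4 → RoughField EP P),
    (∀ i, IsSmoothField (X i)) → (∀ i, IsSmoothField (X' i)) → (∀ i, B.IsLift (X' i) (X i)) →
    ∀ p, H.extDeriv X (B.proj p) = A.curvSq c X' p

/-! ## Exact Courant algebroids and lifted actions -/

/-- An exact Courant algebroid `0 → T*P → Ê → TP → 0` over `P`, with its Dorfman bracket. -/
structure ExactCourantAlgebroid (EP P F : Type*)
    [NormedAddCommGroup EP] [NormedSpace ℝ EP] [TopologicalSpace P] [ChartedSpace EP P]
    [IsManifold 𝓘(ℝ, EP) ∞ P] [NormedAddCommGroup F] [NormedSpace ℝ F] (Eh : P → Type*)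
    [TopologicalSpace (TotalSpace F Eh)] [∀ p, AddCommGroup (Eh p)] [∀ p, Module ℝ (Eh p)]
    [∀ p, TopologicalSpace (Eh p)] [FiberBundle F Eh] [VectorBundle ℝ F Eh]
    [ContMDiffVectorBundle ∞ F Eh 𝓘(ℝ, EP)] where
  /-- the metric `⟨·,·⟩` -/
  pairing : (p : P) → LinearMap.BilinForm ℝ (Eh p)
  pairing_symm : ∀ p a b, pairing p a b = pairing p b a
  pairing_nondeg : ∀ p, (pairing p).Nondegenerate
  pairing_smooth : ∀ a b : Cₛ^∞⟮𝓘(ℝ, EP); F, Eh⟯,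
    IsSmoothFun (EM := EP) (fun p => pairing p (a p) (b p))
  /-- the anchor `π` -/
  anchor : (p : P) → Eh p →ₗ[ℝ] TangentSpace 𝓘(ℝ, EP) p
  anchor_smooth : ∀ a : Cₛ^∞⟮𝓘(ℝ, EP); F, Eh⟯,
    IsSmoothField (fun p => anchor p (a p))
  /-- the Dorfman bracket on smooth sections -/
  bracket : Cₛ^∞⟮𝓘(ℝ, EP); F, Eh⟯ →ₗ[ℝ] Cₛ^∞⟮𝓘(ℝ, EP); F, Eh⟯ →ₗ[ℝ] Cₛ^∞⟮𝓘(ℝ, EP); F, Eh⟯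
  jacobi : ∀ a b d, bracket a (bracket b d) = bracket (bracket a b) d + bracket b (bracket a d)
  anchor_bracket : ∀ a b p,
    anchor p (bracket a b p) = lieBr (fun q => anchor q (a q)) (fun q => anchor q (b q)) p
  /-- `[a, f b] = f [a, b] + π(a)(f) b` -/
  leibniz : ∀ (a b b' : Cₛ^∞⟮𝓘(ℝ, EP); F, Eh⟯) (f : P → ℝ), IsSmoothFun (EM := EP) f →
    (∀ p, b' p = f p • b p) → ∀ p,
    bracket a b' p = f p • bracket a b p + dirDeriv (fun q => anchor q (a q)) f p • b p
  /-- `π(a)⟨b, d⟩ = ⟨[a, b], d⟩ + ⟨b, [a, d]⟩` -/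
  metric_compat : ∀ (a b d : Cₛ^∞⟮𝓘(ℝ, EP); F, Eh⟯) (p : P),
    dirDeriv (fun q => anchor q (a q)) (fun q => pairing q (b q) (d q)) p =
      pairing p (bracket a b p) (d p) + pairing p (b p) (bracket a d p)
  /-- `[a, a] = ½ π* d⟨a, a⟩` -/
  bracket_self : ∀ (a b : Cₛ^∞⟮𝓘(ℝ, EP); F, Eh⟯) (p : P),
    pairing p (bracket a a p) (b p) =
      (1 / 2 : ℝ) * dirDeriv (fun q => anchor q (b q)) (fun q => pairing q (a q) (a q)) p
  anchor_surjective : ∀ p, Function.Surjective (anchor p)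
  /-- exactness in the middle: the kernel of `π` is the image of `π* : T*P → Ê* ≅ Ê` -/
  exact_middle : ∀ p e, anchor p e = 0 ↔
    ∃ ξ : Module.Dual ℝ (TangentSpace 𝓘(ℝ, EP) p), ∀ e', pairing p e e' = ξ (anchor p e')

variable {F : Type*} [NormedAddCommGroup F] [NormedSpace ℝ F] {Eh : P → Type*}
  [TopologicalSpace (TotalSpace F Eh)] [∀ p, AddCommGroup (Eh p)] [∀ p, Module ℝ (Eh p)]
  [∀ p, TopologicalSpace (Eh p)] [FiberBundle F Eh] [VectorBundle ℝ F Eh]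
  [ContMDiffVectorBundle ∞ F Eh 𝓘(ℝ, EP)]

/-- A `G`-equivariant lift of the `G`-action on `P` to `Ê`: an algebra morphism `ρ : 𝔤 → Γ(Ê)` over
the infinitesimal action, and a smooth right action of `G` on `Ê` by Courant algebroid automorphisms
over the action on `P`, whose infinitesimal action on sections is `z ↦ [ρ(z), ·]`. -/
structure LiftedAction (B : PrincipalBundle EG G EM M EP P)
    (C : ExactCourantAlgebroid EP P F Eh) where
  ρ : LieAlg EG G →ₗ[ℝ] Cₛ^∞⟮𝓘(ℝ, EP); F, Eh⟯
  ρ_lie : ∀ z w, ρ ⁅z, w⁆ = C.bracket (ρ z) (ρ w)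
  anchor_ρ : ∀ z p, C.anchor p (ρ z p) = B.fund z p
  /-- the action `e ↦ e · g` on the fibres -/
  R : (g : G) → (p : P) → Eh p ≃ₗ[ℝ] Eh (B.act p g)
  R_one : ∀ p e, (⟨B.act p 1, R 1 p e⟩ : TotalSpace F Eh) = ⟨p, e⟩
  R_mul : ∀ p g h e, (⟨B.act (B.act p g) h, R h (B.act p g) (R g p e)⟩ : TotalSpace F Eh) =
    ⟨B.act p (g * h), R (g * h) p e⟩
  R_smooth : ContMDiff ((𝓘(ℝ, EP).prod 𝓘(ℝ, F)).prod 𝓘(ℝ, EG)) (𝓘(ℝ, EP).prod 𝓘(ℝ, F)) ∞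
    (fun x : TotalSpace F Eh × G =>
      (⟨B.act x.1.proj x.2, R x.2 x.1.proj x.1.2⟩ : TotalSpace F Eh))
  R_pairing : ∀ g p a b, C.pairing (B.act p g) (R g p a) (R g p b) = C.pairing p a b
  R_anchor : ∀ g p a, C.anchor (B.act p g) (R g p a) = B.dact g p (C.anchor p a)
  R_bracket : ∀ (g : G) (a b a' b' : Cₛ^∞⟮𝓘(ℝ, EP); F, Eh⟯),
    (∀ p, a' (B.act p g) = R g p (a p)) → (∀ p, b' (B.act p g) = R g p (b p)) →
    ∀ p, C.bracket a' b' (B.act p g) = R g p (C.bracket a b p)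
  /-- the derivative at `g = 1`, in the direction of `z`, of the section `(g · a)(p) = a(p · g) · g⁻¹`
  is `[ρ(z), a]` -/
  infinitesimal : ∀ (z : LieAlg EG G) (a : Cₛ^∞⟮𝓘(ℝ, EP); F, Eh⟯) (p : P)
    (ℓ : Module.Dual ℝ (Eh p)),
    (mfderiv 𝓘(ℝ, EG) 𝓘(ℝ, ℝ) (fun g : G => ℓ ((R g p).symm (a (B.act p g)))) 1 z : ℝ) =
      ℓ (C.bracket (ρ z) a p)
  /-- `ρ(Ad(g) z) = g · ρ(z)` -/
  equivariant : ∀ (g : G) (z : LieAlg EG G) (p : P),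
    ρ (adjoint g z) p = (R g p).symm (ρ z (B.act p g))

namespace LiftedAction

variable {B : PrincipalBundle EG G EM M EP P} {C : ExactCourantAlgebroid EP P F Eh}
  (L : LiftedAction B C)

/-- There is a `G`-equivariant isotropic splitting `TP → Ê`. -/
def HasEquivariantSplitting : Prop :=
  ∃ l : (p : P) → TangentSpace 𝓘(ℝ, EP) p →ₗ[ℝ] Eh p,
    (∀ p X, C.anchor p (l p X) = X) ∧
    (∀ p X Y, C.pairing p (l p X) (l p Y) = 0) ∧
    (∀ g p X, l (B.act p g) (B.dact g p X) = L.R g p (l p X)) ∧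
    ∀ X : RoughField EP P, IsSmoothField X →
      ∃ a : Cₛ^∞⟮𝓘(ℝ, EP); F, Eh⟯, ∀ p, a p = l p (X p)

/-- `c` is the quadratic form of the lifted action, `c(z) = -⟨ρ(z), ρ(z)⟩`. -/
def IsQuadraticForm (c : LinearMap.BilinForm ℝ (LieAlg EG G)) : Prop :=
  (∀ z w, c z w = c w z) ∧ ∀ p z, c z z = -C.pairing p (L.ρ z p) (L.ρ z p)

/-- With `K = ρ(𝔤)`, if `c` is nondegenerate then `K ∩ K^⊥ = 0`, so that the reduction
`(K^⊥ / (K ∩ K^⊥)) / G` is `K^⊥ / G`. -/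
lemma ρ_eq_zero_of_orthogonal {c : LinearMap.BilinForm ℝ (LieAlg EG G)}
    (hc : L.IsQuadraticForm c) (hnd : c.Nondegenerate) (p : P) (z : LieAlg EG G)
    (h : ∀ w, C.pairing p (L.ρ z p) (L.ρ w p) = 0) : L.ρ z p = 0 := by
  have hz : z = 0 := by
    refine hnd.1 z fun w => ?_
    have h1 := hc.2 p (z + w)
    have h2 := hc.2 p z
    have h3 := hc.2 p w
    have h4 := hc.1 z w
    have h5 := C.pairing_symm p (L.ρ z p) (L.ρ w p)
    have h6 := h w
    simp only [map_add, LinearMap.add_apply, ContMDiffSection.coe_add, Pi.add_apply] at h1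
    linarith
  rw [hz, map_zero]; rfl

/-! ## The reduced Courant algebroid `E = K^⊥ / G` over `M` -/

/-- The fibre of `E = K^⊥ / G` over `m`: the `G`-equivariant sections of `K^⊥` over the fibre of `P`
over `m`. -/
def RedFibre (m : M) : Submodule ℝ ((p : B.Fibre m) → Eh p.1) where
  carrier := {e | (∀ p z, C.pairing p.1 (e p) (L.ρ z p.1) = 0) ∧
    ∀ p g, e (B.actFibre p g) = L.R g p.1 (e p)}
  zero_mem' := by simp
  add_mem' := by
    rintro a b ⟨ha, ha'⟩ ⟨hb, hb'⟩
    refine ⟨fun p z => ?_, fun p g => ?_⟩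
    · simp [ha, hb]
    · simp [ha', hb']
  smul_mem' := by
    rintro r a ⟨ha, ha'⟩
    refine ⟨fun p z => ?_, fun p g => ?_⟩
    · simp [ha]
    · simp [ha']

/-- The smooth sections of `E`: the `G`-invariant smooth sections of `K^⊥` over `P`. -/
def RedSection : Submodule ℝ (Cₛ^∞⟮𝓘(ℝ, EP); F, Eh⟯) where
  carrier := {a | (∀ p z, C.pairing p (a p) (L.ρ z p) = 0) ∧
    ∀ p g, a (B.act p g) = L.R g p (a p)}
  zero_mem' := by simp
  add_mem' := by
    rintro a b ⟨ha, ha'⟩ ⟨hb, hb'⟩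
    refine ⟨fun p z => ?_, fun p g => ?_⟩
    · simp [ha, hb]
    · simp [ha', hb']
  smul_mem' := by
    rintro r a ⟨ha, ha'⟩
    refine ⟨fun p z => ?_, fun p g => ?_⟩
    · simp [ha]
    · simp [ha']

variable {L}

/-- The value of a section of `E` at `m`. -/
def RedSection.eval (a : L.RedSection) (m : M) : L.RedFibre m :=
  ⟨fun p => a.1 p.1, fun p z => a.2.1 p.1 z, fun p g => a.2.2 p.1 g⟩


end LiftedAction

namespace LiftedAction

variable {B : PrincipalBundle EG G EM M EP P} {C : ExactCourantAlgebroid EP P F Eh}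
  (L : LiftedAction B C)

/-- Evaluation of an element of `E_m` at a point of the fibre of `P` over `m`. -/
def evalAt {m : M} (p : B.Fibre m) : L.RedFibre m →ₗ[ℝ] Eh p.1 :=
  (LinearMap.proj p).comp (L.RedFibre m).subtype

/-- The metric of `E`. -/
def redPairing (m : M) : LinearMap.BilinForm ℝ (L.RedFibre m) :=
  (C.pairing (B.pt m).1).compl₁₂ (L.evalAt (B.pt m)) (L.evalAt (B.pt m))

lemma redPairing_eq {m : M} (p : B.Fibre m) (a b : L.RedFibre m) :
    L.redPairing m a b = C.pairing p.1 (a.1 p) (b.1 p) := by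
  obtain ⟨g, hg⟩ := B.exists_actFibre (B.pt m) p
  rw [hg]
  have ha : a.1 (B.actFibre (B.pt m) g) = L.R g _ (a.1 (B.pt m)) := a.2.2 (B.pt m) g
  have hb : b.1 (B.actFibre (B.pt m) g) = L.R g _ (b.1 (B.pt m)) := b.2.2 (B.pt m) g
  rw [ha, hb]
  exact (L.R_pairing g (B.pt m).1 _ _).symm

/-- The anchor `π : E → T` of `E`. -/
def redAnchor (m : M) : L.RedFibre m →ₗ[ℝ] TangentSpace 𝓘(ℝ, EM) m :=
  (B.dproj (B.pt m)).comp ((C.anchor (B.pt m).1).comp (L.evalAt (B.pt m)))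

lemma redAnchor_eq {m : M} (p : B.Fibre m) (a : L.RedFibre m) :
    L.redAnchor m a = B.dproj p (C.anchor p.1 (a.1 p)) := by
  obtain ⟨g, hg⟩ := B.exists_actFibre (B.pt m) p
  rw [hg]
  have ha : a.1 (B.actFibre (B.pt m) g) = L.R g _ (a.1 (B.pt m)) := a.2.2 (B.pt m) g
  rw [ha, L.R_anchor, B.dproj_dact]
  rfl

/-- The bracket preserves the invariant sections of `K^⊥`. -/
lemma bracket_mem (a b : L.RedSection) : C.bracket a.1 b.1 ∈ L.RedSection := by
  refine ⟨fun p z => ?_, fun p g => ?_⟩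
  · -- `[ρ(z), a] = 0` by invariance
    have h1 : C.bracket (L.ρ z) a.1 p = 0 := by
      refine (Module.forall_dual_apply_eq_zero_iff ℝ _).1 fun ℓ => ?_
      rw [← L.infinitesimal]
      have : (fun g : G => ℓ ((L.R g p).symm (a.1 (B.act p g)))) = fun _ => ℓ (a.1 p) := by
        funext g
        rw [a.2.2, LinearEquiv.symm_apply_apply]
      rw [this, mfderiv_const]
      rfl
    have h0 : ∀ b : L.RedSection,
        (fun q => C.pairing q (b.1 q) (L.ρ z q)) = fun _ => (0 : ℝ) :=
      fun b => funext fun q => b.2.1 q z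
    have hd : ∀ X : RoughField EP P, dirDeriv X (fun _ => (0 : ℝ)) p = 0 := by
      intro X
      rw [dirDeriv, mfderiv_const]
      rfl
    have h2 := C.metric_compat a.1 b.1 (L.ρ z) p
    rw [h0, hd] at h2
    have h3 := C.bracket_self a.1 b.1 p
    have h4 := C.bracket_self (L.ρ z) b.1 p
    have h5 := C.bracket_self (a.1 + L.ρ z) b.1 p
    have h6 : (fun q => C.pairing q ((a.1 + L.ρ z) q) ((a.1 + L.ρ z) q)) =
        (fun q => C.pairing q (a.1 q) (a.1 q)) + fun q => C.pairing q (L.ρ z q) (L.ρ z q) := by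
      funext q
      have h7 : C.pairing q (a.1 q) (L.ρ z q) = 0 := a.2.1 q z
      have h8 : C.pairing q (L.ρ z q) (a.1 q) = 0 := by rw [C.pairing_symm, h7]
      simp [h7, h8]
    have h9 : ∀ X : RoughField EP P, dirDeriv X ((fun q => C.pairing q (a.1 q) (a.1 q)) +
        fun q => C.pairing q (L.ρ z q) (L.ρ z q)) p =
        dirDeriv X (fun q => C.pairing q (a.1 q) (a.1 q)) p +
        dirDeriv X (fun q => C.pairing q (L.ρ z q) (L.ρ z q)) p := by
      intro X
      rw [dirDeriv, mfderiv_add ((C.pairing_smooth a.1 a.1).mdifferentiable (by simp) p)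
        ((C.pairing_smooth (L.ρ z) (L.ρ z)).mdifferentiable (by simp) p)]
      rfl
    rw [h6, h9] at h5
    simp only [map_add, LinearMap.add_apply, ContMDiffSection.coe_add, Pi.add_apply, h1,
      map_zero, LinearMap.zero_apply] at h5
    have h10 := C.pairing_symm p (b.1 p) (C.bracket a.1 (L.ρ z) p)
    linarith
  · exact L.R_bracket g a.1 b.1 a.1 b.1 (fun p => a.2.2 p g) (fun p => b.2.2 p g) p

/-- The Dorfman bracket on sections of `E`, the restriction of the one of `Ê`. -/
def redBracket (a b : L.RedSection) : L.RedSection :=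
  ⟨C.bracket a.1 b.1, L.bracket_mem a b⟩

variable [FiniteDimensional ℝ F]

lemma _root_.TransitiveCourant.finiteDimensional_fibre (F : Type*) [NormedAddCommGroup F]
    [NormedSpace ℝ F] (Eh : P → Type*)
    [TopologicalSpace (TotalSpace F Eh)] [∀ p, AddCommGroup (Eh p)] [∀ p, Module ℝ (Eh p)]
    [∀ p, TopologicalSpace (Eh p)] [FiberBundle F Eh] [VectorBundle ℝ F Eh]
    [FiniteDimensional ℝ F] (p : P) : FiniteDimensional ℝ (Eh p) :=
  ((trivializationAt F Eh p).continuousLinearEquivAt ℝ p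
    (FiberBundle.mem_baseSet_trivializationAt' p)).symm.toLinearEquiv.finiteDimensional

/-- The inclusion `½π* : T*P → Ê* ≅ Ê`. -/
def _root_.TransitiveCourant.ExactCourantAlgebroid.cot (C : ExactCourantAlgebroid EP P F Eh)
    (p : P) : Module.Dual ℝ (TangentSpace 𝓘(ℝ, EP) p) →ₗ[ℝ] Eh p :=
  haveI := finiteDimensional_fibre F Eh p
  (1 / 2 : ℝ) • ((C.pairing p).toDual (C.pairing_nondeg p)).symm.toLinearMap.comp
    (C.anchor p).dualMap

lemma _root_.TransitiveCourant.ExactCourantAlgebroid.pairing_cot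
    (C : ExactCourantAlgebroid EP P F Eh) (p : P)
    (ξ : Module.Dual ℝ (TangentSpace 𝓘(ℝ, EP) p)) (e : Eh p) :
    C.pairing p (C.cot p ξ) e = (1 / 2 : ℝ) * ξ (C.anchor p e) := by
  have := finiteDimensional_fibre F Eh p
  simp [ExactCourantAlgebroid.cot]

/-- The inclusion `T*M → E`, `ξ ↦ ½π*(ξ)`, where on `P` the form `ξ` is pulled back. -/
def redCot (m : M) : Module.Dual ℝ (TangentSpace 𝓘(ℝ, EM) m) →ₗ[ℝ] L.RedFibre m where
  toFun ξ := ⟨fun p => C.cot p.1 (ξ ∘ₗ B.dproj p), by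
    refine ⟨fun p z => ?_, fun p g => ?_⟩
    · rw [C.pairing_cot, L.anchor_ρ]
      simp [B.dproj_fund]
    · have h : ∀ e, C.pairing (B.act p.1 g) (C.cot (B.act p.1 g) (ξ ∘ₗ B.dproj (B.actFibre p g)) -
          L.R g p.1 (C.cot p.1 (ξ ∘ₗ B.dproj p))) e = 0 := by
        intro e
        obtain ⟨e, rfl⟩ := (L.R g p.1).surjective e
        rw [map_sub, LinearMap.sub_apply, L.R_pairing, C.pairing_cot, C.pairing_cot, L.R_anchor,
          LinearMap.comp_apply, B.dproj_dact, LinearMap.comp_apply, sub_self]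
      exact sub_eq_zero.1 ((C.pairing_nondeg _).1 _ h)⟩
  map_add' ξ η := by
    refine Subtype.ext (funext fun p => ?_)
    simp [LinearMap.add_comp]
  map_smul' r ξ := by
    refine Subtype.ext (funext fun p => ?_)
    simp [LinearMap.smul_comp]

/-! ## Isotropic splittings -/

/-- A smooth isotropic splitting `λ : T → E`. -/
@[ext] structure IsotropicSplitting where
  toFun : (m : M) → TangentSpace 𝓘(ℝ, EM) m →ₗ[ℝ] L.RedFibre m
  anchor_toFun : ∀ m X, L.redAnchor m (toFun m X) = X
  isotropic : ∀ m X Y, L.redPairing m (toFun m X) (toFun m Y) = 0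
  smooth : ∀ X : RoughField EM M, IsSmoothField X →
    ∃ a : L.RedSection, ∀ m, RedSection.eval a m = toFun m (X m)

namespace IsotropicSplitting

variable {L} (l : L.IsotropicSplitting)

/-- `λ` is a splitting with connection `A`: the composition `T → E → Q = TP/G` of `λ` with `π_Q` is
the horizontal lift of `A`. -/
def Induces (A : Connection B) : Prop :=
  ∀ m X (p : B.Fibre m), A.toFun p.1 (C.anchor p.1 ((l.toFun m X).1 p)) = 0

/-- The image of `ad P` under the isomorphism `Ψ_λ : T ⊕ ad P ⊕ T* → E`, that is, the elements of
`Ker π` that are orthogonal to the image of `λ`. -/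
def adPart (m : M) : Submodule ℝ (L.RedFibre m) where
  carrier := {s | L.redAnchor m s = 0 ∧ ∀ X, L.redPairing m s (l.toFun m X) = 0}
  zero_mem' := by simp
  add_mem' := by
    rintro a b ⟨ha, ha'⟩ ⟨hb, hb'⟩
    exact ⟨by simp [ha, hb], fun X => by simp [ha', hb']⟩
  smul_mem' := by
    rintro r a ⟨ha, ha'⟩
    exact ⟨by simp [ha], fun X => by simp [ha']⟩

/-- The component in `T*` of an element of `E` in the splitting `λ`. -/
def cotPart (m : M) (e : L.RedFibre m) : Module.Dual ℝ (TangentSpace 𝓘(ℝ, EM) m) :=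
  (2 : ℝ) • (L.redPairing m e).comp (l.toFun m)

/-- If `e = Ψ_λ(X + r + ξ)`, where `Ψ_λ(r) = s`, then `ξ` is the component of `e` in `T*`. -/
lemma cotPart_eq (m : M) (X : TangentSpace 𝓘(ℝ, EM) m) (s : L.RedFibre m) (hs : s ∈ l.adPart m)
    (ξ : Module.Dual ℝ (TangentSpace 𝓘(ℝ, EM) m)) :
    l.cotPart m (l.toFun m X + s + L.redCot m ξ) = ξ := by
  refine LinearMap.ext fun Y => ?_
  have h1 : L.redPairing m (L.redCot m ξ) (l.toFun m Y) = (1 / 2 : ℝ) * ξ Y := by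
    rw [L.redPairing_eq (B.pt m)]
    refine (C.pairing_cot _ _ _).trans ?_
    rw [LinearMap.comp_apply]
    change (1 / 2 : ℝ) * ξ (L.redAnchor m (l.toFun m Y)) = _
    rw [l.anchor_toFun]
  simp only [cotPart, LinearMap.smul_apply, LinearMap.comp_apply, map_add, LinearMap.add_apply,
    l.isotropic, hs.2 Y, h1, smul_eq_mul]
  ring

/-- The bracket of `E` in the splitting `λ` is
`[X + ξ, Y + η] = [X, Y] + L_{pX} η - i_{pY} dξ + i_{pY} i_{pX} H`
`  + 2c(∇^A(AX), AY) + 2c(F(X, ·), AY) - 2c(F(Y, ·), AX)`.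
Here a section `e` of `E` corresponds to `X + ξ ∈ Γ(TP/G ⊕ T*)`, where `X = π_Q(e)` is seen as a
vector field on `P` and `ξ` is the component of `e` in `T*`. The equality of 1-forms on `M` is
evaluated on a smooth vector field `Z`, of which `Z'` is a smooth lift to `P`. -/
def BracketFormula (A : Connection B) (c : LinearMap.BilinForm ℝ (LieAlg EG G))
    (H : ThreeForm EM M) : Prop :=
  ∀ e₁ e₂ : L.RedSection,
    let X : RoughField EP P := fun p => C.anchor p (e₁.1 p)
    let Y : RoughField EP P := fun p => C.anchor p (e₂.1 p)
    let pX : RoughField EM M := fun m => L.redAnchor m (RedSection.eval e₁ m)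
    let pY : RoughField EM M := fun m => L.redAnchor m (RedSection.eval e₂ m)
    let ξ := fun m => l.cotPart m (RedSection.eval e₁ m)
    let η := fun m => l.cotPart m (RedSection.eval e₂ m)
    let AX : P → LieAlg EG G := fun p => A.toFun p (X p)
    let AY : P → LieAlg EG G := fun p => A.toFun p (Y p)
    (∀ p, C.anchor p ((L.redBracket e₁ e₂).1 p) = lieBr X Y p) ∧
    ∀ (Z : RoughField EM M) (Z' : RoughField EP P), IsSmoothField Z → IsSmoothField Z' →
      B.IsLift Z' Z → ∀ (m : M) (p : B.Fibre m),
      l.cotPart m (RedSection.eval (L.redBracket e₁ e₂) m) (Z m) =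
        lieDerivOneForm pX η Z m - extDerivOneForm ξ pY Z m + H.toFun m ![pX m, pY m, Z m]
          + 2 * c (A.cov Z' AX p.1) (AY p.1)
          + 2 * c (A.curv X Z' p.1) (AY p.1) - 2 * c (A.curv Y Z' p.1) (AX p.1)

end IsotropicSplitting

/-! ## Admissible metrics -/

/-- `V` is a smooth subbundle of `E`. -/
def IsSubbundle (V : (m : M) → Submodule ℝ (L.RedFibre m)) : Prop :=
  ∀ m, ∃ (r : ℕ) (s : Fin r → L.RedSection) (U : Set M), IsOpen U ∧ m ∈ U ∧ ∀ m' ∈ U,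
    LinearIndependent ℝ (fun i => RedSection.eval (s i) m') ∧
    Submodule.span ℝ (Set.range fun i => RedSection.eval (s i) m') = V m'

/-- `V` is a generalized metric: a subbundle on which the metric of `E` is nondegenerate. -/
def IsGeneralizedMetric (V : (m : M) → Submodule ℝ (L.RedFibre m)) : Prop :=
  L.IsSubbundle V ∧ ∀ m, ((L.redPairing m).restrict (V m)).Nondegenerate

/-- `V` is an admissible metric: a generalized metric with `V ∩ T* = 0` and
`rk V = rk E - dim M`. -/
def IsAdmissible (V : (m : M) → Submodule ℝ (L.RedFibre m)) : Prop :=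
  L.IsGeneralizedMetric V ∧ ∀ m, V m ⊓ LinearMap.range (L.redCot m) = ⊥ ∧
    Module.finrank ℝ (V m) + Module.finrank ℝ EM = Module.finrank ℝ (L.RedFibre m)

/-- The element `λ(X) + g(X)` of `E`. -/
def graphVec (g : PseudoMetric EM M) (l : L.IsotropicSplitting) (m : M)
    (X : TangentSpace 𝓘(ℝ, EM) m) : L.RedFibre m :=
  l.toFun m X + L.redCot m (g.toFun m X)

/-- `(g, λ)` is the metric on `T` and the isotropic splitting determined by `V`: the lift
`π_⊥⁻¹ : T → (V ∩ Ker π)^⊥ ⊂ V` is `λ + g`, and it is an isometry for `g`. (It is automatic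
that `λ(X) + g(X)` projects to `X`.) -/
def IsDeterminedPair (V : (m : M) → Submodule ℝ (L.RedFibre m)) (g : PseudoMetric EM M)
    (l : L.IsotropicSplitting) : Prop :=
  ∀ m, (∀ X, L.graphVec g l m X ∈ V m ∧
      ∀ v ∈ V m, L.redAnchor m v = 0 → L.redPairing m (L.graphVec g l m X) v = 0) ∧
    ∀ X Y, g.toFun m X Y = L.redPairing m (L.graphVec g l m X) (L.graphVec g l m Y)

/-- `V = {X + g(X) + r : X ∈ T, r ∈ ad P}` in the splitting `λ`. -/
def IsGraph (V : (m : M) → Submodule ℝ (L.RedFibre m)) (g : PseudoMetric EM M)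
    (l : L.IsotropicSplitting) : Prop :=
  ∀ m e, e ∈ V m ↔ ∃ X, ∃ s ∈ l.adPart m, e = L.graphVec g l m X + s

/-- The transformation `e ↦ e + i_{π(e)} b` of `E`, for a 2-form `b` on `M`. -/
def bTransform (b : TwoForm EM M) (m : M) : L.RedFibre m →ₗ[ℝ] L.RedFibre m :=
  LinearMap.id + (L.redCot m).comp (LinearMap.comp (b.toFun m) (L.redAnchor m))

/-- `V = {X + g(X) + r : X ∈ T, r ∈ ad P}` in some splitting of `E` with connection `A`. -/
def IsAssociated (V : (m : M) → Submodule ℝ (L.RedFibre m)) (g : PseudoMetric EM M)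
    (A : Connection B) : Prop :=
  ∃ l : L.IsotropicSplitting, l.Induces A ∧ L.IsGraph V g l

end LiftedAction

end TransitiveCourant

end

open scoped Manifold ContDiff Bundle Topology
open Bundle VectorField

set_option linter.unusedSectionVars false

noncomputable section

namespace TransitiveCourant

/-! ## Smooth families of linear systems -/

section LinearSystems

variable {E : Type*} [NormedAddCommGroup E] [NormedSpace ℝ E]
  {N : Type*} [TopologicalSpace N] [ChartedSpace E N]
  {V₁ : Type*} [NormedAddCommGroup V₁] [NormedSpace ℝ V₁] [FiniteDimensional ℝ V₁]
  {V₂ : Type*} [NormedAddCommGroup V₂] [NormedSpace ℝ V₂] [FiniteDimensional ℝ V₂]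

/-! Nondegeneracy of `c` gives `Ê = K ⊕ K^⊥` (`exists_add_ρ_orthogonal`). As `G` acts freely and
transitively on the fibres of `P`, a vector of `K^⊥` at one point of a fibre is the value of exactly
one element of `E` (`exists_redFibre_eq`, `evalAt_injective`). So linear algebra in `E` can be done
at a single point of `P`: the metric of `E` is nondegenerate, its anchor is onto, and `T* = (Ker
π)^⊥` (`exists_redCot_of_orthogonal`).

Let `V` be admissible. A rank count gives `E = V ⊕ T*`. An element of `V ∩ Ker π` orthogonal to `V ∩
Ker π` is then orthogonal to all of `Ker π`, so it lies in `V ∩ T* = 0`. Thus the metric is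
nondegenerate on `V ∩ Ker π`, and the orthogonal complement of this space in `V` maps isomorphically
onto `T` (`exists_perp_lift`). With `u` the inverse map, `g` is the pullback of the metric by `u`,
and `λ = u - g` is isotropic because each of the two cross terms contributes `-g/2`. Smoothness of
`u` is the one analytic point: `u(X)` is part of the solution of an invertible smooth linear system,
with a Lagrange multiplier (`exists_redSection_perp_lift`). A splitting lifts `T` to `TP`
equivariantly, so it determines a connection (`existsUnique_connection`).

For the bracket, put `H(X, Y, Z) = 2⟨[λX, λY], λZ⟩`. Since `λ` is isotropic, the derivative terms in
the Courant axioms vanish and this is totally skew; being tensorial in `Z`, it is a 3-form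
(`exists_threeForm`). The bracket formula follows by decomposing both sections along `T ⊕ ad P ⊕ T*`
and pairing with `λZ`, which gives nine terms, each computed from metric compatibility and the
symmetric part of the bracket (`Induces.bracketFormula`). The equation for `dH` is the Jacobi
identity of `λX₀, λX₁, λX₂` paired with `λX₃`: metric compatibility leaves derivatives of `H` and
products `⟨[λXᵢ, λXⱼ], [λXₖ, λXₙ]⟩`, and the formula for the metric in the splitting turns the
latter into values of `H` on brackets plus terms `c(F, F)` (`Induces.structureEq`).

For the converse, compose an equivariant isotropic splitting of `Ê` with the horizontal lift of `A`
and subtract `π*⟨·, ρ(A)⟩`. The result lies in `K^⊥`, has the same anchor, and is still isotropic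
because `A` kills horizontal vectors (`exists_induces`). In the graph of `g`, the summands `(λ +
g)(T)` and `ad P` are orthogonal and carry the nondegenerate metrics `g` and `c`, whence
admissibility (`IsGraph.isAdmissible`). Two splittings with the same connection differ by a map `T →
T*`, which isotropy forces to be skew; this 2-form moves one graph to the other
(`IsAssociated.iff_exists_map`). -/

/-- A family of linear maps on a finite-dimensional space is smooth if it is so pointwise. -/
lemma contMDiffAt_toContinuousLinearMap {Φ : N → V₁ →ₗ[ℝ] V₂} {b₀ : N}
    (h : ∀ v, ContMDiffAt 𝓘(ℝ, E) 𝓘(ℝ, V₂) ∞ (fun b => Φ b v) b₀) :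
    ContMDiffAt 𝓘(ℝ, E) 𝓘(ℝ, V₁ →L[ℝ] V₂) ∞
      (fun b => LinearMap.toContinuousLinearMap (Φ b)) b₀ := by
  let β := Module.finBasis ℝ V₁
  -- The operator is a sum of rank-one maps over a basis, whose vector factors are the columns `Φ b
  -- (β i)`.
  have hs : (fun b => LinearMap.toContinuousLinearMap (Φ b)) = fun b =>
      ∑ i, ContinuousLinearMap.smulRightL ℝ V₁ V₂
        (LinearMap.toContinuousLinearMap (β.coord i)) (Φ b (β i)) := by
    funext b
    ext v
    conv_lhs => rw [← β.sum_repr v]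
    rw [map_sum, _root_.sum_apply]
    simp
  rw [hs]
  refine contMDiffAt_finsetSum fun i _ => ?_
  exact (ContinuousLinearMap.contMDiff (ContinuousLinearMap.smulRightL ℝ V₁ V₂
    (LinearMap.toContinuousLinearMap (β.coord i)))).contMDiffAt.comp b₀ (h (β i))

/-- The invertible operators form an open set in the operator norm, and the family is continuous
into that space. -/
lemma eventually_bijective {Φ : N → V₁ →ₗ[ℝ] V₂} {b₀ : N}
    (h : ∀ v, ContMDiffAt 𝓘(ℝ, E) 𝓘(ℝ, V₂) ∞ (fun b => Φ b v) b₀)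
    (hb : Function.Bijective (Φ b₀)) : ∀ᶠ b in 𝓝 b₀, Function.Bijective (Φ b) := by
  have h1 := (contMDiffAt_toContinuousLinearMap h).continuousAt
  let e₀ := (LinearEquiv.ofBijective (Φ b₀) hb).toContinuousLinearEquiv
  have h2 := ContinuousLinearEquiv.nhds e₀
  have h3 : (e₀ : V₁ →L[ℝ] V₂) = LinearMap.toContinuousLinearMap (Φ b₀) := by
    ext v; rfl
  rw [h3] at h2
  filter_upwards [h1 h2] with b hb'
  obtain ⟨e, he⟩ := hb'
  have : (Φ b : V₁ → V₂) = e := by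
    funext v
    exact (congrArg (fun f : V₁ →L[ℝ] V₂ => f v) he).symm
  rw [this]
  exact e.bijective

/-- The solution of a smooth family of invertible linear systems is smooth. -/
lemma contMDiffAt_of_linear_system {Φ : N → V₁ →ₗ[ℝ] V₂} {b₀ : N}
    (h : ∀ v, ContMDiffAt 𝓘(ℝ, E) 𝓘(ℝ, V₂) ∞ (fun b => Φ b v) b₀)
    (hb : Function.Bijective (Φ b₀)) {x : N → V₁} {y : N → V₂}
    (hy : ContMDiffAt 𝓘(ℝ, E) 𝓘(ℝ, V₂) ∞ y b₀) (hxy : ∀ᶠ b in 𝓝 b₀, Φ b (x b) = y b) :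
    ContMDiffAt 𝓘(ℝ, E) 𝓘(ℝ, V₁) ∞ x b₀ := by
  have h1 := contMDiffAt_toContinuousLinearMap h
  let e₀ := (LinearEquiv.ofBijective (Φ b₀) hb).toContinuousLinearEquiv
  have h3 : (e₀ : V₁ →L[ℝ] V₂) = LinearMap.toContinuousLinearMap (Φ b₀) := by
    ext v; rfl
  have h4 : ContMDiffAt 𝓘(ℝ, E) 𝓘(ℝ, V₂ →L[ℝ] V₁) ∞
      (fun b => ContinuousLinearMap.inverse (LinearMap.toContinuousLinearMap (Φ b))) b₀ := by
    have := (contDiffAt_map_inverse (n := ∞) e₀).contMDiffAt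
    rw [h3] at this
    exact this.comp b₀ h1
  -- `ContinuousLinearMap.inverse` is a total function and is smooth at an invertible operator. It
  -- is the true inverse where `Φ b` is bijective, which holds near `b₀`, so there `x = Φ⁻¹ y`.
  refine (h4.clm_apply hy).congr_of_eventuallyEq ?_
  filter_upwards [hxy, eventually_bijective h hb] with b hb1 hb2
  let e := (LinearEquiv.ofBijective (Φ b) hb2).toContinuousLinearEquiv
  have h5 : LinearMap.toContinuousLinearMap (Φ b) = (e : V₁ →L[ℝ] V₂) := by
    ext v; rfl
  rw [h5, ContinuousLinearMap.inverse_equiv, ← hb1]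
  exact (e.symm_apply_apply (x b)).symm

end LinearSystems

/-! ## Local frames of global sections -/

section Frames

variable {E : Type*} [NormedAddCommGroup E] [NormedSpace ℝ E] [FiniteDimensional ℝ E]
  {N : Type*} [TopologicalSpace N] [T2Space N] [ChartedSpace E N] [IsManifold 𝓘(ℝ, E) ∞ N]
  {F : Type*} [NormedAddCommGroup F] [NormedSpace ℝ F] {V : N → Type*}
  [TopologicalSpace (TotalSpace F V)] [∀ b, AddCommGroup (V b)] [∀ b, Module ℝ (V b)]
  [∀ b, TopologicalSpace (V b)] [FiberBundle F V] [VectorBundle ℝ F V]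
  [ContMDiffVectorBundle ∞ F V 𝓘(ℝ, E)]

/-- A smooth function that is `1` near a point and supported in a given neighbourhood. -/
lemma exists_bump {b₀ : N} {U : Set N} (hU : U ∈ 𝓝 b₀) :
    ∃ χ : N → ℝ, ContMDiff 𝓘(ℝ, E) 𝓘(ℝ, ℝ) ∞ χ ∧ tsupport χ ⊆ U ∧ ∀ᶠ b in 𝓝 b₀, χ b = 1 := by
  obtain ⟨f, -, hf⟩ := (SmoothBumpFunction.nhds_basis_tsupport (I := 𝓘(ℝ, E)) b₀).mem_iff.1 hU
  exact ⟨f, f.contMDiff, hf, f.eventuallyEq_one⟩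

/-- Around every point there are global smooth sections that are constant in the trivialization. -/
lemma exists_frame (b₀ : N) : ∃ X : F →ₗ[ℝ] Cₛ^∞⟮𝓘(ℝ, E); F, V⟯, ∀ᶠ b in 𝓝 b₀,
    b ∈ (trivializationAt F V b₀).baseSet ∧
    ∀ v, X v b = (trivializationAt F V b₀).symm b v := by
  set e := trivializationAt F V b₀
  obtain ⟨χ, hχ, hs, h1⟩ := exists_bump (E := E) (b₀ := b₀) (U := e.baseSet)
    (e.open_baseSet.mem_nhds (FiberBundle.mem_baseSet_trivializationAt' b₀))
  have hsm : ∀ v : F, ContMDiffOn 𝓘(ℝ, E) (𝓘(ℝ, E).prod 𝓘(ℝ, F)) ∞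
      (fun b => (⟨b, e.symm b v⟩ : TotalSpace F V)) e.baseSet := by
    intro v
    have h := e.contMDiffOn_symm (n := ∞) (IB := 𝓘(ℝ, E))
    have h2 : ContMDiffOn 𝓘(ℝ, E) (𝓘(ℝ, E).prod 𝓘(ℝ, F)) ∞ (fun b : N => ((b, v) : N × F))
        e.baseSet := (contMDiff_id.prodMk contMDiff_const).contMDiffOn
    refine (h.comp h2 (fun b hb => ?_)).congr fun b hb => ?_
    · rw [e.target_eq]; exact ⟨hb, trivial⟩
    · exact e.mk_symm hb v
  -- Linearity of `e.symm b` is only needed over the base set, since the bump function vanishes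
  -- elsewhere.
  have h0 : ∀ b ∉ e.baseSet, χ b = 0 := fun b hb =>
    image_eq_zero_of_notMem_tsupport fun h => hb (hs h)
  refine ⟨⟨⟨fun v => ⟨fun b => χ b • e.symm b v, ?_⟩, fun v w => ?_⟩, fun r v => ?_⟩, ?_⟩
  · exact ContMDiffOn.smul_section_of_tsupport hχ.contMDiffOn e.open_baseSet hs (hsm v)
  · ext b
    change χ b • e.symm b (v + w) = χ b • e.symm b v + χ b • e.symm b w
    by_cases hb : b ∈ e.baseSet
    · simp only [← e.symmL_apply (R := ℝ) hb, map_add, smul_add]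
    · simp [h0 b hb]
  · ext b
    change χ b • e.symm b (r • v) = r • χ b • e.symm b v
    by_cases hb : b ∈ e.baseSet
    · simp only [← e.symmL_apply (R := ℝ) hb, map_smul, smul_comm r]
    · simp [h0 b hb]
  · filter_upwards [h1, e.open_baseSet.mem_nhds (FiberBundle.mem_baseSet_trivializationAt' b₀)]
      with b hb hb'
    refine ⟨hb', fun v => ?_⟩
    change χ b • e.symm b v = _
    rw [hb, one_smul]

/-- The linear coordinates of a bundle in the preferred trivialization at `b₀`. -/
def coordAt (F : Type*) [NormedAddCommGroup F] [NormedSpace ℝ F] {V : N → Type*}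
    [TopologicalSpace (TotalSpace F V)] [∀ b, AddCommGroup (V b)] [∀ b, Module ℝ (V b)]
    [∀ b, TopologicalSpace (V b)] [FiberBundle F V] [VectorBundle ℝ F V] (b₀ b : N) :
    V b →ₗ[ℝ] F :=
  ((trivializationAt F V b₀).continuousLinearMapAt ℝ b).toLinearMap

lemma coordAt_eq {b₀ b : N} (hb : b ∈ (trivializationAt F V b₀).baseSet) (v : V b) :
    coordAt F b₀ b v = (trivializationAt F V b₀ ⟨b, v⟩).2 :=
  congrFun ((trivializationAt F V b₀).coe_linearMapAt_of_mem (R := ℝ) hb) v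

lemma symm_coordAt {b₀ b : N} (hb : b ∈ (trivializationAt F V b₀).baseSet) (v : V b) :
    (trivializationAt F V b₀).symm b (coordAt F b₀ b v) = v := by
  rw [coordAt_eq hb]
  exact (trivializationAt F V b₀).symm_apply_apply_mk hb v

lemma coordAt_symm {b₀ b : N} (hb : b ∈ (trivializationAt F V b₀).baseSet) (v : F) :
    coordAt F b₀ b ((trivializationAt F V b₀).symm b v) = v := by
  rw [coordAt_eq hb]
  exact congrArg Prod.snd ((trivializationAt F V b₀).apply_mk_symm hb v)

lemma coordAt_bijective {b₀ b : N} (hb : b ∈ (trivializationAt F V b₀).baseSet) :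
    Function.Bijective (coordAt (V := V) F b₀ b) :=
  ⟨Function.LeftInverse.injective (symm_coordAt hb),
    Function.RightInverse.surjective (coordAt_symm hb)⟩

lemma eventually_mem_baseSet (b₀ : N) :
    ∀ᶠ b in 𝓝 b₀, b ∈ (trivializationAt F V b₀).baseSet :=
  (trivializationAt F V b₀).open_baseSet.mem_nhds (FiberBundle.mem_baseSet_trivializationAt' b₀)

variable {E' : Type*} [NormedAddCommGroup E'] [NormedSpace ℝ E']
  {N' : Type*} [TopologicalSpace N'] [ChartedSpace E' N']

/-- Smoothness of a map into the total space, in terms of the linear coordinates. -/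
lemma contMDiffAt_totalSpace_coordAt {f : N' → N} {s : (x : N') → V (f x)} {x₀ : N'} :
    ContMDiffAt 𝓘(ℝ, E') (𝓘(ℝ, E).prod 𝓘(ℝ, F)) ∞ (fun x => (⟨f x, s x⟩ : TotalSpace F V)) x₀ ↔
      ContMDiffAt 𝓘(ℝ, E') 𝓘(ℝ, E) ∞ f x₀ ∧
      ContMDiffAt 𝓘(ℝ, E') 𝓘(ℝ, F) ∞ (fun x => coordAt F (f x₀) (f x) (s x)) x₀ := by
  rw [contMDiffAt_totalSpace]
  refine and_congr_right fun h => ?_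
  have hev : (fun x => coordAt F (f x₀) (f x) (s x)) =ᶠ[𝓝 x₀]
      fun x => (trivializationAt F V (f x₀) ⟨f x, s x⟩).2 := by
    filter_upwards [h.continuousAt (eventually_mem_baseSet (F := F) (V := V) (f x₀))] with x hx
    exact coordAt_eq hx _
  exact ⟨fun h' => h'.congr_of_eventuallyEq hev, fun h' => h'.congr_of_eventuallyEq hev.symm⟩

/-- Smooth combinations of smooth sections along a map are smooth. -/
lemma contMDiffAt_totalSpace_sum {ι : Type*} [Fintype ι] {f : N' → N} {s : ι → (x : N') → V (f x)}
    {c : ι → N' → ℝ} {x₀ : N'} (hf : ContMDiffAt 𝓘(ℝ, E') 𝓘(ℝ, E) ∞ f x₀)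
    (hs : ∀ i, ContMDiffAt 𝓘(ℝ, E') (𝓘(ℝ, E).prod 𝓘(ℝ, F)) ∞
      (fun x => (⟨f x, s i x⟩ : TotalSpace F V)) x₀)
    (hc : ∀ i, ContMDiffAt 𝓘(ℝ, E') 𝓘(ℝ, ℝ) ∞ (c i) x₀) :
    ContMDiffAt 𝓘(ℝ, E') (𝓘(ℝ, E).prod 𝓘(ℝ, F)) ∞
      (fun x => (⟨f x, ∑ i, c i x • s i x⟩ : TotalSpace F V)) x₀ := by
  rw [contMDiffAt_totalSpace_coordAt]
  refine ⟨hf, ?_⟩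
  simp only [map_sum, map_smul]
  exact contMDiffAt_finsetSum fun i _ => (hc i).smul (contMDiffAt_totalSpace_coordAt.1 (hs i)).2

end Frames

/-! ### Smoothness criteria for bundle maps and sections, by means of frames -/

section FrameConsequences

variable {E : Type*} [NormedAddCommGroup E] [NormedSpace ℝ E] [FiniteDimensional ℝ E]
  {N : Type*} [TopologicalSpace N] [T2Space N] [ChartedSpace E N] [IsManifold 𝓘(ℝ, E) ∞ N]
  {F : Type*} [NormedAddCommGroup F] [NormedSpace ℝ F] [FiniteDimensional ℝ F] {V : N → Type*}
  [TopologicalSpace (TotalSpace F V)] [∀ b, AddCommGroup (V b)] [∀ b, Module ℝ (V b)]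
  [∀ b, TopologicalSpace (V b)] [FiberBundle F V] [VectorBundle ℝ F V]
  [ContMDiffVectorBundle ∞ F V 𝓘(ℝ, E)]
  {E' : Type*} [NormedAddCommGroup E'] [NormedSpace ℝ E']
  {N' : Type*} [TopologicalSpace N'] [ChartedSpace E' N']
  {W : Type*} [NormedAddCommGroup W] [NormedSpace ℝ W]

/-- Evaluation of smooth sections at a point. -/
def evalSection (b : N) : Cₛ^∞⟮𝓘(ℝ, E); F, V⟯ →ₗ[ℝ] V b where
  toFun s := s b
  map_add' _ _ := rfl
  map_smul' _ _ := rfl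

/-- A field of linear forms that is smooth on smooth sections is smooth on smooth sections along
maps. -/
lemma contMDiffAt_apply_along {ξ : (b : N) → V b →ₗ[ℝ] W}
    (hξ : ∀ s : Cₛ^∞⟮𝓘(ℝ, E); F, V⟯, ContMDiff 𝓘(ℝ, E) 𝓘(ℝ, W) ∞ (fun b => ξ b (s b)))
    {f : N' → N} {s : (x : N') → V (f x)} {x₀ : N'}
    (hs : ContMDiffAt 𝓘(ℝ, E') (𝓘(ℝ, E).prod 𝓘(ℝ, F)) ∞
      (fun x => (⟨f x, s x⟩ : TotalSpace F V)) x₀) :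
    ContMDiffAt 𝓘(ℝ, E') 𝓘(ℝ, W) ∞ (fun x => ξ (f x) (s x)) x₀ := by
  obtain ⟨hf, hc⟩ := contMDiffAt_totalSpace_coordAt.1 hs
  obtain ⟨X, hX⟩ := exists_frame (E := E) (F := F) (V := V) (f x₀)
  let β := Module.finBasis ℝ F
  -- Near `x₀` the section is a combination of the frame pulled back by `f`, with its smooth
  -- coordinates as coefficients.
  have hev : (fun x => ξ (f x) (s x)) =ᶠ[𝓝 x₀] fun x =>
      ∑ i, β.coord i (coordAt F (f x₀) (f x) (s x)) • ξ (f x) (X (β i) (f x)) := by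
    filter_upwards [hf.continuousAt hX] with x hx
    have h1 : s x = X (coordAt F (f x₀) (f x) (s x)) (f x) := by
      rw [hx.2, symm_coordAt hx.1]
    let T : F →ₗ[ℝ] W := (ξ (f x)).comp ((evalSection (f x)).comp X)
    have h2 : ξ (f x) (s x) = T (coordAt F (f x₀) (f x) (s x)) := congrArg (ξ (f x)) h1
    rw [h2]
    conv_lhs => rw [← β.sum_repr (coordAt F (f x₀) (f x) (s x))]
    rw [map_sum]
    simp only [map_smul]
    rfl
  refine ContMDiffAt.congr_of_eventuallyEq ?_ hev
  refine contMDiffAt_finsetSum fun i _ => ?_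
  have h1 : ContMDiffAt 𝓘(ℝ, E') 𝓘(ℝ, ℝ) ∞
      (fun x => β.coord i (coordAt F (f x₀) (f x) (s x))) x₀ :=
    (ContinuousLinearMap.contMDiff
      (LinearMap.toContinuousLinearMap (β.coord i))).contMDiffAt.comp x₀ hc
  have h2 : ContMDiffAt 𝓘(ℝ, E') 𝓘(ℝ, W) ∞ (fun x => ξ (f x) (X (β i) (f x))) x₀ :=
    ContMDiffAt.comp x₀ (hξ (X (β i))).contMDiffAt hf
  exact h1.smul h2

/-- Every vector extends to a smooth section. -/
lemma exists_section_eq (b₀ : N) (v : V b₀) : ∃ s : Cₛ^∞⟮𝓘(ℝ, E); F, V⟯, s b₀ = v := by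
  obtain ⟨X, hX⟩ := exists_frame (E := E) (F := F) (V := V) b₀
  refine ⟨X (coordAt F b₀ b₀ v), ?_⟩
  rw [hX.self_of_nhds.2, symm_coordAt hX.self_of_nhds.1]

/-- A section is smooth if its value under a smooth, fibrewise bijective bundle map into a trivial
bundle is smooth. -/
lemma contMDiffAt_section_of_bijective [FiniteDimensional ℝ W] {T : (b : N) → V b →ₗ[ℝ] W} {b₀ : N}
    (hT : ∀ s : Cₛ^∞⟮𝓘(ℝ, E); F, V⟯, ContMDiffAt 𝓘(ℝ, E) 𝓘(ℝ, W) ∞ (fun b => T b (s b)) b₀)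
    (hb : Function.Bijective (T b₀)) {s : (b : N) → V b}
    (hs : ContMDiffAt 𝓘(ℝ, E) 𝓘(ℝ, W) ∞ (fun b => T b (s b)) b₀) :
    ContMDiffAt 𝓘(ℝ, E) (𝓘(ℝ, E).prod 𝓘(ℝ, F)) ∞ (fun b => (⟨b, s b⟩ : TotalSpace F V)) b₀ := by
  obtain ⟨X, hX⟩ := exists_frame (E := E) (F := F) (V := V) b₀
  refine (contMDiffAt_totalSpace_coordAt (f := fun b : N => b)).2 ⟨contMDiffAt_id, ?_⟩
  -- In the frame, the coordinates of `s` solve the linear system with matrix `T b ∘ X` and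
  -- right-hand side `T b (s b)`.
  let Φ : N → F →ₗ[ℝ] W := fun b =>
    { toFun := fun v => T b (X v b)
      map_add' := fun v w => by simp
      map_smul' := fun r v => by simp }
  refine contMDiffAt_of_linear_system (Φ := Φ) (fun v => hT (X v)) ?_ hs ?_
  · have : (Φ b₀ : F → W) = T b₀ ∘ (trivializationAt F V b₀).symm b₀ := by
      funext v
      exact congrArg (T b₀) (hX.self_of_nhds.2 v)
    rw [this]
    have h0 := hX.self_of_nhds.1
    exact hb.comp ⟨Function.LeftInverse.injective (coordAt_symm h0),
      Function.RightInverse.surjective (symm_coordAt h0)⟩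
  · filter_upwards [hX] with b hb'
    change T b (X _ b) = _
    rw [hb'.2, symm_coordAt hb'.1]

end FrameConsequences

/-! ## The local structure of principal bundles -/

section PrincipalBundle

variable {EG : Type*} [NormedAddCommGroup EG] [NormedSpace ℝ EG] [FiniteDimensional ℝ EG]
  {G : Type*} [TopologicalSpace G] [ChartedSpace EG G] [Group G] [LieGroup 𝓘(ℝ, EG) ∞ G]
  {EM : Type*} [NormedAddCommGroup EM] [NormedSpace ℝ EM] [FiniteDimensional ℝ EM]
  {M : Type*} [TopologicalSpace M] [ChartedSpace EM M]
  {EP : Type*} [NormedAddCommGroup EP] [NormedSpace ℝ EP] [FiniteDimensional ℝ EP]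
  {P : Type*} [TopologicalSpace P] [ChartedSpace EP P]

lemma mdifferentiableAt_conj (g h : G) :
    MDifferentiableAt 𝓘(ℝ, EG) 𝓘(ℝ, EG) (fun h : G => g * h * g⁻¹) h :=
  (((contMDiff_mul_right (I := 𝓘(ℝ, EG)) (n := ∞) (a := g⁻¹)).comp
    (contMDiff_mul_left (I := 𝓘(ℝ, EG)) (n := ∞) (a := g))).mdifferentiable (by simp)) h

/-- Chain rule for conjugation by `h` followed by conjugation by `g`. The outer derivative is taken
at `h * 1 * h⁻¹`, which is only propositionally `1`; the auxiliary variable `x` absorbs this. -/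
lemma adjoint_mul (g h : G) (z : LieAlg EG G) :
    adjoint (g * h) z = adjoint g (adjoint h z) := by
  have key : ∀ x : G, x = h * 1 * h⁻¹ →
      (mfderiv 𝓘(ℝ, EG) 𝓘(ℝ, EG) (fun y : G => g * h * y * (g * h)⁻¹) 1 z : EG) =
        (mfderiv 𝓘(ℝ, EG) 𝓘(ℝ, EG) (fun y : G => g * y * g⁻¹) x : EG →L[ℝ] EG)
          (mfderiv 𝓘(ℝ, EG) 𝓘(ℝ, EG) (fun y : G => h * y * h⁻¹) 1 z : EG) := by
    rintro x rfl
    have h1 := mfderiv_comp_apply (I := 𝓘(ℝ, EG)) (I' := 𝓘(ℝ, EG)) (I'' := 𝓘(ℝ, EG)) (1 : G)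
      (mdifferentiableAt_conj g (h * 1 * h⁻¹)) (mdifferentiableAt_conj h 1) z
    have h2 : (fun y : G => g * y * g⁻¹) ∘ (fun y : G => h * y * h⁻¹) =
        fun y : G => g * h * y * (g * h)⁻¹ := by
      funext y
      simp [mul_assoc]
    rw [h2] at h1
    exact h1
  exact key 1 (by simp)

lemma adjoint_one (z : LieAlg EG G) : adjoint (1 : G) z = z := by
  have key : ∀ f : G → G, f = id → (mfderiv 𝓘(ℝ, EG) 𝓘(ℝ, EG) f 1 z : EG) = z := by
    rintro _ rfl
    exact congrArg (fun f : EG →L[ℝ] EG => f z) (mfderiv_id (I := 𝓘(ℝ, EG)) (x := (1 : G)))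
  exact key _ (by funext h; simp)

lemma adjoint_adjoint_inv (g : G) (z : LieAlg EG G) : adjoint g (adjoint g⁻¹ z) = z := by
  rw [← adjoint_mul, mul_inv_cancel, adjoint_one]

lemma contMDiff_adjoint (z : LieAlg EG G) :
    IsSmoothFun (EM := EG) (W := EG) (fun g : G => adjoint g z) := by
  intro g₀
  have hconj : ContMDiff (𝓘(ℝ, EG).prod 𝓘(ℝ, EG)) 𝓘(ℝ, EG) ∞
      (Function.uncurry fun g h : G => g * h * g⁻¹) :=
    (contMDiff_fst.mul contMDiff_snd).mul (ContMDiff.inv (n := ∞) contMDiff_fst)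
  have : IsManifold 𝓘(ℝ, EG) ∞ G := ContMDiffMul.toIsManifold
  have h := ContMDiffAt.mfderiv (m := ∞) (n := ∞) (I := 𝓘(ℝ, EG)) (I' := 𝓘(ℝ, EG))
    (J := 𝓘(ℝ, EG)) (x₀ := g₀) (fun g h : G => g * h * g⁻¹) (fun _ => 1)
    hconj.contMDiffAt contMDiffAt_const (by simp)
  have h1 : (fun g : G => g * 1 * g⁻¹) = fun _ => 1 := by funext g; simp
  rw [h1] at h
  -- Smooth dependence of the derivative on `g` is known in tangent coordinates. Here source and
  -- target base points are constantly `1`, so the coordinate changes are the identity.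
  have h2 : ∀ (φ : G → EG →L[ℝ] EG) (g : G), inTangentCoordinates 𝓘(ℝ, EG) 𝓘(ℝ, EG)
      (fun _ : G => (1 : G)) (fun _ : G => (1 : G)) φ g₀ g = φ g := by
    intro φ g
    refine (inTangentCoordinates_eq (I := 𝓘(ℝ, EG)) (I' := 𝓘(ℝ, EG)) (fun _ : G => (1 : G))
      (fun _ : G => (1 : G)) φ (x₀ := g₀) (x := g) (mem_chart_source _ _)
      (mem_chart_source _ _)).trans ?_
    ext v
    have h4 : (1 : G) ∈ (tangentBundleCore 𝓘(ℝ, EG) G).baseSet (achart EG (1 : G)) :=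
      mem_chart_source _ _
    simp only [ContinuousLinearMap.comp_apply]
    rw [(tangentBundleCore 𝓘(ℝ, EG) G).coordChange_self _ _ h4,
      (tangentBundleCore 𝓘(ℝ, EG) G).coordChange_self _ _ h4]
  have h3 := h.clm_apply (contMDiffAt_const (c := @id EG z))
  exact h3.congr_of_eventuallyEq (Filter.Eventually.of_forall fun g =>
    (congrArg (fun f : EG →L[ℝ] EG => f z) (h2 (fun x => (mfderiv 𝓘(ℝ, EG) 𝓘(ℝ, EG)
      (fun h : G => x * h * x⁻¹) 1 : EG →L[ℝ] EG)) g)).symm)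

namespace PrincipalBundle

variable (B : PrincipalBundle EG G EM M EP P)

lemma contMDiff_act_left (p : P) : ContMDiff 𝓘(ℝ, EG) 𝓘(ℝ, EP) ∞ (fun g : G => B.act p g) :=
  B.contMDiff_act.comp (contMDiff_const.prodMk contMDiff_id)

/-- Through every point there is a smooth local section `σ` of the bundle; together with the
coordinate `k` along the fibres, relative to `σ`, it is equivalent to a local trivialization. -/
lemma exists_local_section (p₀ : P) : ∃ (U : Set M) (σ : M → P) (k : P → G),
    IsOpen U ∧ B.proj p₀ ∈ U ∧ ContMDiffOn 𝓘(ℝ, EM) 𝓘(ℝ, EP) ∞ σ U ∧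
    ContMDiffOn 𝓘(ℝ, EP) 𝓘(ℝ, EG) ∞ k (B.proj ⁻¹' U) ∧ σ (B.proj p₀) = p₀ ∧
    (∀ m ∈ U, B.proj (σ m) = m) ∧ (∀ q, B.proj q ∈ U → B.act (σ (B.proj q)) (k q) = q) ∧
    k p₀ = 1 ∧ ∀ q g, B.proj q ∈ U → k (B.act q g) = k q * g := by
  obtain ⟨U, φ, hU, hm, hs, ht, hφ1, hφ2, hφ⟩ := B.locally_trivial (B.proj p₀)
  have hp₀ : p₀ ∈ φ.source := by rw [hs]; exact hm
  have hmem : ∀ m ∈ U, ∀ g, ((m, g) : M × G) ∈ φ.target := fun m hm g => by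
    rw [ht]; exact ⟨hm, trivial⟩
  have hsrc : ∀ q, B.proj q ∈ U → q ∈ φ.source := fun q hq => by rw [hs]; exact hq
  -- Normalizing by the fibre coordinate of `p₀` makes the constant section `φ.symm (m, h₀)` pass
  -- through `p₀` and makes `k p₀ = 1`.
  set h₀ := (φ p₀).2
  have hpr : ∀ m ∈ U, B.proj (φ.symm (m, h₀)) = m := fun m hm => by
    rw [← (hφ _ (φ.map_target (hmem m hm h₀))).1, φ.right_inv (hmem m hm h₀)]
  refine ⟨U, fun m => φ.symm (m, h₀), fun q => h₀⁻¹ * (φ q).2, hU, hm, ?_, ?_, ?_, hpr, ?_, ?_, ?_⟩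
  · refine hφ2.comp (contMDiff_id.prodMk contMDiff_const).contMDiffOn fun m hm => ?_
    exact hmem m hm h₀
  · rw [← hs]
    exact (contMDiff_mul_left (I := 𝓘(ℝ, EG)) (n := ∞) (a := h₀⁻¹)).comp_contMDiffOn
      (contMDiff_snd.comp_contMDiffOn hφ1)
  · have : ((B.proj p₀, h₀) : M × G) = φ p₀ := by rw [← (hφ _ hp₀).1]
    exact (congrArg φ.symm this).trans (φ.left_inv hp₀)
  · intro q hq
    have h1 : B.act (φ.symm (B.proj q, h₀)) (h₀⁻¹ * (φ q).2) ∈ φ.source :=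
      hsrc _ (by rw [B.proj_act, hpr _ hq]; exact hq)
    refine φ.injOn h1 (hsrc q hq) ?_
    rw [(hφ _ (φ.map_target (hmem _ hq h₀))).2, φ.right_inv (hmem _ hq h₀)]
    refine Prod.ext ?_ ?_
    · exact ((hφ _ (hsrc q hq)).1).symm
    · simp
  · simp [h₀]
  · intro q g hq
    simp only [(hφ _ (hsrc q hq)).2, mul_assoc]

/-- The fibre coordinate satisfies `k (p · g) = g`, so its differential is a left inverse of `z ↦
Y_z(p)`. -/
lemma fund_injective (p : P) (z : LieAlg EG G) (hz : B.fund z p = 0) : z = 0 := by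
  obtain ⟨U, σ, k, hU, hm, hσ, hk, h1, h2, h3, h4, h5⟩ := B.exists_local_section p
  have hkp : ∀ q, q = p → MDifferentiableAt 𝓘(ℝ, EP) 𝓘(ℝ, EG) k q := by
    rintro q rfl
    exact (hk.contMDiffAt ((hU.preimage B.contMDiff_proj.continuous).mem_nhds hm)).mdifferentiableAt
      (by simp)
  have h6 := mfderiv_comp_apply (I := 𝓘(ℝ, EG)) (I' := 𝓘(ℝ, EP)) (I'' := 𝓘(ℝ, EG)) (1 : G)
    (g := k) (hkp _ (B.act_one p)) ((B.contMDiff_act_left p).mdifferentiable (by simp) 1) z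
  have h7 : k ∘ (fun g => B.act p g) = id := by
    funext g
    simp [h5 p g hm, h4]
  rw [h7] at h6
  have h8 : (mfderiv 𝓘(ℝ, EG) 𝓘(ℝ, EG) (id : G → G) 1 z : EG) = z :=
    congrArg (fun f : EG →L[ℝ] EG => f z) (mfderiv_id (I := 𝓘(ℝ, EG)) (x := (1 : G)))
  have h9 : (mfderiv 𝓘(ℝ, EG) 𝓘(ℝ, EP) (fun g : G => B.act p g) 1 z : EP) = 0 := hz
  refine (h8.symm.trans h6).trans ?_
  exact (congrArg _ h9).trans (map_zero _)

/-- The differential of a local section through `p` is a right inverse. -/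
lemma dproj_surjective {m : M} (p : B.Fibre m) : Function.Surjective (B.dproj p) := by
  obtain ⟨p, rfl⟩ := p
  obtain ⟨U, σ, k, hU, hm, hσ, hk, h1, h2, h3, h4, h5⟩ := B.exists_local_section p
  have hσm : MDifferentiableAt 𝓘(ℝ, EM) 𝓘(ℝ, EP) σ (B.proj p) :=
    (hσ.contMDiffAt (hU.mem_nhds hm)).mdifferentiableAt (by simp)
  intro v
  refine ⟨(mfderiv 𝓘(ℝ, EM) 𝓘(ℝ, EP) σ (B.proj p) v : EP), ?_⟩
  have h6 := mfderiv_comp_apply (I := 𝓘(ℝ, EM)) (I' := 𝓘(ℝ, EP)) (I'' := 𝓘(ℝ, EM)) (B.proj p)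
    (g := B.proj) (B.contMDiff_proj.mdifferentiable (by simp) _) hσm v
  have h7 : B.proj ∘ σ =ᶠ[𝓝 (B.proj p)] id := by
    filter_upwards [hU.mem_nhds hm] with m hm using h2 m hm
  have h8 : (mfderiv 𝓘(ℝ, EM) 𝓘(ℝ, EM) (B.proj ∘ σ) (B.proj p) v : EM) = v := by
    rw [h7.mfderiv_eq]
    exact congrArg (fun f : EM →L[ℝ] EM => f v) (mfderiv_id (I := 𝓘(ℝ, EM)) (x := B.proj p))
  have key : ∀ q, q = p →
      (mfderiv 𝓘(ℝ, EP) 𝓘(ℝ, EM) B.proj q : EP →L[ℝ] EM)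
        (mfderiv 𝓘(ℝ, EM) 𝓘(ℝ, EP) σ (B.proj p) v : EP) =
      (mfderiv 𝓘(ℝ, EP) 𝓘(ℝ, EM) B.proj p : EP →L[ℝ] EM)
        (mfderiv 𝓘(ℝ, EM) 𝓘(ℝ, EP) σ (B.proj p) v : EP) := by
    rintro q rfl; rfl
  exact (key _ h1).symm.trans (h6.symm.trans h8)

/-- Differentiate `q = σ(proj q) · k(q)` along `v`. The first factor contributes nothing, as `v`
projects to zero, and the second one contributes `Y_w` with `w = dk(v)`. -/
lemma exists_fund_of_dproj_eq_zero {m : M} (p : B.Fibre m) (v : TangentSpace 𝓘(ℝ, EP) p.1)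
    (hv : B.dproj p v = 0) : ∃ z, v = B.fund z p.1 := by
  obtain ⟨p, rfl⟩ := p
  obtain ⟨U, σ, k, hU, hm, hσ, hk, h1, h2, h3, h4, h5⟩ := B.exists_local_section p
  have hU' : B.proj ⁻¹' U ∈ 𝓝 p := (hU.preimage B.contMDiff_proj.continuous).mem_nhds hm
  have hkp : MDifferentiableAt 𝓘(ℝ, EP) 𝓘(ℝ, EG) k p :=
    (hk.contMDiffAt hU').mdifferentiableAt (by simp)
  have hσm : MDifferentiableAt 𝓘(ℝ, EM) 𝓘(ℝ, EP) σ (B.proj p) :=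
    (hσ.contMDiffAt (hU.mem_nhds hm)).mdifferentiableAt (by simp)
  have hpr : MDifferentiableAt 𝓘(ℝ, EP) 𝓘(ℝ, EM) B.proj p :=
    B.contMDiff_proj.mdifferentiable (by simp) p
  have hσp : MDifferentiableAt 𝓘(ℝ, EP) 𝓘(ℝ, EP) (σ ∘ B.proj) p := hσm.comp p hpr
  have h6 : (mfderiv 𝓘(ℝ, EP) 𝓘(ℝ, EP) (σ ∘ B.proj) p v : EP) = 0 := by
    have := mfderiv_comp_apply (I := 𝓘(ℝ, EP)) (I' := 𝓘(ℝ, EM)) (I'' := 𝓘(ℝ, EP)) p hσm hpr v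
    refine this.trans ?_
    exact (congrArg (mfderiv 𝓘(ℝ, EM) 𝓘(ℝ, EP) σ (B.proj p)) hv).trans (map_zero _)
  have h7 : (fun x : P × G => B.act x.1 x.2) ∘ (fun q => ((σ ∘ B.proj) q, k q)) =ᶠ[𝓝 p] id := by
    filter_upwards [hU'] with q hq using h3 q hq
  have h8 : (mfderiv 𝓘(ℝ, EP) 𝓘(ℝ, EP)
      ((fun x : P × G => B.act x.1 x.2) ∘ (fun q => ((σ ∘ B.proj) q, k q))) p v : EP) = v := by
    rw [h7.mfderiv_eq]
    exact congrArg (fun f : EP →L[ℝ] EP => f v) (mfderiv_id (I := 𝓘(ℝ, EP)) (x := p))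
  have h9 := mfderiv_comp_apply (I := 𝓘(ℝ, EP)) (I' := 𝓘(ℝ, EP).prod 𝓘(ℝ, EG))
    (I'' := 𝓘(ℝ, EP)) p (g := fun x : P × G => B.act x.1 x.2)
    (f := fun q => ((σ ∘ B.proj) q, k q))
    (B.contMDiff_act.mdifferentiable (by simp) _) (hσp.prodMk hkp) v
  rw [mfderiv_prod_eq_add_apply (B.contMDiff_act.mdifferentiable (by simp) _),
    mfderiv_prodMk hσp hkp] at h9
  -- The partial derivative is taken at `(σ(proj p), k p)`, which equals `(p, 1)` only
  -- propositionally.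
  have key : ∀ (a : P) (b : G) (w : EG), a = p → b = 1 →
      (mfderiv 𝓘(ℝ, EG) 𝓘(ℝ, EP) (fun g : G => B.act a g) b w : EP) = B.fund w p := by
    rintro a b w rfl rfl; rfl
  let w : EG := mfderiv 𝓘(ℝ, EP) 𝓘(ℝ, EG) k p v
  refine ⟨w, ?_⟩
  refine (h8.symm.trans h9).trans ?_
  refine Eq.trans ?_ (key ((σ ∘ B.proj) p) (k p) w h1 h4)
  refine (congrArg₂ (fun a b : EP => a + b) ?_ rfl).trans (zero_add _)
  exact (congrArg (mfderiv 𝓘(ℝ, EP) 𝓘(ℝ, EP) (fun z : P => B.act z (k p))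
    ((σ ∘ B.proj) p)) h6).trans (map_zero _)

/-- Functions on `M` are smooth if their pullback to `P` is. -/
lemma contMDiff_of_comp_proj {E' N' : Type*} [NormedAddCommGroup E'] [NormedSpace ℝ E']
    [TopologicalSpace N'] {H' : Type*} [TopologicalSpace H'] {I' : ModelWithCorners ℝ E' H'}
    [ChartedSpace H' N'] {f : M → N'}
    (hf : ContMDiff 𝓘(ℝ, EP) I' ∞ (fun p => f (B.proj p))) : ContMDiff 𝓘(ℝ, EM) I' ∞ f := by
  intro m
  obtain ⟨p, rfl⟩ := B.nonempty_fibre m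
  obtain ⟨U, σ, k, hU, hm, hσ, hk, h1, h2, h3, h4, h5⟩ := B.exists_local_section p
  refine ((hf (σ (B.proj p))).comp _ (hσ.contMDiffAt (hU.mem_nhds hm))).congr_of_eventuallyEq ?_
  filter_upwards [hU.mem_nhds hm] with m hm
  simp [h2 m hm]

/-- Freeness of the action: the group element is read off from the fibre coordinate. -/
lemma act_injective (p : P) {g h : G} (hgh : B.act p g = B.act p h) : g = h := by
  obtain ⟨U, σ, k, hU, hm, hσ, hk, h1, h2, h3, h4, h5⟩ := B.exists_local_section p
  have := congrArg k hgh
  simpa [h5 _ _ hm] using this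

variable [IsManifold 𝓘(ℝ, EM) ∞ M] [IsManifold 𝓘(ℝ, EP) ∞ P]

lemma contMDiff_dproj {W : RoughField EP P} (hW : IsSmoothField W) :
    ContMDiff 𝓘(ℝ, EP) 𝓘(ℝ, EM).tangent ∞
      (fun p => (⟨B.proj p, B.dproj ⟨p, rfl⟩ (W p)⟩ : TangentBundle 𝓘(ℝ, EM) M)) :=
  (B.contMDiff_proj.contMDiff_tangentMap (m := ∞) (by simp)).comp hW

end PrincipalBundle

end PrincipalBundle

/-! ## Exact Courant algebroids -/

section Derivations

variable {EM : Type*} [NormedAddCommGroup EM] [NormedSpace ℝ EM]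
  {M : Type*} [TopologicalSpace M] [ChartedSpace EM M]

lemma dirDeriv_add (X : RoughField EM M) {f g : M → ℝ} (hf : IsSmoothFun (EM := EM) f)
    (hg : IsSmoothFun (EM := EM) g) (m : M) :
    dirDeriv X (fun m => f m + g m) m = dirDeriv X f m + dirDeriv X g m := by
  have h := mfderiv_add (hf.mdifferentiable (by simp) m) (hg.mdifferentiable (by simp) m)
  exact congrArg (fun φ : EM →L[ℝ] ℝ => φ (X m)) h

lemma dirDeriv_const_mul (X : RoughField EM M) {f : M → ℝ} (hf : IsSmoothFun (EM := EM) f)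
    (r : ℝ) (m : M) : dirDeriv X (fun m => r * f m) m = r * dirDeriv X f m := by
  have h := const_smul_mfderiv (hf.mdifferentiable (by simp) m) r
  exact congrArg (fun φ : EM →L[ℝ] ℝ => φ (X m)) h

lemma dirDeriv_const (X : RoughField EM M) (r : ℝ) (m : M) : dirDeriv X (fun _ => r) m = 0 := by
  rw [dirDeriv, mfderiv_const]; rfl

end Derivations

namespace ExactCourantAlgebroid

variable {EP : Type*} [NormedAddCommGroup EP] [NormedSpace ℝ EP] [FiniteDimensional ℝ EP]
  {P : Type*} [TopologicalSpace P] [T2Space P] [ChartedSpace EP P] [IsManifold 𝓘(ℝ, EP) ∞ P]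
  {F : Type*} [NormedAddCommGroup F] [NormedSpace ℝ F] [FiniteDimensional ℝ F]
  {Eh : P → Type*} [TopologicalSpace (TotalSpace F Eh)]
  [∀ p, AddCommGroup (Eh p)] [∀ p, Module ℝ (Eh p)] [∀ p, TopologicalSpace (Eh p)]
  [FiberBundle F Eh] [VectorBundle ℝ F Eh] [ContMDiffVectorBundle ∞ F Eh 𝓘(ℝ, EP)]
  (C : ExactCourantAlgebroid EP P F Eh)

lemma ext_pairing {p : P} {e e' : Eh p} (h : ∀ b, C.pairing p e b = C.pairing p e' b) : e = e' :=
  sub_eq_zero.1 ((C.pairing_nondeg p).1 _ fun b => by simp [h b])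

lemma anchor_cot (p : P) (ξ : Module.Dual ℝ (TangentSpace 𝓘(ℝ, EP) p)) :
    C.anchor p (C.cot p ξ) = 0 :=
  (C.exact_middle p _).2 ⟨(1 / 2 : ℝ) • ξ, fun e' => by rw [C.pairing_cot]; rfl⟩

lemma exists_cot {p : P} {e : Eh p} (h : C.anchor p e = 0) : ∃ ξ, e = C.cot p ξ := by
  obtain ⟨ξ, hξ⟩ := (C.exact_middle p e).1 h
  -- The factor `2` undoes the `½` in the embedding `cot`.
  refine ⟨(2 : ℝ) • ξ, C.ext_pairing fun b => ?_⟩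
  rw [hξ, C.pairing_cot]
  simp

/-- A section of `Ê` is smooth if its products with smooth sections are. -/
lemma contMDiff_of_pairing {e : (p : P) → Eh p}
    (h : ∀ b : Cₛ^∞⟮𝓘(ℝ, EP); F, Eh⟯,
      IsSmoothFun (EM := EP) (fun p => C.pairing p (e p) (b p))) :
    ContMDiff 𝓘(ℝ, EP) (𝓘(ℝ, EP).prod 𝓘(ℝ, F)) ∞ (fun p => (⟨p, e p⟩ : TotalSpace F Eh)) := by
  intro p₀
  obtain ⟨X, hX⟩ := exists_frame (E := EP) (F := F) (V := Eh) p₀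
  let β := Module.finBasis ℝ F
  -- Pairing with a frame maps `Ê` to a trivial bundle; at `p₀` this is injective by nondegeneracy
  -- and bijective by dimension, so `contMDiffAt_section_of_bijective` applies.
  let T : (p : P) → Eh p →ₗ[ℝ] (Fin (Module.finrank ℝ F) → ℝ) := fun p =>
    LinearMap.pi fun i => (C.pairing p).flip (X (β i) p)
  have hT : ∀ e : (p : P) → Eh p, (∀ b : Cₛ^∞⟮𝓘(ℝ, EP); F, Eh⟯,
      IsSmoothFun (EM := EP) (fun p => C.pairing p (e p) (b p))) →
      ContMDiffAt 𝓘(ℝ, EP) 𝓘(ℝ, Fin (Module.finrank ℝ F) → ℝ) ∞ (fun p => T p (e p)) p₀ :=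
    fun e he => contMDiffAt_pi_space.2 fun i => (he (X (β i))) p₀
  refine contMDiffAt_section_of_bijective (T := T)
    (fun s => hT (fun p => s p) fun b => C.pairing_smooth s b) ?_ (hT e h)
  have := finiteDimensional_fibre F Eh p₀
  have hinj : Function.Injective (T p₀) := by
    refine (injective_iff_map_eq_zero (T p₀)).2 fun e he => (C.pairing_nondeg p₀).1 e fun b => ?_
    have h1 : b = ((evalSection p₀).comp X) (coordAt F p₀ p₀ b) := by
      change b = X _ p₀
      rw [hX.self_of_nhds.2, symm_coordAt hX.self_of_nhds.1]
    have h2 : (C.pairing p₀ e).comp ((evalSection p₀).comp X) = 0 :=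
      β.ext fun i => congrFun he i
    rw [h1]
    exact LinearMap.congr_fun h2 _
  refine ⟨hinj, (LinearMap.injective_iff_surjective_of_finrank_eq_finrank ?_).1 hinj⟩
  rw [Module.finrank_fin_fun]
  exact (LinearEquiv.ofBijective _ (coordAt_bijective (V := Eh) (F := F)
    hX.self_of_nhds.1)).finrank_eq

/-- The symmetric part of the Dorfman bracket is exact. -/
lemma bracket_symm (a b d : Cₛ^∞⟮𝓘(ℝ, EP); F, Eh⟯) (p : P) :
    C.pairing p (C.bracket a b p) (d p) + C.pairing p (C.bracket b a p) (d p) =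
      dirDeriv (fun q => C.anchor q (d q)) (fun q => C.pairing q (a q) (b q)) p := by
  -- Polarization of the axiom for `[e, e]`, applied to `a`, `b` and `a + b`.
  have h1 := C.bracket_self a d p
  have h2 := C.bracket_self b d p
  have h3 := C.bracket_self (a + b) d p
  have h4 : (fun q => C.pairing q ((a + b) q) ((a + b) q)) = fun q =>
      (C.pairing q (a q) (a q) + C.pairing q (b q) (b q)) + 2 * C.pairing q (a q) (b q) := by
    funext q
    have := C.pairing_symm q (a q) (b q)
    simp only [ContMDiffSection.coe_add, Pi.add_apply, map_add, LinearMap.add_apply]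
    linarith
  have haa := C.pairing_smooth a a
  have hbb := C.pairing_smooth b b
  have hab := C.pairing_smooth a b
  have hsum : IsSmoothFun (EM := EP)
      (fun q => C.pairing q (a q) (a q) + C.pairing q (b q) (b q)) := haa.add hbb
  have htwo : IsSmoothFun (EM := EP) (fun q => 2 * C.pairing q (a q) (b q)) :=
    contMDiff_const.mul hab
  rw [h4, dirDeriv_add _ hsum htwo, dirDeriv_add _ haa hbb,
    dirDeriv_const_mul _ hab] at h3
  simp only [map_add, LinearMap.add_apply, ContMDiffSection.coe_add, Pi.add_apply] at h3
  linarith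

end ExactCourantAlgebroid

instance (EG G : Type*) [NormedAddCommGroup EG] [NormedSpace ℝ EG] [FiniteDimensional ℝ EG]
    [TopologicalSpace G] [ChartedSpace EG G] [Group G] : FiniteDimensional ℝ (LieAlg EG G) :=
  inferInstanceAs (FiniteDimensional ℝ EG)

instance (EM : Type*) [NormedAddCommGroup EM] [NormedSpace ℝ EM] [FiniteDimensional ℝ EM]
    {M : Type*} [TopologicalSpace M] [ChartedSpace EM M] (m : M) :
    FiniteDimensional ℝ (TangentSpace 𝓘(ℝ, EM) m) :=
  inferInstanceAs (FiniteDimensional ℝ EM)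

/-! ## The reduced Courant algebroid -/

namespace LiftedAction

section Reduced

variable {EG : Type*} [NormedAddCommGroup EG] [NormedSpace ℝ EG] [FiniteDimensional ℝ EG]
  {G : Type*} [TopologicalSpace G] [ChartedSpace EG G] [Group G] [LieGroup 𝓘(ℝ, EG) ∞ G]
  {EM : Type*} [NormedAddCommGroup EM] [NormedSpace ℝ EM] [FiniteDimensional ℝ EM]
  {M : Type*} [TopologicalSpace M] [T2Space M] [ChartedSpace EM M] [IsManifold 𝓘(ℝ, EM) ∞ M]
  {EP : Type*} [NormedAddCommGroup EP] [NormedSpace ℝ EP] [FiniteDimensional ℝ EP]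
  {P : Type*} [TopologicalSpace P] [T2Space P] [ChartedSpace EP P] [IsManifold 𝓘(ℝ, EP) ∞ P]
  {F : Type*} [NormedAddCommGroup F] [NormedSpace ℝ F] [FiniteDimensional ℝ F]
  {Eh : P → Type*} [TopologicalSpace (TotalSpace F Eh)]
  [∀ p, AddCommGroup (Eh p)] [∀ p, Module ℝ (Eh p)] [∀ p, TopologicalSpace (Eh p)]
  [FiberBundle F Eh] [VectorBundle ℝ F Eh] [ContMDiffVectorBundle ∞ F Eh 𝓘(ℝ, EP)]
variable {B : PrincipalBundle EG G EM M EP P} {C : ExactCourantAlgebroid EP P F Eh}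
  (L : LiftedAction B C) {c : LinearMap.BilinForm ℝ (LieAlg EG G)}

lemma contMDiff_fund (L : LiftedAction B C) (z : LieAlg EG G) : IsSmoothField (B.fund z) := by
  have h := C.anchor_smooth (L.ρ z)
  have h1 : (fun p => C.anchor p (L.ρ z p)) = B.fund z := funext fun p => L.anchor_ρ z p
  rwa [h1] at h

/-- Applying the anchor to the equivariance of `ρ` gives this without differentiating the group
action. -/
lemma dact_fund (L : LiftedAction B C) (g : G) (p : P) (z : LieAlg EG G) :
    B.dact g p (B.fund z p) = B.fund (adjoint g⁻¹ z) (B.act p g) := by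
  have h := L.equivariant g (adjoint g⁻¹ z) p
  rw [adjoint_adjoint_inv, LinearEquiv.eq_symm_apply] at h
  rw [← L.anchor_ρ, ← L.anchor_ρ, ← h, L.R_anchor]

lemma ρ_act (g : G) (p : P) (z : LieAlg EG G) : L.ρ z (B.act p g) = L.R g p (L.ρ (adjoint g z) p) := by
  rw [L.equivariant, LinearEquiv.apply_symm_apply]

/-- Polarization of `c(z) = -⟨ρ(z), ρ(z)⟩`. -/
lemma pairing_ρ_ρ (hc : L.IsQuadraticForm c) (p : P) (z w : LieAlg EG G) :
    C.pairing p (L.ρ z p) (L.ρ w p) = -c z w := by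
  have h1 := hc.2 p (z + w)
  have h2 := hc.2 p z
  have h3 := hc.2 p w
  have h4 := hc.1 z w
  have h5 := C.pairing_symm p (L.ρ z p) (L.ρ w p)
  simp only [map_add, LinearMap.add_apply, ContMDiffSection.coe_add, Pi.add_apply] at h1
  linarith

/-- `Ê = K ⊕ K^⊥`. -/
lemma exists_add_ρ_orthogonal (hc : L.IsQuadraticForm c) (hnd : c.Nondegenerate) {p : P}
    (e : Eh p) : ∃ z, ∀ w, C.pairing p (e + L.ρ z p) (L.ρ w p) = 0 := by
  -- The vector `z` is chosen with `c(z, ·) = ⟨e, ρ(·)⟩`. The plus sign in `e + ρ(z)` is right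
  -- because `⟨ρ(z), ρ(w)⟩ = -c(z, w)`.
  let φ : Module.Dual ℝ (LieAlg EG G) := (C.pairing p e).comp ((evalSection p).comp L.ρ)
  obtain ⟨z, hz⟩ := (c.toDual hnd).surjective φ
  refine ⟨z, fun w => ?_⟩
  have h1 : c z w = C.pairing p e (L.ρ w p) := by
    rw [← LinearMap.BilinForm.toDual_def hnd, hz]; rfl
  rw [map_add, LinearMap.add_apply, L.pairing_ρ_ρ hc, h1, add_neg_cancel]

/-- An equivariant section over a fibre is determined by one value, since `G` is transitive on the
fibre. -/
lemma evalAt_injective {m : M} (p : B.Fibre m) : Function.Injective (L.evalAt p) := by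
  refine (injective_iff_map_eq_zero _).2 fun a ha => Subtype.ext (funext fun q => ?_)
  obtain ⟨g, rfl⟩ := B.exists_actFibre p q
  rw [a.2.2]
  have : a.1 p = 0 := ha
  rw [this, map_zero]; rfl

lemma redFibre_ext {m : M} (p : B.Fibre m) {a b : L.RedFibre m} (h : a.1 p = b.1 p) : a = b :=
  L.evalAt_injective p h

/-- Every element of `K^⊥` is the value of an element of `K^⊥ / G`. -/
lemma exists_redFibre_eq {m : M} (p : B.Fibre m) {e : Eh p.1}
    (he : ∀ w, C.pairing p.1 e (L.ρ w p.1) = 0) : ∃ a : L.RedFibre m, a.1 p = e := by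
  -- The vector `e` is carried around the fibre by the action. Equations are kept in the total space
  -- because `q` and `p · g` are only propositionally equal.
  have hex : ∀ q : B.Fibre m, ∃ y : Eh q.1, ∃ g,
      (⟨q.1, y⟩ : TotalSpace F Eh) = ⟨B.act p.1 g, L.R g p.1 e⟩ := by
    intro q
    obtain ⟨g, rfl⟩ := B.exists_actFibre p q
    exact ⟨L.R g p.1 e, g, rfl⟩
  choose a ha using hex
  -- The value at `q` does not depend on the group element chosen to reach `q`, by freeness.
  have hT : ∀ (q : B.Fibre m) g, q.1 = B.act p.1 g →
      (⟨q.1, a q⟩ : TotalSpace F Eh) = ⟨B.act p.1 g, L.R g p.1 e⟩ := by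
    intro q g hq
    obtain ⟨g', hg'⟩ := ha q
    have h1 : q.1 = B.act p.1 g' := congrArg TotalSpace.proj hg'
    rw [B.act_injective p.1 (hq.symm.trans h1)]
    exact hg'
  have hT' : ∀ g, a (B.actFibre p g) = L.R g p.1 e := fun g =>
    (TotalSpace.mk_inj (F := F)).1 (hT (B.actFibre p g) g rfl)
  refine ⟨⟨a, fun q z => ?_, fun q g => ?_⟩, ?_⟩
  · obtain ⟨g, rfl⟩ := B.exists_actFibre p q
    rw [hT', L.ρ_act, L.R_pairing, he]
  · obtain ⟨h, rfl⟩ := B.exists_actFibre p q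
    rw [hT']
    refine (TotalSpace.mk_inj (F := F)).1 ?_
    exact (hT _ (h * g) (B.act_mul p.1 h g)).trans (L.R_mul p.1 h g e).symm
  · refine (TotalSpace.mk_inj (F := F)).1 ?_
    exact (hT p 1 (B.act_one p.1).symm).trans (L.R_one p.1 e)

lemma redPairing_symm (m : M) (a b : L.RedFibre m) : L.redPairing m a b = L.redPairing m b a :=
  C.pairing_symm _ _ _

/-- An element of `K^⊥` pairs with any `e` as it does with the `K^⊥`-component of `e`, and every
such component is the value of an element of `E`. -/
lemma redPairing_nondeg (hc : L.IsQuadraticForm c) (hnd : c.Nondegenerate) {m : M}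
    {a : L.RedFibre m} (h : ∀ b, L.redPairing m a b = 0) : a = 0 := by
  let p := B.pt m
  refine L.redFibre_ext p ((C.pairing_nondeg p.1).1 _ fun e => ?_)
  obtain ⟨z, hz⟩ := L.exists_add_ρ_orthogonal hc hnd e
  obtain ⟨b, hb⟩ := L.exists_redFibre_eq p hz
  have h1 := h b
  rw [L.redPairing_eq p, hb, map_add, a.2.1, add_zero] at h1
  exact h1

/-- Lift to `TP`, then to `Ê`, then project to `K^⊥`; the last step changes the anchor by a vertical
vector only. -/
lemma redAnchor_surjective (hc : L.IsQuadraticForm c) (hnd : c.Nondegenerate) (m : M) :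
    Function.Surjective (L.redAnchor m) := by
  intro X
  let p := B.pt m
  obtain ⟨v, rfl⟩ := B.dproj_surjective p X
  obtain ⟨e, rfl⟩ := C.anchor_surjective p.1 v
  obtain ⟨z, hz⟩ := L.exists_add_ρ_orthogonal hc hnd e
  obtain ⟨a, ha⟩ := L.exists_redFibre_eq p hz
  refine ⟨a, ?_⟩
  rw [L.redAnchor_eq p, ha, map_add, map_add, L.anchor_ρ, B.dproj_fund, add_zero]

lemma finiteDimensional_redFibre (m : M) : FiniteDimensional ℝ (L.RedFibre m) := by
  have := finiteDimensional_fibre F Eh (B.pt m).1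
  exact FiniteDimensional.of_injective _ (L.evalAt_injective (B.pt m))

lemma redPairing_redCot (m : M) (ξ : Module.Dual ℝ (TangentSpace 𝓘(ℝ, EM) m))
    (e : L.RedFibre m) : L.redPairing m (L.redCot m ξ) e = (1 / 2 : ℝ) * ξ (L.redAnchor m e) := by
  rw [L.redPairing_eq (B.pt m)]
  exact C.pairing_cot _ _ _

lemma redPairing_redCot_right (m : M) (ξ : Module.Dual ℝ (TangentSpace 𝓘(ℝ, EM) m))
    (e : L.RedFibre m) : L.redPairing m e (L.redCot m ξ) = (1 / 2 : ℝ) * ξ (L.redAnchor m e) := by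
  rw [L.redPairing_symm, L.redPairing_redCot]

lemma anchor_redCot {m : M} (ξ : Module.Dual ℝ (TangentSpace 𝓘(ℝ, EM) m)) (p : B.Fibre m) :
    C.anchor p.1 ((L.redCot m ξ).1 p) = 0 :=
  C.anchor_cot _ _

lemma redAnchor_redCot (m : M) (ξ : Module.Dual ℝ (TangentSpace 𝓘(ℝ, EM) m)) :
    L.redAnchor m (L.redCot m ξ) = 0 := by
  rw [L.redAnchor_eq (B.pt m), L.anchor_redCot, map_zero]

lemma redCot_injective (hc : L.IsQuadraticForm c) (hnd : c.Nondegenerate) (m : M) :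
    Function.Injective (L.redCot m) := by
  refine (injective_iff_map_eq_zero _).2 fun ξ hξ => LinearMap.ext fun X => ?_
  obtain ⟨e, rfl⟩ := L.redAnchor_surjective hc hnd m X
  have h := L.redPairing_redCot m ξ e
  rw [hξ, map_zero, LinearMap.zero_apply] at h
  simpa using h.symm

/-- `(Ker π)^⊥ = T*`. -/
lemma exists_redCot_of_orthogonal (hc : L.IsQuadraticForm c) (hnd : c.Nondegenerate) {m : M}
    {e : L.RedFibre m} (h : ∀ k, L.redAnchor m k = 0 → L.redPairing m e k = 0) :
    ∃ ξ, e = L.redCot m ξ := by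
  obtain ⟨S, hS⟩ := (L.redAnchor m).exists_rightInverse_of_surjective
    (LinearMap.range_eq_top.2 (L.redAnchor_surjective hc hnd m))
  have hS' : ∀ X, L.redAnchor m (S X) = X := LinearMap.congr_fun hS
  -- For a linear right inverse `S` of the anchor, `b - S(πb)` lies in `Ker π`, so `⟨e, b⟩ = ⟨e,
  -- S(πb)⟩`; the `2` again cancels the `½` of the embedding.
  refine ⟨(2 : ℝ) • (L.redPairing m e).comp S, sub_eq_zero.1 (L.redPairing_nondeg hc hnd fun b => ?_)⟩
  have h1 := h (b - S (L.redAnchor m b)) (by rw [map_sub, hS', sub_self])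
  rw [map_sub] at h1
  rw [map_sub, LinearMap.sub_apply, L.redPairing_redCot]
  simp only [LinearMap.smul_apply, LinearMap.comp_apply, smul_eq_mul]
  linarith

/-- Here the anchor takes values in `TP`, so `e = ½π*β` at `p` for a covector `β` on `P`.
Orthogonality to `K` says that `β` vanishes on vertical vectors, and the elements of `Ker π ⊂ E`
have vertical anchor. Hence `e` is orthogonal to `Ker π`. -/
lemma exists_redCot_of_anchor_eq_zero (hc : L.IsQuadraticForm c) (hnd : c.Nondegenerate) {m : M}
    (p : B.Fibre m) {e : L.RedFibre m} (h : C.anchor p.1 (e.1 p) = 0) :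
    ∃ ξ, e = L.redCot m ξ := by
  refine L.exists_redCot_of_orthogonal hc hnd fun k hk => ?_
  rw [L.redAnchor_eq p] at hk
  obtain ⟨z, hz⟩ := B.exists_fund_of_dproj_eq_zero p _ hk
  obtain ⟨β, hβ⟩ := C.exists_cot h
  have h1 := e.2.1 p z
  rw [hβ, C.pairing_cot, L.anchor_ρ, ← hz, ← C.pairing_cot, ← hβ] at h1
  rw [L.redPairing_eq p, h1]

/-! ### Smooth sections of `E` -/

lemma exists_redSection (e : (m : M) → L.RedFibre m)
    (h : ContMDiff 𝓘(ℝ, EP) (𝓘(ℝ, EP).prod 𝓘(ℝ, F)) ∞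
      (fun p => (⟨p, (e (B.proj p)).1 ⟨p, rfl⟩⟩ : TotalSpace F Eh))) :
    ∃ a : L.RedSection, ∀ m, RedSection.eval a m = e m := by
  have h1 : ∀ m (p : B.Fibre m), (e (B.proj p.1)).1 ⟨p.1, rfl⟩ = (e m).1 p := by
    rintro _ ⟨p, rfl⟩; rfl
  refine ⟨⟨⟨_, h⟩, fun p z => (e (B.proj p)).2.1 ⟨p, rfl⟩ z, fun p g => ?_⟩, fun m => ?_⟩
  · exact (h1 _ (B.actFibre ⟨p, rfl⟩ g)).trans ((e (B.proj p)).2.2 ⟨p, rfl⟩ g)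
  · exact Subtype.ext (funext fun p => h1 m p)

lemma contMDiff_redPairing (a b : L.RedSection) : IsSmoothFun (EM := EM)
    (fun m => L.redPairing m (RedSection.eval a m) (RedSection.eval b m)) := by
  refine B.contMDiff_of_comp_proj ?_
  have h : (fun p => L.redPairing (B.proj p) (RedSection.eval a (B.proj p))
      (RedSection.eval b (B.proj p))) = fun p => C.pairing p (a.1 p) (b.1 p) :=
    funext fun p => L.redPairing_eq ⟨p, rfl⟩ _ _
  rw [h]
  exact C.pairing_smooth a.1 b.1

lemma contMDiff_redAnchor (a : L.RedSection) :
    IsSmoothField (fun m => L.redAnchor m (RedSection.eval a m)) := by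
  refine B.contMDiff_of_comp_proj ?_
  have h : (fun p => (⟨B.proj p, L.redAnchor (B.proj p) (RedSection.eval a (B.proj p))⟩ :
      TangentBundle 𝓘(ℝ, EM) M)) = fun p => ⟨B.proj p, B.dproj ⟨p, rfl⟩ (C.anchor p (a.1 p))⟩ :=
    funext fun p => congrArg _ (L.redAnchor_eq ⟨p, rfl⟩ _)
  rw [h]
  exact B.contMDiff_dproj (C.anchor_smooth a.1)

/-- The pullback to `P` of a smooth 1-form is smooth. -/
lemma contMDiff_oneForm_dproj {ξ : (m : M) → Module.Dual ℝ (TangentSpace 𝓘(ℝ, EM) m)}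
    (hξ : ∀ X : RoughField EM M, IsSmoothField X → IsSmoothFun (EM := EM) (fun m => ξ m (X m)))
    {W : RoughField EP P} (hW : IsSmoothField W) :
    IsSmoothFun (EM := EP) (fun p => ξ (B.proj p) (B.dproj ⟨p, rfl⟩ (W p))) := fun p =>
  contMDiffAt_apply_along (V := fun m : M => TangentSpace 𝓘(ℝ, EM) m)
    (fun s => hξ (fun m => s m) s.contMDiff) (B.contMDiff_dproj hW p)

lemma exists_redSection_redCot {ξ : (m : M) → Module.Dual ℝ (TangentSpace 𝓘(ℝ, EM) m)}
    (hξ : ∀ X : RoughField EM M, IsSmoothField X → IsSmoothFun (EM := EM) (fun m => ξ m (X m))) :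
    ∃ a : L.RedSection, ∀ m, RedSection.eval a m = L.redCot m (ξ m) := by
  refine L.exists_redSection (fun m => L.redCot m (ξ m)) (C.contMDiff_of_pairing fun b => ?_)
  have h : (fun p => C.pairing p ((L.redCot (B.proj p) (ξ (B.proj p))).1 ⟨p, rfl⟩) (b p)) =
      fun p => (1 / 2 : ℝ) * ξ (B.proj p) (B.dproj ⟨p, rfl⟩ (C.anchor p (b p))) :=
    funext fun p => C.pairing_cot _ _ _
  rw [h]
  exact contMDiff_const.mul (contMDiff_oneForm_dproj hξ (C.anchor_smooth b))

/-- The anchor of a section of `E` acts on functions on `M`. -/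
lemma dirDeriv_comp_proj {X : RoughField EP P} {m : M} (p : B.Fibre m) {Z : RoughField EM M}
    (hX : B.dproj p (X p.1) = Z m) {f : M → ℝ} (hf : IsSmoothFun (EM := EM) f) :
    dirDeriv X (fun q => f (B.proj q)) p.1 = dirDeriv Z f m := by
  obtain ⟨p, rfl⟩ := p
  have h := mfderiv_comp_apply (I := 𝓘(ℝ, EP)) (I' := 𝓘(ℝ, EM)) (I'' := 𝓘(ℝ, ℝ)) p
    (hf.mdifferentiable (by simp) (B.proj p)) (B.contMDiff_proj.mdifferentiable (by simp) p) (X p)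
  exact h.trans (congrArg (mfderiv 𝓘(ℝ, EM) 𝓘(ℝ, ℝ) f (B.proj p)) hX)

end Reduced

end LiftedAction

/-! ## The metric and the splitting determined by an admissible metric -/

/-- The orthogonal projection to a subspace without null vectors. -/
lemma exists_projection {E : Type*} [AddCommGroup E] [Module ℝ E] [FiniteDimensional ℝ E]
    (b : LinearMap.BilinForm ℝ E) (W : Submodule ℝ E)
    (h : ∀ w ∈ W, (∀ w' ∈ W, b w w' = 0) → w = 0) (v : E) :
    ∃ w ∈ W, ∀ w' ∈ W, b w w' = b v w' := by
  -- The hypothesis is that `W → W*` is injective, hence it is onto by dimension; the projection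
  -- represents the functional `b v` on `W`.
  let φ : W →ₗ[ℝ] Module.Dual ℝ W := b.compl₁₂ W.subtype W.subtype
  have hφ : Function.Injective φ := (injective_iff_map_eq_zero _).2 fun w hw =>
    Subtype.ext (h w.1 w.2 fun w' hw' => LinearMap.congr_fun hw ⟨w', hw'⟩)
  obtain ⟨w, hw⟩ := (LinearMap.injective_iff_surjective_of_finrank_eq_finrank
    (Subspace.dual_finrank_eq (K := ℝ) (V := W)).symm).1 hφ ((b v).comp W.subtype)
  exact ⟨w.1, w.2, fun w' hw' => LinearMap.congr_fun hw ⟨w', hw'⟩⟩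

namespace LiftedAction

section Admissible

variable {EG : Type*} [NormedAddCommGroup EG] [NormedSpace ℝ EG] [FiniteDimensional ℝ EG]
  {G : Type*} [TopologicalSpace G] [ChartedSpace EG G] [Group G] [LieGroup 𝓘(ℝ, EG) ∞ G]
  {EM : Type*} [NormedAddCommGroup EM] [NormedSpace ℝ EM] [FiniteDimensional ℝ EM]
  {M : Type*} [TopologicalSpace M] [T2Space M] [ChartedSpace EM M] [IsManifold 𝓘(ℝ, EM) ∞ M]
  {EP : Type*} [NormedAddCommGroup EP] [NormedSpace ℝ EP] [FiniteDimensional ℝ EP]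
  {P : Type*} [TopologicalSpace P] [T2Space P] [ChartedSpace EP P] [IsManifold 𝓘(ℝ, EP) ∞ P]
  {F : Type*} [NormedAddCommGroup F] [NormedSpace ℝ F] [FiniteDimensional ℝ F]
  {Eh : P → Type*} [TopologicalSpace (TotalSpace F Eh)]
  [∀ p, AddCommGroup (Eh p)] [∀ p, Module ℝ (Eh p)] [∀ p, TopologicalSpace (Eh p)]
  [FiberBundle F Eh] [VectorBundle ℝ F Eh] [ContMDiffVectorBundle ∞ F Eh 𝓘(ℝ, EP)]
variable {B : PrincipalBundle EG G EM M EP P} {C : ExactCourantAlgebroid EP P F Eh}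
  {L : LiftedAction B C} {c : LinearMap.BilinForm ℝ (LieAlg EG G)}
  {V : (m : M) → Submodule ℝ (L.RedFibre m)}

/-- If `V ∩ T* = 0` and `rk V = rk E - dim M`, then `E = V + T*`. -/
lemma exists_add_redCot (hc : L.IsQuadraticForm c) (hnd : c.Nondegenerate)
    (hV : L.IsAdmissible V) {m : M} (e : L.RedFibre m) :
    ∃ v ∈ V m, ∃ ξ, e = v + L.redCot m ξ := by
  have := L.finiteDimensional_redFibre m
  have h1 : V m ⊔ LinearMap.range (L.redCot m) = ⊤ := by
    refine Submodule.eq_top_of_finrank_eq ?_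
    have h2 := Submodule.finrank_sup_add_finrank_inf_eq (V m) (LinearMap.range (L.redCot m))
    rw [(hV.2 m).1, finrank_bot, add_zero,
      LinearMap.finrank_range_of_inj (L.redCot_injective hc hnd m), Subspace.dual_finrank_eq] at h2
    exact h2.trans (hV.2 m).2
  obtain ⟨v, hv, _, ⟨ξ, rfl⟩, h⟩ := Submodule.mem_sup.1 (h1 ▸ Submodule.mem_top : e ∈ _)
  exact ⟨v, hv, ξ, h.symm⟩

/-- The metric is nondegenerate on `V ∩ Ker π`. -/
lemma eq_zero_of_orthogonal_ker (hc : L.IsQuadraticForm c) (hnd : c.Nondegenerate)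
    (hV : L.IsAdmissible V) {m : M} {w : L.RedFibre m} (hw : w ∈ V m)
    (h0 : L.redAnchor m w = 0)
    (h : ∀ v ∈ V m, L.redAnchor m v = 0 → L.redPairing m w v = 0) : w = 0 := by
  -- An element of `Ker π` splits as `v + ξ` with `v ∈ V ∩ Ker π`, and `⟨w, ξ⟩ = ½ξ(πw) = 0`. So `w`
  -- is orthogonal to `Ker π`, which puts it in `V ∩ T*`.
  obtain ⟨ξ, rfl⟩ := L.exists_redCot_of_orthogonal hc hnd (e := w) fun k hk => by
    obtain ⟨v, hv, ξ, rfl⟩ := exists_add_redCot hc hnd hV k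
    rw [map_add, L.redAnchor_redCot, add_zero] at hk
    rw [map_add, h v hv hk, L.redPairing_redCot_right, h0]
    simp
  have : L.redCot m ξ ∈ V m ⊓ LinearMap.range (L.redCot m) := ⟨hw, ξ, rfl⟩
  rw [(hV.2 m).1] at this
  exact this

/-- The inverse of `π_⊥`: a linear lift `T → V` with image orthogonal to `V ∩ Ker π`. -/
lemma exists_perp_lift (hc : L.IsQuadraticForm c) (hnd : c.Nondegenerate)
    (hV : L.IsAdmissible V) (m : M) :
    ∃ u : TangentSpace 𝓘(ℝ, EM) m →ₗ[ℝ] L.RedFibre m, ∀ X, u X ∈ V m ∧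
      L.redAnchor m (u X) = X ∧ ∀ v ∈ V m, L.redAnchor m v = 0 → L.redPairing m (u X) v = 0 := by
  have := L.finiteDimensional_redFibre m
  let W : Submodule ℝ (L.RedFibre m) := V m ⊓ LinearMap.ker (L.redAnchor m)
  let D : Submodule ℝ (L.RedFibre m) :=
    { carrier := {u | u ∈ V m ∧ ∀ v ∈ W, L.redPairing m u v = 0}
      zero_mem' := ⟨zero_mem _, by simp⟩
      add_mem' := by
        rintro a b ⟨ha, ha'⟩ ⟨hb, hb'⟩
        exact ⟨add_mem ha hb, fun v hv => by simp [ha' v hv, hb' v hv]⟩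
      smul_mem' := by
        rintro r a ⟨ha, ha'⟩
        exact ⟨Submodule.smul_mem _ r ha, fun v hv => by simp [ha' v hv]⟩ }
  have hsurj : Function.Surjective ((L.redAnchor m).comp D.subtype) := by
    intro X
    obtain ⟨e, rfl⟩ := L.redAnchor_surjective hc hnd m X
    obtain ⟨v, hv, ξ, rfl⟩ := exists_add_redCot hc hnd hV e
    -- Subtracting from `v` its projection to `V ∩ Ker π` makes it orthogonal to that space and
    -- preserves its anchor.
    obtain ⟨w, hw, hw'⟩ := exists_projection (L.redPairing m) W (fun w hw h =>
      eq_zero_of_orthogonal_ker hc hnd hV hw.1 hw.2 fun v hv h0 => h v ⟨hv, h0⟩) v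
    refine ⟨⟨v - w, sub_mem hv hw.1, fun v' hv' => ?_⟩, ?_⟩
    · rw [map_sub, LinearMap.sub_apply, hw' v' hv', sub_self]
    · have h0 : L.redAnchor m w = 0 := hw.2
      change L.redAnchor m (v - w) = _
      rw [map_sub, h0, map_add, L.redAnchor_redCot, sub_zero, add_zero]
  obtain ⟨S, hS⟩ := LinearMap.exists_rightInverse_of_surjective _ (LinearMap.range_eq_top.2 hsurj)
  exact ⟨D.subtype.comp S, fun X => ⟨(S X).2.1, LinearMap.congr_fun hS X,
    fun v hv h0 => (S X).2.2 v ⟨hv, h0⟩⟩⟩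

/-- Values of combinations of sections of `E`. -/
lemma sum_redFibre_apply {ι : Type*} (t : Finset ι) {m : M} (a : ι → L.RedFibre m) (f : ι → ℝ)
    (p : B.Fibre m) : (∑ i ∈ t, f i • a i : L.RedFibre m).1 p = ∑ i ∈ t, f i • (a i).1 p := by
  have h := map_sum (L.evalAt p) (fun i => f i • a i) t
  simp only [map_smul] at h
  exact h

/-- Smoothness of a section of `E` is tested upstairs, where the coefficients pull back and the
sections are smooth on `P`. No partition of unity is needed, because `e` is already global. -/
lemma exists_redSection_of_local_sum {e : (m : M) → L.RedFibre m}
    (h : ∀ m₀, ∃ (r : ℕ) (s : Fin r → L.RedSection) (f : M → Fin r → ℝ),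
      (∀ i, ContMDiffAt 𝓘(ℝ, EM) 𝓘(ℝ, ℝ) ∞ (fun m => f m i) m₀) ∧
      ∀ᶠ m in 𝓝 m₀, e m = ∑ i, f m i • RedSection.eval (s i) m) :
    ∃ a : L.RedSection, ∀ m, RedSection.eval a m = e m := by
  refine L.exists_redSection e fun p₀ => ?_
  obtain ⟨r, s, f, hf, hs⟩ := h (B.proj p₀)
  have h1 := contMDiffAt_totalSpace_sum (N := P) (F := F) (V := Eh) (f := fun p : P => p)
    (s := fun i p => (s i).1 p) (c := fun i p => f (B.proj p) i) (x₀ := p₀) contMDiffAt_id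
    (fun i => (s i).1.contMDiff p₀) (fun i => ContMDiffAt.comp p₀ (hf i) (B.contMDiff_proj p₀))
  refine h1.congr_of_eventuallyEq ?_
  filter_upwards [B.contMDiff_proj.continuous.continuousAt hs] with p hp
  have hp' : e (B.proj p) = _ := hp
  refine congrArg (fun y : Eh p => (⟨p, y⟩ : TotalSpace F Eh)) ?_
  rw [hp', sum_redFibre_apply]
  rfl

/-- The inverse of `π_⊥` is smooth. -/
lemma exists_redSection_perp_lift (hc : L.IsQuadraticForm c) (hnd : c.Nondegenerate)
    (hV : L.IsAdmissible V) {u : (m : M) → TangentSpace 𝓘(ℝ, EM) m →ₗ[ℝ] L.RedFibre m}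
    (hu : ∀ m X, u m X ∈ V m ∧ L.redAnchor m (u m X) = X ∧
      ∀ v ∈ V m, L.redAnchor m v = 0 → L.redPairing m (u m X) v = 0)
    {X : RoughField EM M} (hX : IsSmoothField X) :
    ∃ a : L.RedSection, ∀ m, RedSection.eval a m = u m (X m) := by
  refine exists_redSection_of_local_sum fun m₀ => ?_
  obtain ⟨r, s, U, hU, hm₀, hs⟩ := hV.1.1 m₀
  let n := Module.finrank ℝ EM
  let β := Module.finBasis ℝ EM
  let y : (m : M) → Fin n → Module.Dual ℝ (TangentSpace 𝓘(ℝ, EM) m) := fun m k =>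
    (β.coord k).comp (coordAt EM m₀ m)
  have hy : ∀ {Y : RoughField EM M}, IsSmoothField Y → ∀ k,
      ContMDiffAt 𝓘(ℝ, EM) 𝓘(ℝ, ℝ) ∞ (fun m => y m k (Y m)) m₀ := by
    intro Y hY k
    have h1 := (contMDiffAt_totalSpace_coordAt (f := fun m : M => m)
      (V := fun m : M => TangentSpace 𝓘(ℝ, EM) m) (s := Y) (x₀ := m₀)).1 (hY m₀)
    exact (ContinuousLinearMap.contMDiff
      (LinearMap.toContinuousLinearMap (β.coord k))).contMDiffAt.comp m₀ h1.2
  let a : M → Fin r → Fin r → ℝ := fun m i j =>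
    L.redPairing m (RedSection.eval (s i) m) (RedSection.eval (s j) m)
  let b : M → Fin r → Fin n → ℝ := fun m i k => y m k (L.redAnchor m (RedSection.eval (s i) m))
  have ha : ∀ i j, ContMDiffAt 𝓘(ℝ, EM) 𝓘(ℝ, ℝ) ∞ (fun m => a m i j) m₀ := fun i j =>
    (L.contMDiff_redPairing (s i) (s j)) m₀
  have hb : ∀ i k, ContMDiffAt 𝓘(ℝ, EM) 𝓘(ℝ, ℝ) ∞ (fun m => b m i k) m₀ := fun i k =>
    hy (L.contMDiff_redAnchor (s i)) k
  -- The unknowns are the coefficients of a vector `w` of `V` in the frame `s` and those of a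
  -- covector `ν`, a Lagrange multiplier, in the coordinate coframe `y`. The equations with
  -- right-hand side `(0, y(X))` read `⟨w, v⟩ = ν(πv)` for `v ∈ V` and `πw = X`. They hold for `w =
  -- u(X)` and `ν = g(X)`, where `g` is the metric induced by `u`.
  let Φ : M → ((Fin r → ℝ) × (Fin n → ℝ)) →ₗ[ℝ] ((Fin r → ℝ) × (Fin n → ℝ)) := fun m =>
    { toFun := fun x => (fun j => ∑ i, x.1 i * a m i j - ∑ k, x.2 k * b m j k,
        fun k => ∑ i, x.1 i * b m i k)
      map_add' := fun x x' => by
        ext j <;> simp only [Prod.fst_add, Prod.snd_add, Pi.add_apply, add_mul,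
          Finset.sum_add_distrib]
        ring
      map_smul' := fun t x => by
        ext j <;> simp only [Prod.smul_fst, Prod.smul_snd, Pi.smul_apply, smul_eq_mul, mul_assoc,
          ← Finset.mul_sum, RingHom.id_apply]
        ring }
  have hΦ : ∀ x, ContMDiffAt 𝓘(ℝ, EM) 𝓘(ℝ, (Fin r → ℝ) × (Fin n → ℝ)) ∞ (fun m => Φ m x) m₀ := by
    intro x
    refine ContMDiffAt.prodMk_space (contMDiffAt_pi_space.2 fun j => ?_)
      (contMDiffAt_pi_space.2 fun k => ?_)
    · exact (contMDiffAt_finsetSum fun i _ => contMDiffAt_const.mul (ha i j)).sub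
        (contMDiffAt_finsetSum fun k _ => contMDiffAt_const.mul (hb j k))
    · exact contMDiffAt_finsetSum fun i _ => contMDiffAt_const.mul (hb i k)
  -- the equations in terms of `E`
  have hmem : ∀ m ∈ U, ∀ i, RedSection.eval (s i) m ∈ V m := fun m hm i => by
    rw [← (hs m hm).2]; exact Submodule.subset_span ⟨i, rfl⟩
  have hspan : ∀ m ∈ U, ∀ v ∈ V m, ∃ f : Fin r → ℝ, v = ∑ i, f i • RedSection.eval (s i) m := by
    intro m hm v hv
    rw [← (hs m hm).2] at hv
    obtain ⟨f, hf⟩ := (Submodule.mem_span_range_iff_exists_fun ℝ).1 hv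
    exact ⟨f, hf.symm⟩
  have hΦ1 : ∀ m x j, (Φ m x).1 j = L.redPairing m (∑ i, x.1 i • RedSection.eval (s i) m)
      (RedSection.eval (s j) m) - ∑ k, x.2 k * y m k (L.redAnchor m (RedSection.eval (s j) m)) := by
    intro m x j
    simp only [map_sum, map_smul, LinearMap.sum_apply, LinearMap.smul_apply, smul_eq_mul]
    rfl
  have hΦ2 : ∀ m x k, (Φ m x).2 k = y m k (L.redAnchor m (∑ i, x.1 i • RedSection.eval (s i) m)) := by
    intro m x k
    simp only [map_sum, map_smul, smul_eq_mul]
    rfl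
  have hzero : ∀ m (Z : TangentSpace 𝓘(ℝ, EM) m),
      m ∈ (trivializationAt EM (fun m : M => TangentSpace 𝓘(ℝ, EM) m) m₀).baseSet →
      (∀ k, y m k Z = 0) → Z = 0 := by
    intro m Z hm hZ
    refine (coordAt_bijective hm).1 ?_
    rw [map_zero]
    exact β.ext_elem fun k => by rw [map_zero]; exact hZ k
  have hbase := eventually_mem_baseSet (F := EM) (V := fun m : M => TangentSpace 𝓘(ℝ, EM) m) m₀
  have hbij : Function.Bijective (Φ m₀) := by
    have hinj : Function.Injective (Φ m₀) := by
      refine (injective_iff_map_eq_zero _).2 fun x hx => ?_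
      set w := ∑ i, x.1 i • RedSection.eval (s i) m₀ with hw
      have hwV : w ∈ V m₀ := Submodule.sum_mem _ fun i _ =>
        Submodule.smul_mem _ _ (hmem m₀ hm₀ i)
      have hw0 : L.redAnchor m₀ w = 0 := hzero m₀ _ hbase.self_of_nhds fun k => by
        rw [← hΦ2, hx]; rfl
      let ν : Module.Dual ℝ (TangentSpace 𝓘(ℝ, EM) m₀) := ∑ k, x.2 k • y m₀ k
      have hν : ∀ Z, ν Z = ∑ k, x.2 k * y m₀ k Z := fun Z => by simp [ν]
      have hwv : ∀ v ∈ V m₀, L.redPairing m₀ w v = ν (L.redAnchor m₀ v) := by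
        have h1 : ∀ j, L.redPairing m₀ w (RedSection.eval (s j) m₀) =
            ν (L.redAnchor m₀ (RedSection.eval (s j) m₀)) := by
          intro j
          rw [hν, ← sub_eq_zero, ← hΦ1, hx]; rfl
        intro v hv
        obtain ⟨f, rfl⟩ := hspan m₀ hm₀ v hv
        simp only [map_sum, map_smul, h1]
      -- For zero right-hand side, `w` lies in `V ∩ Ker π` and is orthogonal to it. Once `w = 0`,
      -- the covector vanishes too, because `V` maps onto `T`.
      have hw00 : w = 0 := eq_zero_of_orthogonal_ker hc hnd hV hwV hw0 fun v hv h0 => by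
        rw [hwv v hv, h0, map_zero]
      have hν0 : ν = 0 := LinearMap.ext fun Z => by
        rw [← (hu m₀ Z).2.1, ← hwv _ (hu m₀ Z).1, hw00]; simp
      refine Prod.ext (funext fun i => ?_) (funext fun k => ?_)
      · exact Fintype.linearIndependent_iff.1 (hs m₀ hm₀).1 x.1 (hw ▸ hw00) i
      · obtain ⟨Z, hZ⟩ := (coordAt_bijective (F := EM)
          (V := fun m : M => TangentSpace 𝓘(ℝ, EM) m) hbase.self_of_nhds).2 (β k)
        have h1 := hν Z
        rw [hν0] at h1
        have h2 : ∀ j, y m₀ j Z = if k = j then 1 else 0 := fun j => by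
          change β.coord j (coordAt EM m₀ m₀ Z) = _
          rw [hZ, Module.Basis.coord_apply, Module.Basis.repr_self, Finsupp.single_apply]
        simp only [h2, mul_ite, mul_one, mul_zero, Finset.sum_ite_eq, Finset.mem_univ, if_true,
          LinearMap.zero_apply] at h1
        exact h1.symm
    exact ⟨hinj, LinearMap.injective_iff_surjective.1 hinj⟩
  have hsol : ∀ m, ∃ x : (Fin r → ℝ) × (Fin n → ℝ), m ∈ U →
      m ∈ (trivializationAt EM (fun m : M => TangentSpace 𝓘(ℝ, EM) m) m₀).baseSet →
      u m (X m) = ∑ i, x.1 i • RedSection.eval (s i) m ∧ Φ m x = (0, fun k => y m k (X m)) := by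
    intro m
    by_cases hm : m ∈ U ∧ m ∈
      (trivializationAt EM (fun m : M => TangentSpace 𝓘(ℝ, EM) m) m₀).baseSet
    · obtain ⟨f, hf⟩ := hspan m hm.1 _ (hu m (X m)).1
      let ε : Fin n → TangentSpace 𝓘(ℝ, EM) m := fun k =>
        (trivializationAt EM (fun m : M => TangentSpace 𝓘(ℝ, EM) m) m₀).symm m (β k)
      have hε : ∀ Z, Z = ∑ k, y m k Z • ε k := by
        intro Z
        refine (coordAt_bijective hm.2).1 ?_
        simp only [map_sum, map_smul, ε, coordAt_symm hm.2]
        exact (β.sum_repr (coordAt EM m₀ m Z)).symm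
      -- This is the multiplier. It serves on all of `V`, as `v - u(πv)` lies in `V ∩ Ker π`, to
      -- which `u(X)` is orthogonal.
      let gX : Module.Dual ℝ (TangentSpace 𝓘(ℝ, EM) m) := (L.redPairing m (u m (X m))).comp (u m)
      have hgX : ∀ v ∈ V m, L.redPairing m (u m (X m)) v = gX (L.redAnchor m v) := by
        intro v hv
        have h1 := (hu m (X m)).2.2 (v - u m (L.redAnchor m v)) (sub_mem hv (hu m _).1)
          (by rw [map_sub, (hu m _).2.1, sub_self])
        rw [map_sub, sub_eq_zero] at h1
        exact h1
      refine ⟨(f, fun k => gX (ε k)), fun _ _ => ⟨hf, Prod.ext (funext fun j => ?_)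
        (funext fun k => ?_)⟩⟩
      · rw [hΦ1, ← hf, hgX _ (hmem m hm.1 j)]
        conv_lhs => enter [1]; rw [hε (L.redAnchor m (RedSection.eval (s j) m))]
        simp only [map_sum, map_smul, smul_eq_mul, mul_comm, sub_self]
        rfl
      · rw [hΦ2, ← hf, (hu m (X m)).2.1]
    · exact ⟨0, fun h1 h2 => absurd ⟨h1, h2⟩ hm⟩
  choose x hx using hsol
  have hxs : ContMDiffAt 𝓘(ℝ, EM) 𝓘(ℝ, (Fin r → ℝ) × (Fin n → ℝ)) ∞ x m₀ := by
    refine contMDiffAt_of_linear_system hΦ hbij (y := fun m => (0, fun k => y m k (X m))) ?_ ?_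
    · exact ContMDiffAt.prodMk_space contMDiffAt_const (contMDiffAt_pi_space.2 fun k => hy hX k)
    · filter_upwards [hbase, hU.mem_nhds hm₀] with m h1 h2 using (hx m h2 h1).2
  refine ⟨r, s, fun m => (x m).1, fun i => ?_, ?_⟩
  · have h1 : ContMDiffAt 𝓘(ℝ, EM) 𝓘(ℝ, Fin r → ℝ) ∞ (fun m => (x m).1) m₀ :=
      (ContinuousLinearMap.contMDiff
        (ContinuousLinearMap.fst ℝ (Fin r → ℝ) (Fin n → ℝ))).contMDiffAt.comp m₀ hxs
    exact contMDiffAt_pi_space.1 h1 i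
  · filter_upwards [hbase, hU.mem_nhds hm₀] with m h1 h2 using (hx m h2 h1).1

lemma redPairing_graphVec (g : PseudoMetric EM M) (l : L.IsotropicSplitting) (m : M)
    (X : TangentSpace 𝓘(ℝ, EM) m) (e : L.RedFibre m) :
    L.redPairing m (L.graphVec g l m X) e =
      L.redPairing m (l.toFun m X) e + (1 / 2 : ℝ) * g.toFun m X (L.redAnchor m e) := by
  rw [graphVec, map_add, LinearMap.add_apply, L.redPairing_redCot]

lemma redAnchor_graphVec (g : PseudoMetric EM M) (l : L.IsotropicSplitting) (m : M)
    (X : TangentSpace 𝓘(ℝ, EM) m) : L.redAnchor m (L.graphVec g l m X) = X := by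
  rw [graphVec, map_add, l.anchor_toFun, L.redAnchor_redCot, add_zero]

/-- `λ + g` is an isometry for `g`. -/
lemma redPairing_graphVec_graphVec (g : PseudoMetric EM M) (l : L.IsotropicSplitting) (m : M)
    (X Y : TangentSpace 𝓘(ℝ, EM) m) :
    L.redPairing m (L.graphVec g l m X) (L.graphVec g l m Y) = g.toFun m X Y := by
  rw [redPairing_graphVec, redAnchor_graphVec, L.redPairing_symm, redPairing_graphVec, l.isotropic,
    l.anchor_toFun, g.symm m Y X]
  ring

/-- With `u` the inverse of `π_⊥`, take `g = ⟨u, u⟩` and `λ = u - g`. Then `⟨λX, λY⟩ = g(X, Y) -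
½g(X, Y) - ½g(Y, X) = 0`. -/
lemma exists_isDeterminedPair (hc : L.IsQuadraticForm c) (hnd : c.Nondegenerate)
    (hV : L.IsAdmissible V) : ∃ (g : PseudoMetric EM M) (l : L.IsotropicSplitting),
      L.IsDeterminedPair V g l := by
  choose u hu using exists_perp_lift hc hnd hV
  have hus := fun {X : RoughField EM M} (hX : IsSmoothField X) =>
    exists_redSection_perp_lift hc hnd hV hu hX
  have hgs : ∀ X Y : RoughField EM M, IsSmoothField X → IsSmoothField Y →
      IsSmoothFun (EM := EM) (fun m => L.redPairing m (u m (X m)) (u m (Y m))) := by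
    intro X Y hX hY
    obtain ⟨a, ha⟩ := hus hX
    obtain ⟨b, hb⟩ := hus hY
    simpa only [ha, hb] using L.contMDiff_redPairing a b
  -- A null vector `X` of `g` gives `u(X)` orthogonal to `u(T)` and to `V ∩ Ker π`, hence to `V`,
  -- where the metric is nondegenerate.
  have hnon : ∀ m X, (∀ Y, L.redPairing m (u m X) (u m Y) = 0) → X = 0 := by
    intro m X hX
    have h1 : ∀ v ∈ V m, L.redPairing m (u m X) v = 0 := by
      intro v hv
      have h2 := (hu m X).2.2 (v - u m (L.redAnchor m v)) (sub_mem hv (hu m _).1)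
        (by rw [map_sub, (hu m _).2.1, sub_self])
      rw [map_sub, hX, sub_zero] at h2
      exact h2
    have h3 : (⟨u m X, (hu m X).1⟩ : V m) = 0 :=
      (hV.1.2 m).1 _ fun v => h1 v.1 v.2
    have h4 : u m X = 0 := congrArg Subtype.val h3
    rw [← (hu m X).2.1, h4, map_zero]
  let g : PseudoMetric EM M :=
    { toFun := fun m => (L.redPairing m).compl₁₂ (u m) (u m)
      symm := fun m X Y => L.redPairing_symm m _ _
      nondeg := fun m => ⟨hnon m, fun X hX => hnon m X fun Y =>
        (L.redPairing_symm m _ _).trans (hX Y)⟩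
      smooth := hgs }
  have hg : ∀ m X Y, g.toFun m X Y = L.redPairing m (u m X) (u m Y) := fun _ _ _ => rfl
  let l : L.IsotropicSplitting :=
    { toFun := fun m => u m - (L.redCot m).comp (g.toFun m)
      anchor_toFun := fun m X => by
        rw [LinearMap.sub_apply, map_sub, (hu m X).2.1, LinearMap.comp_apply, L.redAnchor_redCot,
          sub_zero]
      isotropic := fun m X Y => by
        simp only [LinearMap.sub_apply, LinearMap.comp_apply, map_sub, L.redPairing_redCot,
          L.redPairing_redCot_right, (hu m _).2.1, L.redAnchor_redCot, map_zero, ← hg]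
        rw [g.symm m Y X]
        ring
      smooth := fun X hX => by
        obtain ⟨a, ha⟩ := hus hX
        obtain ⟨b, hb⟩ := L.exists_redSection_redCot (ξ := fun m => g.toFun m (X m))
          fun Y hY => g.smooth X Y hX hY
        refine ⟨a - b, fun m => ?_⟩
        rw [LinearMap.sub_apply, LinearMap.comp_apply, ← ha, ← hb]
        rfl }
  have hgv : ∀ m X, L.graphVec g l m X = u m X := fun m X => sub_add_cancel _ _
  refine ⟨g, l, fun m => ⟨fun X => ?_, fun X Y => ?_⟩⟩
  · rw [hgv]
    exact ⟨(hu m X).1, (hu m X).2.2⟩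
  · rw [hgv, hgv]; rfl

/-- Two lifts of `X` to `(V ∩ Ker π)^⊥ ⊂ V` differ by an element of `V ∩ Ker π` orthogonal to that
space, so they agree. Their common value recovers `g` as a pullback, and then `λ`. -/
lemma IsDeterminedPair.unique (hc : L.IsQuadraticForm c) (hnd : c.Nondegenerate)
    (hV : L.IsAdmissible V) {g g' : PseudoMetric EM M} {l l' : L.IsotropicSplitting}
    (h : L.IsDeterminedPair V g l) (h' : L.IsDeterminedPair V g' l') : g = g' ∧ l = l' := by
  have h1 : ∀ m X, L.graphVec g l m X = L.graphVec g' l' m X := by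
    intro m X
    refine sub_eq_zero.1 (eq_zero_of_orthogonal_ker hc hnd hV
      (sub_mem ((h m).1 X).1 ((h' m).1 X).1) ?_ fun v hv hv0 => ?_)
    · rw [map_sub, redAnchor_graphVec, redAnchor_graphVec, sub_self]
    · rw [map_sub, LinearMap.sub_apply, ((h m).1 X).2 v hv hv0, ((h' m).1 X).2 v hv hv0, sub_self]
  have h2 : g = g' := PseudoMetric.ext (funext fun m => LinearMap.ext₂ fun X Y => by
    rw [(h m).2, (h' m).2, h1, h1])
  subst h2
  refine ⟨rfl, IsotropicSplitting.ext (funext fun m => LinearMap.ext fun X => ?_)⟩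
  exact add_right_cancel (h1 m X)

/-- The point is `V ∩ Ker π = ad P`. Elements of `Ker π` do not see the `g`-part of `λ + g`, so `V ∩
Ker π` is orthogonal to the image of `λ`. Conversely, write `s ∈ ad P` as `v + ξ` along `V + T*`;
pairing with `λ(Y)` gives `ξ = 0`. -/
lemma IsDeterminedPair.isGraph (hc : L.IsQuadraticForm c) (hnd : c.Nondegenerate)
    (hV : L.IsAdmissible V) {g : PseudoMetric EM M} {l : L.IsotropicSplitting}
    (h : L.IsDeterminedPair V g l) : L.IsGraph V g l := by
  have h1 : ∀ m, ∀ w ∈ V m, L.redAnchor m w = 0 → w ∈ l.adPart m := by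
    intro m w hw hw0
    refine ⟨hw0, fun X => ?_⟩
    have h2 := ((h m).1 X).2 w hw hw0
    rw [redPairing_graphVec, hw0, map_zero, mul_zero, add_zero] at h2
    rw [L.redPairing_symm, h2]
  intro m e
  constructor
  · intro he
    refine ⟨L.redAnchor m e, e - L.graphVec g l m (L.redAnchor m e),
      h1 m _ (sub_mem he ((h m).1 _).1) ?_, (add_sub_cancel _ _).symm⟩
    rw [map_sub, redAnchor_graphVec, sub_self]
  · rintro ⟨X, s, hs, rfl⟩
    refine add_mem ((h m).1 X).1 ?_
    obtain ⟨v, hv, ξ, rfl⟩ := exists_add_redCot hc hnd hV s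
    have hv0 : L.redAnchor m v = 0 := by
      have := hs.1
      rwa [map_add, L.redAnchor_redCot, add_zero] at this
    have hξ : ξ = 0 := LinearMap.ext fun Y => by
      have h2 := hs.2 Y
      rw [map_add, LinearMap.add_apply, (h1 m v hv hv0).2, L.redPairing_redCot, l.anchor_toFun,
        zero_add] at h2
      simpa using h2
    rw [hξ, map_zero, add_zero]
    exact hv

end Admissible

end LiftedAction

/-! ## Connections and horizontal lifts -/

/-- The fundamental vector field at a point, as a linear map. -/
def PrincipalBundle.fundMap {EG : Type*} [NormedAddCommGroup EG] [NormedSpace ℝ EG]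
    {G : Type*} [TopologicalSpace G] [ChartedSpace EG G] [Group G]
    {EM : Type*} [NormedAddCommGroup EM] [NormedSpace ℝ EM]
    {M : Type*} [TopologicalSpace M] [ChartedSpace EM M]
    {EP : Type*} [NormedAddCommGroup EP] [NormedSpace ℝ EP]
    {P : Type*} [TopologicalSpace P] [ChartedSpace EP P]
    (B : PrincipalBundle EG G EM M EP P) (p : P) :
    LieAlg EG G →ₗ[ℝ] TangentSpace 𝓘(ℝ, EP) p where
  toFun z := B.fund z p
  map_add' z w :=
    map_add (mfderiv 𝓘(ℝ, EG) 𝓘(ℝ, EP) (fun g : G => B.act p g) 1 : EG →L[ℝ] EP) z w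
  map_smul' r z :=
    map_smul (mfderiv 𝓘(ℝ, EG) 𝓘(ℝ, EP) (fun g : G => B.act p g) 1 : EG →L[ℝ] EP) r z

section Connections

variable {EG : Type*} [NormedAddCommGroup EG] [NormedSpace ℝ EG] [FiniteDimensional ℝ EG]
  {G : Type*} [TopologicalSpace G] [ChartedSpace EG G] [Group G] [LieGroup 𝓘(ℝ, EG) ∞ G]
  {EM : Type*} [NormedAddCommGroup EM] [NormedSpace ℝ EM] [FiniteDimensional ℝ EM]
  {M : Type*} [TopologicalSpace M] [T2Space M] [ChartedSpace EM M] [IsManifold 𝓘(ℝ, EM) ∞ M]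
  {EP : Type*} [NormedAddCommGroup EP] [NormedSpace ℝ EP] [FiniteDimensional ℝ EP]
  {P : Type*} [TopologicalSpace P] [T2Space P] [ChartedSpace EP P] [IsManifold 𝓘(ℝ, EP) ∞ P]
  {F : Type*} [NormedAddCommGroup F] [NormedSpace ℝ F] [FiniteDimensional ℝ F]
  {Eh : P → Type*} [TopologicalSpace (TotalSpace F Eh)]
  [∀ p, AddCommGroup (Eh p)] [∀ p, Module ℝ (Eh p)] [∀ p, TopologicalSpace (Eh p)]
  [FiberBundle F Eh] [VectorBundle ℝ F Eh] [ContMDiffVectorBundle ∞ F Eh 𝓘(ℝ, EP)]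
variable {B : PrincipalBundle EG G EM M EP P} {C : ExactCourantAlgebroid EP P F Eh}
  {L : LiftedAction B C}

lemma isSmoothField_add {X Y : RoughField EP P} (hX : IsSmoothField X) (hY : IsSmoothField Y) :
    IsSmoothField (fun p => X p + Y p) :=
  ContMDiff.add_section hX hY

namespace Connection

variable (A : Connection B)

/-- The kernel of the projection consists of the vertical vectors, on which `A` inverts `z ↦ Y_z`.
-/
lemma bijective_prod_dproj {m : M} (p : B.Fibre m) :
    Function.Bijective ((A.toFun p.1).prod (B.dproj p)) := by
  constructor
  · refine (injective_iff_map_eq_zero _).2 fun v hv => ?_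
    obtain ⟨z, rfl⟩ := B.exists_fund_of_dproj_eq_zero p v (congrArg Prod.snd hv)
    have hz : z = 0 := (A.apply_fund p.1 z).symm.trans (congrArg Prod.fst hv)
    rw [hz]
    exact (B.fundMap p.1).map_zero
  · rintro ⟨z, x⟩
    obtain ⟨v, rfl⟩ := B.dproj_surjective p x
    refine ⟨v + B.fund (z - A.toFun p.1 v) p.1, Prod.ext ?_ ?_⟩
    · change A.toFun p.1 (v + B.fund (z - A.toFun p.1 v) p.1) = z
      rw [map_add, A.apply_fund, add_sub_cancel]
    · change B.dproj p (v + B.fund (z - A.toFun p.1 v) p.1) = _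
      rw [map_add, B.dproj_fund, add_zero]

lemma tangent_ext {m : M} (p : B.Fibre m) {v w : TangentSpace 𝓘(ℝ, EP) p.1}
    (h1 : A.toFun p.1 v = A.toFun p.1 w) (h2 : B.dproj p v = B.dproj p w) : v = w :=
  (A.bijective_prod_dproj p).1 (Prod.ext h1 h2)

/-- The horizontal lift at a point. -/
def horLift {m : M} (p : B.Fibre m) : TangentSpace 𝓘(ℝ, EM) m →ₗ[ℝ] TangentSpace 𝓘(ℝ, EP) p.1 :=
  (LinearEquiv.ofBijective _ (A.bijective_prod_dproj p)).symm.toLinearMap.comp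
    (LinearMap.inr ℝ (LieAlg EG G) (TangentSpace 𝓘(ℝ, EM) m))

lemma prod_horLift {m : M} (p : B.Fibre m) (x : TangentSpace 𝓘(ℝ, EM) m) :
    ((A.toFun p.1).prod (B.dproj p)) (A.horLift p x) = (0, x) :=
  (LinearEquiv.ofBijective _ (A.bijective_prod_dproj p)).apply_symm_apply (0, x)

lemma apply_horLift {m : M} (p : B.Fibre m) (x : TangentSpace 𝓘(ℝ, EM) m) :
    A.toFun p.1 (A.horLift p x) = 0 := congrArg Prod.fst (A.prod_horLift p x)

lemma dproj_horLift {m : M} (p : B.Fibre m) (x : TangentSpace 𝓘(ℝ, EM) m) :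
    B.dproj p (A.horLift p x) = x := congrArg Prod.snd (A.prod_horLift p x)

lemma dact_horLift {m : M} (p : B.Fibre m) (g : G) (x : TangentSpace 𝓘(ℝ, EM) m) :
    B.dact g p.1 (A.horLift p x) = A.horLift (B.actFibre p g) x := by
  refine A.tangent_ext (B.actFibre p g) ?_ ?_
  · rw [A.apply_horLift]
    refine (A.equivariant p.1 g _).trans ?_
    rw [A.apply_horLift]
    exact map_zero (mfderiv 𝓘(ℝ, EG) 𝓘(ℝ, EG) (fun h : G => g⁻¹ * h * g⁻¹⁻¹) 1 : EG →L[ℝ] EG)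
  · rw [A.dproj_horLift, B.dproj_dact, A.dproj_horLift]

/-- The horizontal part of a lift of a vector field. -/
lemma hor_eq_horLift {W : RoughField EP P} {m : M} (p : B.Fibre m) {x : TangentSpace 𝓘(ℝ, EM) m}
    (h : B.dproj p (W p.1) = x) : A.hor W p.1 = A.horLift p x := by
  refine A.tangent_ext p ?_ ?_
  · rw [A.apply_horLift, hor, map_sub]
    exact sub_eq_zero.2 (A.apply_fund _ _).symm
  · rw [A.dproj_horLift, hor, map_sub, ← h]
    exact (congrArg (_ - ·) (B.dproj_fund p _)).trans (sub_zero _)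

/-- The lift is the solution of `A(v) = 0`, `dproj v = X`. In base coordinates these are smooth
equations, bijective at each point. -/
lemma contMDiff_horLift {X : RoughField EM M} (hX : IsSmoothField X) :
    IsSmoothField (fun p => A.horLift (B := B) ⟨p, rfl⟩ (X (B.proj p))) := by
  intro p₀
  let T : (p : P) → TangentSpace 𝓘(ℝ, EP) p →ₗ[ℝ] EG × EM := fun p =>
    LinearMap.prod (A.toFun p)
      ((coordAt EM (V := fun m : M => TangentSpace 𝓘(ℝ, EM) m) (B.proj p₀) (B.proj p)).comp
        (B.dproj ⟨p, rfl⟩))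
  have hb : B.proj p₀ ∈
      (trivializationAt EM (fun m : M => TangentSpace 𝓘(ℝ, EM) m) (B.proj p₀)).baseSet :=
    FiberBundle.mem_baseSet_trivializationAt' _
  refine contMDiffAt_section_of_bijective (V := fun p : P => TangentSpace 𝓘(ℝ, EP) p) (W := EG × EM)
    (T := T) (fun s => ?_) ?_ ?_
  · refine ContMDiffAt.prodMk_space (A.smooth _ s.contMDiff p₀) ?_
    exact (contMDiffAt_totalSpace_coordAt (V := fun m : M => TangentSpace 𝓘(ℝ, EM) m)).1
      (B.contMDiff_dproj s.contMDiff p₀) |>.2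
  · have h1 := A.bijective_prod_dproj (B := B) ⟨p₀, rfl⟩
    have h2 := coordAt_bijective (F := EM) hb
    have h3 : (T p₀ : _ → EG × EM) = Prod.map id (coordAt EM (V := fun m : M =>
        TangentSpace 𝓘(ℝ, EM) m) (B.proj p₀) (B.proj p₀)) ∘
        (A.toFun p₀).prod (B.dproj ⟨p₀, rfl⟩) := rfl
    rw [h3]
    exact (Function.bijective_id.prodMap h2).comp h1
  · have h1 : (fun p => T p (A.horLift (B := B) ⟨p, rfl⟩ (X (B.proj p)))) = fun p =>
        ((0 : EG), coordAt EM (V := fun m : M => TangentSpace 𝓘(ℝ, EM) m) (B.proj p₀) (B.proj p)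
          (X (B.proj p))) := by
      funext p
      refine Prod.ext (A.apply_horLift (B := B) ⟨p, rfl⟩ _) ?_
      exact congrArg (coordAt EM (V := fun m : M => TangentSpace 𝓘(ℝ, EM) m) _ _)
        (A.dproj_horLift (B := B) ⟨p, rfl⟩ _)
    rw [h1]
    refine ContMDiffAt.prodMk_space contMDiffAt_const ?_
    exact (contMDiffAt_totalSpace_coordAt (V := fun m : M => TangentSpace 𝓘(ℝ, EM) m)
      (f := fun p => B.proj p) (s := fun p => X (B.proj p))).1
      ((hX.comp B.contMDiff_proj) p₀) |>.2

end Connection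

namespace LiftedAction.IsotropicSplitting

variable (l : L.IsotropicSplitting)

/-- The lift of tangent vectors given by a splitting. -/
def anchorLift {m : M} (p : B.Fibre m) :
    TangentSpace 𝓘(ℝ, EM) m →ₗ[ℝ] TangentSpace 𝓘(ℝ, EP) p.1 :=
  (C.anchor p.1).comp ((L.evalAt p).comp (l.toFun m))

lemma dproj_anchorLift {m : M} (p : B.Fibre m) (x : TangentSpace 𝓘(ℝ, EM) m) :
    B.dproj p (l.anchorLift p x) = x :=
  (L.redAnchor_eq p _).symm.trans (l.anchor_toFun m x)

lemma dact_anchorLift {m : M} (p : B.Fibre m) (g : G) (x : TangentSpace 𝓘(ℝ, EM) m) :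
    B.dact g p.1 (l.anchorLift p x) = l.anchorLift (B.actFibre p g) x := by
  have h : (l.toFun m x).1 (B.actFibre p g) = L.R g p.1 ((l.toFun m x).1 p) :=
    (l.toFun m x).2.2 p g
  change _ = C.anchor (B.act p.1 g) ((l.toFun m x).1 (B.actFibre p g))
  rw [h, L.R_anchor]
  rfl

lemma contMDiff_anchorLift {X : RoughField EM M} (hX : IsSmoothField X) :
    IsSmoothField (fun p => l.anchorLift (B := B) ⟨p, rfl⟩ (X (B.proj p))) := by
  obtain ⟨a, ha⟩ := l.smooth X hX
  have h : (fun p => l.anchorLift (B := B) ⟨p, rfl⟩ (X (B.proj p))) =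
      fun p => C.anchor p (a.1 p) := by
    funext p
    change C.anchor p ((l.toFun (B.proj p) (X (B.proj p))).1 ⟨p, rfl⟩) = _
    rw [← ha]; rfl
  rw [h]
  exact C.anchor_smooth a.1

/-- The isomorphism `𝔤 ⊕ T_m M ≅ T_p P` of a splitting. -/
lemma bijective_coprod {m : M} (p : B.Fibre m) :
    Function.Bijective ((B.fundMap p.1).coprod (l.anchorLift p)) := by
  constructor
  · refine (injective_iff_map_eq_zero _).2 fun x hx => ?_
    have hx' : B.fund x.1 p.1 + l.anchorLift p x.2 = 0 := hx
    have h2 : x.2 = 0 := by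
      have := congrArg (B.dproj p) hx'
      rwa [map_add, B.dproj_fund, l.dproj_anchorLift, zero_add, map_zero] at this
    rw [h2, map_zero, add_zero] at hx'
    exact Prod.ext (B.fund_injective p.1 _ hx') h2
  · intro v
    obtain ⟨z, hz⟩ := B.exists_fund_of_dproj_eq_zero p (v - l.anchorLift p (B.dproj p v))
      (by rw [map_sub, l.dproj_anchorLift, sub_self])
    exact ⟨(z, B.dproj p v), (sub_eq_iff_eq_add.1 hz).symm⟩

/-- The connection form of a splitting. -/
def connForm {m : M} (p : B.Fibre m) : TangentSpace 𝓘(ℝ, EP) p.1 →ₗ[ℝ] LieAlg EG G :=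
  (LinearMap.fst ℝ _ _).comp (LinearEquiv.ofBijective _ (l.bijective_coprod p)).symm.toLinearMap

lemma connForm_eq {m : M} (p : B.Fibre m) (z : LieAlg EG G) (x : TangentSpace 𝓘(ℝ, EM) m) :
    l.connForm p (B.fund z p.1 + l.anchorLift p x) = z :=
  congrArg Prod.fst ((LinearEquiv.ofBijective _ (l.bijective_coprod p)).symm_apply_apply (z, x))

lemma exists_eq_fund_add {m : M} (p : B.Fibre m) (v : TangentSpace 𝓘(ℝ, EP) p.1) :
    v = B.fund (l.connForm p v) p.1 + l.anchorLift p (B.dproj p v) := by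
  obtain ⟨⟨z, x⟩, rfl⟩ := (l.bijective_coprod p).2 v
  change B.fund z p.1 + l.anchorLift p x = B.fund (l.connForm p (B.fund z p.1 + l.anchorLift p x)) p.1
    + l.anchorLift p (B.dproj p (B.fund z p.1 + l.anchorLift p x))
  rw [l.connForm_eq, map_add, B.dproj_fund, l.dproj_anchorLift, zero_add]

/-- The connection form and the projected vector together solve the system `Y_z + λ(x) = W`, whose
coefficients are smooth: fundamental fields and lifts of a local frame of `T`. -/
lemma contMDiff_connForm {W : RoughField EP P} (hW : IsSmoothField W) :
    IsSmoothFun (EM := EP) (W := EG) (fun p => l.connForm (B := B) ⟨p, rfl⟩ (W p)) := by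
  intro p₀
  obtain ⟨X, hX⟩ := exists_frame (E := EM) (F := EM) (V := fun m : M => TangentSpace 𝓘(ℝ, EM) m)
    (B.proj p₀)
  let Ψ : (p : P) → (EG × EM) →ₗ[ℝ] TangentSpace 𝓘(ℝ, EP) p := fun p =>
    LinearMap.coprod (B.fundMap p) ((l.anchorLift (B := B) ⟨p, rfl⟩).comp
      ((evalSection (B.proj p)).comp X))
  let Φ : P → (EG × EM) →ₗ[ℝ] EP := fun p =>
    (coordAt EP (V := fun p : P => TangentSpace 𝓘(ℝ, EP) p) p₀ p).comp (Ψ p)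
  have hΦ : ∀ v, ContMDiffAt 𝓘(ℝ, EP) 𝓘(ℝ, EP) ∞ (fun p => Φ p v) p₀ := by
    intro v
    have h1 : IsSmoothField (fun p => Ψ p v) :=
      isSmoothField_add (L.contMDiff_fund v.1) (l.contMDiff_anchorLift (X v.2).contMDiff)
    exact ((contMDiffAt_totalSpace_coordAt (V := fun p : P => TangentSpace 𝓘(ℝ, EP) p)
      (f := fun p => p)).1 (h1 p₀)).2
  have hb : p₀ ∈ (trivializationAt EP (fun p : P => TangentSpace 𝓘(ℝ, EP) p) p₀).baseSet :=
    FiberBundle.mem_baseSet_trivializationAt' _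
  have hbij : Function.Bijective (Φ p₀) := by
    have h0 := hX.self_of_nhds
    have h1 : Function.Bijective ((evalSection (B.proj p₀)).comp X) := by
      have : ((evalSection (B.proj p₀)).comp X : EM → _) =
          (trivializationAt EM (fun m : M => TangentSpace 𝓘(ℝ, EM) m) (B.proj p₀)).symm (B.proj p₀) :=
        funext h0.2
      rw [this]
      exact ⟨Function.LeftInverse.injective (coordAt_symm h0.1),
        Function.RightInverse.surjective (symm_coordAt h0.1)⟩
    have h2 : (Ψ p₀ : EG × EM → _) = ((B.fundMap p₀).coprod (l.anchorLift (B := B) ⟨p₀, rfl⟩)) ∘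
        Prod.map id ((evalSection (B.proj p₀)).comp X) := rfl
    have h3 : Function.Bijective (Ψ p₀) := by
      rw [h2]
      exact (l.bijective_coprod (B := B) ⟨p₀, rfl⟩).comp (Function.bijective_id.prodMap h1)
    exact (coordAt_bijective (F := EP) hb).comp h3
  have hs := contMDiffAt_of_linear_system hΦ hbij
    (x := fun p => (l.connForm (B := B) ⟨p, rfl⟩ (W p), coordAt EM (V := fun m : M =>
      TangentSpace 𝓘(ℝ, EM) m) (B.proj p₀) (B.proj p) (B.dproj ⟨p, rfl⟩ (W p))))
    (y := fun p => coordAt EP (V := fun p : P => TangentSpace 𝓘(ℝ, EP) p) p₀ p (W p))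
    ((contMDiffAt_totalSpace_coordAt (V := fun p : P => TangentSpace 𝓘(ℝ, EP) p)
      (f := fun p => p)).1 (hW p₀)).2 ?_
  · have h1 := ContMDiffAt.comp p₀
      (ContinuousLinearMap.contMDiff (ContinuousLinearMap.fst ℝ EG EM)).contMDiffAt hs
    exact h1
  · filter_upwards [B.contMDiff_proj.continuous.continuousAt hX] with p hp
    refine congrArg (coordAt EP (V := fun p : P => TangentSpace 𝓘(ℝ, EP) p) p₀ p) ?_
    have h1 : X (coordAt EM (V := fun m : M => TangentSpace 𝓘(ℝ, EM) m) (B.proj p₀) (B.proj p)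
        (B.dproj ⟨p, rfl⟩ (W p))) (B.proj p) = B.dproj ⟨p, rfl⟩ (W p) := by
      rw [hp.2, symm_coordAt hp.1]
    refine Eq.trans ?_ (l.exists_eq_fund_add (B := B) ⟨p, rfl⟩ (W p)).symm
    exact congrArg (fun y => B.fund (l.connForm (B := B) ⟨p, rfl⟩ (W p)) p +
      l.anchorLift (B := B) ⟨p, rfl⟩ y) h1

lemma connForm_dact {m : M} (p : B.Fibre m) (g : G) (v : TangentSpace 𝓘(ℝ, EP) p.1) :
    l.connForm (B.actFibre p g) (B.dact g p.1 v) = adjoint g⁻¹ (l.connForm p v) := by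
  obtain ⟨⟨z, x⟩, rfl⟩ := (l.bijective_coprod p).2 v
  change l.connForm (B.actFibre p g) (B.dact g p.1 (B.fund z p.1 + l.anchorLift p x)) =
    adjoint g⁻¹ (l.connForm p (B.fund z p.1 + l.anchorLift p x))
  rw [l.connForm_eq, map_add, L.dact_fund, l.dact_anchorLift]
  exact l.connForm_eq (B.actFibre p g) _ _

/-- The connection determined by a splitting. -/
def conn : Connection B where
  toFun p := l.connForm ⟨p, rfl⟩
  apply_fund p z := by
    have := l.connForm_eq (B := B) ⟨p, rfl⟩ z 0
    rwa [map_zero, add_zero] at this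
  equivariant p g v := by
    -- The base points of `p` and `p · g` agree only propositionally, so the form must be seen not
    -- to depend on how the base point is named.
    have key : ∀ m (q : B.Fibre m) (w : TangentSpace 𝓘(ℝ, EP) q.1),
        l.connForm (B := B) ⟨q.1, rfl⟩ w = l.connForm q w := by
      rintro _ ⟨q, rfl⟩ w; rfl
    exact (key _ (B.actFibre ⟨p, rfl⟩ g) _).trans (l.connForm_dact (B := B) ⟨p, rfl⟩ g v)
  smooth W hW := l.contMDiff_connForm hW

lemma induces_conn : l.Induces l.conn := by
  rintro _ X ⟨p, rfl⟩
  have := l.connForm_eq (B := B) ⟨p, rfl⟩ 0 X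
  have h0 : B.fund (0 : LieAlg EG G) p = 0 := (B.fundMap p).map_zero
  rw [h0, zero_add] at this
  exact this

variable {l}

lemma Induces.anchorLift_eq {A : Connection B} (h : l.Induces A) {m : M} (p : B.Fibre m)
    (x : TangentSpace 𝓘(ℝ, EM) m) : l.anchorLift p x = A.horLift p x := by
  refine A.tangent_ext p ?_ ?_
  · rw [A.apply_horLift]; exact h m x p
  · rw [A.dproj_horLift, l.dproj_anchorLift]

/-- Vertical vectors and the lifts given by `λ` span the tangent space of `P`; on the former every
connection is prescribed, on the latter it vanishes. -/
lemma Induces.eq_conn {A : Connection B} (h : l.Induces A) : A = l.conn := by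
  refine Connection.ext (funext fun p => LinearMap.ext fun v => ?_)
  have h1 := l.exists_eq_fund_add (B := B) ⟨p, rfl⟩ v
  have h2 : A.toFun p (l.anchorLift (B := B) ⟨p, rfl⟩ (B.dproj ⟨p, rfl⟩ v)) = 0 :=
    h _ _ ⟨p, rfl⟩
  conv_lhs => rw [h1]
  rw [map_add, A.apply_fund, h2, add_zero]
  rfl

lemma existsUnique_connection (l : L.IsotropicSplitting) : ∃! A : Connection B, l.Induces A :=
  ⟨l.conn, l.induces_conn, fun _ h => h.eq_conn⟩

end LiftedAction.IsotropicSplitting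

end Connections

/-! ## Vector fields as derivations, and related vector fields -/

section Fields

variable {E : Type*} [NormedAddCommGroup E] [NormedSpace ℝ E] [FiniteDimensional ℝ E]
  {N : Type*} [TopologicalSpace N] [T2Space N] [ChartedSpace E N] [IsManifold 𝓘(ℝ, E) ∞ N]

lemma isSmoothField_lieBr {X Y : RoughField E N} (hX : IsSmoothField X) (hY : IsSmoothField Y) :
    IsSmoothField (lieBr X Y) := by
  have : IsManifold 𝓘(ℝ, E) ((∞ : ℕ∞ω) + 1) N := by
    change IsManifold 𝓘(ℝ, E) ∞ N; infer_instance
  have : IsManifold 𝓘(ℝ, E) (minSmoothness ℝ 2) N := by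
    rw [minSmoothness_of_isRCLikeNormedField]; infer_instance
  have := ContDiff.mlieBracket_vectorField (m := ⊤) (n := ⊤) hX hY (by simp)
  exact this

lemma contMDiff_dirDeriv {X : RoughField E N} (hX : IsSmoothField X) {f : N → ℝ}
    (hf : IsSmoothFun (EM := E) f) : IsSmoothFun (EM := E) (dirDeriv X f) := by
  have h : ContMDiff 𝓘(ℝ, E) 𝓘(ℝ, ℝ).tangent ∞ (fun m =>
      (⟨f m, mfderiv 𝓘(ℝ, E) 𝓘(ℝ, ℝ) f m (X m)⟩ : TangentBundle 𝓘(ℝ, ℝ) ℝ)) :=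
    (hf.contMDiff_tangentMap (m := ∞) (by simp)).comp hX
  intro m
  have h1 := ((contMDiffAt_totalSpace (F := ℝ) (E := fun x : ℝ => TangentSpace 𝓘(ℝ, ℝ) x)).1 (h m)).2
  simp only [trivializationAt_model_space_apply] at h1
  exact h1

lemma lieBr_smul (X : RoughField E N) {Y : RoughField E N} (hY : IsSmoothField Y) {f : N → ℝ}
    (hf : IsSmoothFun (EM := E) f) (m : N) :
    lieBr X (fun m => f m • Y m) m = dirDeriv X f m • Y m + f m • lieBr X Y m :=
  mlieBracket_smul_right (hf.mdifferentiable (by simp) m) (hY.mdifferentiable (by simp) m)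

/-- The Lie bracket of vector fields acts on functions as the commutator. -/
lemma dirDeriv_lieBr {X Y : RoughField E N} (hX : IsSmoothField X) (hY : IsSmoothField Y)
    {f : N → ℝ} (hf : IsSmoothFun (EM := E) f) (m : N) :
    dirDeriv (lieBr X Y) f m = dirDeriv X (dirDeriv Y f) m - dirDeriv Y (dirDeriv X f) m := by
  by_cases htriv : ∃ v : TangentSpace 𝓘(ℝ, E) m, v ≠ 0
  swap
  · have h0 : ∀ v : TangentSpace 𝓘(ℝ, E) m, v = 0 := fun v => by
      by_contra hv; exact htriv ⟨v, hv⟩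
    have h1 : ∀ (Z : RoughField E N) (h : N → ℝ), dirDeriv Z h m = 0 := fun Z h => by
      rw [dirDeriv, h0 (Z m)]; exact map_zero _
    simp [h1]
  -- Choose a field `Z` with `Z(m) = v ≠ 0` and expand the Jacobi identity for `X`, `Y`, `fZ`. After
  -- the Jacobi identity for `Z` itself is removed, what remains is the claim times `Z(m)`.
  obtain ⟨v, hv⟩ := htriv
  obtain ⟨s, hs⟩ := exists_section_eq (E := E) (F := E)
    (V := fun m : N => TangentSpace 𝓘(ℝ, E) m) m v
  let Z : RoughField E N := fun m => s m
  have hZ : IsSmoothField Z := s.contMDiff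
  have hsm : ∀ {Z : RoughField E N}, IsSmoothField Z → ∀ {h : N → ℝ}, IsSmoothFun (EM := E) h →
      IsSmoothField (fun m => h m • Z m) := fun hZ _ hh => ContMDiff.smul_section hh hZ
  have hms : minSmoothness ℝ 2 ≤ (∞ : ℕ∞ω) := by
    rw [minSmoothness_of_isRCLikeNormedField]; exact WithTop.coe_le_coe.2 (le_top : (2 : ℕ∞) ≤ ⊤)
  have : IsManifold 𝓘(ℝ, E) (minSmoothness ℝ 3) N := by
    rw [minSmoothness_of_isRCLikeNormedField]; infer_instance
  have hJ : ∀ {W : RoughField E N}, IsSmoothField W → ∀ m, lieBr X (lieBr Y W) m =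
      lieBr (lieBr X Y) W m + lieBr Y (lieBr X W) m := fun hW m =>
    leibniz_identity_mlieBracket_apply ((hX m).of_le hms) ((hY m).of_le hms) ((hW m).of_le hms)
  have hadd : ∀ {X W W' : RoughField E N}, IsSmoothField W → IsSmoothField W' → ∀ m,
      lieBr X (fun m => W m + W' m) m = lieBr X W m + lieBr X W' m := fun hW hW' m =>
    mlieBracket_add_right (hW.mdifferentiable (by simp) m) (hW'.mdifferentiable (by simp) m)
  have hXf := contMDiff_dirDeriv hX hf
  have hYf := contMDiff_dirDeriv hY hf
  have hXZ := isSmoothField_lieBr hX hZ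
  have hYZ := isSmoothField_lieBr hY hZ
  have hexp : ∀ {X Y : RoughField E N}, IsSmoothField X → IsSmoothField Y →
      lieBr X (lieBr Y (fun m => f m • Z m)) m =
        dirDeriv X (dirDeriv Y f) m • Z m + dirDeriv Y f m • lieBr X Z m +
          (dirDeriv X f m • lieBr Y Z m + f m • lieBr X (lieBr Y Z) m) := by
    intro X Y hX hY
    have h1 : lieBr Y (fun m => f m • Z m) =
        fun m => dirDeriv Y f m • Z m + f m • lieBr Y Z m := funext fun m => lieBr_smul Y hZ hf m
    rw [h1, hadd (hsm hZ (contMDiff_dirDeriv hY hf)) (hsm (isSmoothField_lieBr hY hZ) hf),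
      lieBr_smul X hZ (contMDiff_dirDeriv hY hf), lieBr_smul X (isSmoothField_lieBr hY hZ) hf]
  have h1 := hJ (hsm hZ hf) m
  rw [hexp hX hY, hexp hY hX, lieBr_smul _ hZ hf, hJ hZ m] at h1
  have hZm : Z m = v := hs
  have h2 : (dirDeriv (lieBr X Y) f m -
      (dirDeriv X (dirDeriv Y f) m - dirDeriv Y (dirDeriv X f) m)) • Z m = 0 := by
    have h3 := sub_eq_zero.2 h1
    rw [← neg_eq_zero, ← h3]
    module
  rw [hZm] at h2
  exact sub_eq_zero.1 ((smul_eq_zero.1 h2).resolve_right hv)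

/-- Smooth functions separate tangent vectors. -/
lemma tangent_eq_of_forall_mfderiv {m : N} {v w : TangentSpace 𝓘(ℝ, E) m}
    (h : ∀ f : N → ℝ, IsSmoothFun (EM := E) f →
      (mfderiv 𝓘(ℝ, E) 𝓘(ℝ, ℝ) f m v : ℝ) = mfderiv 𝓘(ℝ, E) 𝓘(ℝ, ℝ) f m w) : v = w := by
  obtain ⟨χ⟩ : Nonempty (SmoothBumpFunction 𝓘(ℝ, E) m) := inferInstance
  -- A cut-off chart is a global smooth map to `E` with invertible differential at `m`, and linear
  -- functionals of it are smooth functions.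
  let φ : N → E := fun x => χ x • extChartAt 𝓘(ℝ, E) m x
  have hφ : ContMDiff 𝓘(ℝ, E) 𝓘(ℝ, E) ∞ φ := χ.contMDiff_smul contMDiffOn_extChartAt
  have hev : φ =ᶠ[𝓝 m] extChartAt 𝓘(ℝ, E) m := by
    filter_upwards [χ.eventuallyEq_one] with x hx
    simp [φ, hx]
  have h1 : (mfderiv 𝓘(ℝ, E) 𝓘(ℝ, E) φ m v : E) = mfderiv 𝓘(ℝ, E) 𝓘(ℝ, E) φ m w := by
    let d : E := mfderiv 𝓘(ℝ, E) 𝓘(ℝ, E) φ m v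
    let d' : E := mfderiv 𝓘(ℝ, E) 𝓘(ℝ, E) φ m w
    change d = d'
    refine (Module.forall_dual_apply_eq_zero_iff ℝ (d - d')).1 (fun ψ => ?_) |> sub_eq_zero.1
    rw [map_sub, sub_eq_zero]
    let ψ' : E →L[ℝ] ℝ := LinearMap.toContinuousLinearMap ψ
    have h2 : ∀ v : TangentSpace 𝓘(ℝ, E) m,
        (mfderiv 𝓘(ℝ, E) 𝓘(ℝ, ℝ) (ψ' ∘ φ) m v : ℝ) = ψ (mfderiv 𝓘(ℝ, E) 𝓘(ℝ, E) φ m v : E) := by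
      intro v
      refine (mfderiv_comp_apply (I := 𝓘(ℝ, E)) (I' := 𝓘(ℝ, E)) (I'' := 𝓘(ℝ, ℝ)) m
        ψ'.mdifferentiableAt (hφ.mdifferentiable (by simp) m) v).trans ?_
      rw [ψ'.mfderiv_eq]
      rfl
    exact (h2 v).symm.trans ((h _ (ψ'.contMDiff.comp hφ)).trans (h2 w))
  rw [hev.mfderiv_eq] at h1
  have h3 := isInvertible_mfderiv_extChartAt (I := 𝓘(ℝ, E)) (mem_extChartAt_source (I := 𝓘(ℝ, E)) m)
  exact h3.injective h1

end Fields

section RelatedFields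

variable {EG : Type*} [NormedAddCommGroup EG] [NormedSpace ℝ EG] [FiniteDimensional ℝ EG]
  {G : Type*} [TopologicalSpace G] [ChartedSpace EG G] [Group G] [LieGroup 𝓘(ℝ, EG) ∞ G]
  {EM : Type*} [NormedAddCommGroup EM] [NormedSpace ℝ EM] [FiniteDimensional ℝ EM]
  {M : Type*} [TopologicalSpace M] [T2Space M] [ChartedSpace EM M] [IsManifold 𝓘(ℝ, EM) ∞ M]
  {EP : Type*} [NormedAddCommGroup EP] [NormedSpace ℝ EP] [FiniteDimensional ℝ EP]
  {P : Type*} [TopologicalSpace P] [T2Space P] [ChartedSpace EP P] [IsManifold 𝓘(ℝ, EP) ∞ P]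
  {F : Type*} [NormedAddCommGroup F] [NormedSpace ℝ F] [FiniteDimensional ℝ F]
  {Eh : P → Type*} [TopologicalSpace (TotalSpace F Eh)]
  [∀ p, AddCommGroup (Eh p)] [∀ p, Module ℝ (Eh p)] [∀ p, TopologicalSpace (Eh p)]
  [FiberBundle F Eh] [VectorBundle ℝ F Eh] [ContMDiffVectorBundle ∞ F Eh 𝓘(ℝ, EP)]
/-- The Lie bracket of vector fields on `P` that are related to fields on `M` is related to the
Lie bracket of the latter. -/
lemma PrincipalBundle.dproj_lieBr (B : PrincipalBundle EG G EM M EP P) {X Y : RoughField EP P}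
    {X' Y' : RoughField EM M} (hX : IsSmoothField X) (hY : IsSmoothField Y)
    (hX' : IsSmoothField X') (hY' : IsSmoothField Y') (h : B.IsLift X X') (h' : B.IsLift Y Y')
    {m : M} (p : B.Fibre m) : B.dproj p (lieBr X Y p.1) = lieBr X' Y' m := by
  -- Tested on `f`, both sides are commutators of derivations, and related fields act on `f ∘ proj`
  -- as their images act on `f`.
  refine tangent_eq_of_forall_mfderiv fun f hf => ?_
  have hcomp : ∀ {Z : RoughField EP P} {Z' : RoughField EM M}, B.IsLift Z Z' →
      ∀ {f : M → ℝ}, IsSmoothFun (EM := EM) f →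
      dirDeriv Z (fun q => f (B.proj q)) = fun q => dirDeriv Z' f (B.proj q) :=
    fun hZ _ hf => funext fun q =>
      LiftedAction.dirDeriv_comp_proj (B := B) ⟨q, rfl⟩ (hZ _ ⟨q, rfl⟩) hf
  have hfp : IsSmoothFun (EM := EP) (fun q => f (B.proj q)) := hf.comp B.contMDiff_proj
  have h1 := dirDeriv_lieBr hX hY hfp p.1
  rw [hcomp h hf, hcomp h' hf, hcomp h (contMDiff_dirDeriv hY' hf),
    hcomp h' (contMDiff_dirDeriv hX' hf)] at h1
  obtain ⟨p, rfl⟩ := p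
  have h2 := dirDeriv_lieBr hX' hY' hf (B.proj p)
  refine Eq.trans (Eq.symm ?_) (h1.trans h2.symm)
  exact mfderiv_comp_apply p (hf.mdifferentiable (by simp) _)
    (B.contMDiff_proj.mdifferentiable (by simp) p) (lieBr X Y p)

end RelatedFields

/-! ## The bracket of `E` -/

namespace LiftedAction

section Bracket

variable {EG : Type*} [NormedAddCommGroup EG] [NormedSpace ℝ EG] [FiniteDimensional ℝ EG]
  {G : Type*} [TopologicalSpace G] [ChartedSpace EG G] [Group G] [LieGroup 𝓘(ℝ, EG) ∞ G]
  {EM : Type*} [NormedAddCommGroup EM] [NormedSpace ℝ EM] [FiniteDimensional ℝ EM]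
  {M : Type*} [TopologicalSpace M] [T2Space M] [ChartedSpace EM M] [IsManifold 𝓘(ℝ, EM) ∞ M]
  {EP : Type*} [NormedAddCommGroup EP] [NormedSpace ℝ EP] [FiniteDimensional ℝ EP]
  {P : Type*} [TopologicalSpace P] [T2Space P] [ChartedSpace EP P] [IsManifold 𝓘(ℝ, EP) ∞ P]
  {F : Type*} [NormedAddCommGroup F] [NormedSpace ℝ F] [FiniteDimensional ℝ F]
  {Eh : P → Type*} [TopologicalSpace (TotalSpace F Eh)]
  [∀ p, AddCommGroup (Eh p)] [∀ p, Module ℝ (Eh p)] [∀ p, TopologicalSpace (Eh p)]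
  [FiberBundle F Eh] [VectorBundle ℝ F Eh] [ContMDiffVectorBundle ∞ F Eh 𝓘(ℝ, EP)]
variable {B : PrincipalBundle EG G EM M EP P} {C : ExactCourantAlgebroid EP P F Eh}
  (L : LiftedAction B C) {c : LinearMap.BilinForm ℝ (LieAlg EG G)}

/-- The product of two sections of `E`. -/
def secPairing (a b : L.RedSection) (m : M) : ℝ :=
  L.redPairing m (RedSection.eval a m) (RedSection.eval b m)

/-- The vector field on `M` under a section of `E`. -/
def secAnchor (a : L.RedSection) : RoughField EM M := fun m => L.redAnchor m (RedSection.eval a m)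

variable {L}

lemma RedSection.ext_eval {a b : L.RedSection} (h : ∀ m, RedSection.eval a m = RedSection.eval b m) :
    a = b := by
  refine Subtype.ext (DFunLike.ext _ _ fun p => ?_)
  exact congrFun (congrArg Subtype.val (h (B.proj p))) ⟨p, rfl⟩

lemma RedSection.eval_add (a b : L.RedSection) (m : M) :
    RedSection.eval (a + b) m = RedSection.eval a m + RedSection.eval b m := rfl

lemma RedSection.eval_sub (a b : L.RedSection) (m : M) :
    RedSection.eval (a - b) m = RedSection.eval a m - RedSection.eval b m := rfl

lemma RedSection.eval_smul (r : ℝ) (a : L.RedSection) (m : M) :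
    RedSection.eval (r • a) m = r • RedSection.eval a m := rfl

variable (L)

lemma secPairing_symm (a b : L.RedSection) : L.secPairing a b = L.secPairing b a :=
  funext fun m => L.redPairing_symm m _ _

lemma secPairing_add_left (a a' b : L.RedSection) (m : M) :
    L.secPairing (a + a') b m = L.secPairing a b m + L.secPairing a' b m := by
  simp [secPairing, RedSection.eval_add]

lemma secPairing_smul_left (r : ℝ) (a b : L.RedSection) (m : M) :
    L.secPairing (r • a) b m = r * L.secPairing a b m := by
  simp [secPairing, RedSection.eval_smul]

lemma secPairing_add_right (a b b' : L.RedSection) (m : M) :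
    L.secPairing a (b + b') m = L.secPairing a b m + L.secPairing a b' m := by
  simp [secPairing, RedSection.eval_add]

lemma secPairing_smul_right (r : ℝ) (a b : L.RedSection) (m : M) :
    L.secPairing a (r • b) m = r * L.secPairing a b m := by
  simp [secPairing, RedSection.eval_smul]

lemma redBracket_add_left (a a' b : L.RedSection) :
    L.redBracket (a + a') b = L.redBracket a b + L.redBracket a' b :=
  Subtype.ext (LinearMap.map_add₂ C.bracket a.1 a'.1 b.1)

lemma redBracket_add_right (a b b' : L.RedSection) :
    L.redBracket a (b + b') = L.redBracket a b + L.redBracket a b' :=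
  Subtype.ext (map_add (C.bracket a.1) b.1 b'.1)

lemma redBracket_smul_left (r : ℝ) (a b : L.RedSection) :
    L.redBracket (r • a) b = r • L.redBracket a b :=
  Subtype.ext (LinearMap.map_smul₂ C.bracket r a.1 b.1)

lemma redBracket_smul_right (r : ℝ) (a b : L.RedSection) :
    L.redBracket a (r • b) = r • L.redBracket a b :=
  Subtype.ext (map_smul (C.bracket a.1) r b.1)

lemma isLift_anchor (a : L.RedSection) :
    B.IsLift (fun q => C.anchor q (a.1 q)) (L.secAnchor a) :=
  fun m p => (L.redAnchor_eq p (RedSection.eval a m)).symm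

lemma secPairing_proj (a b : L.RedSection) :
    (fun q => C.pairing q (a.1 q) (b.1 q)) = fun q => L.secPairing a b (B.proj q) :=
  funext fun q => (L.redPairing_eq ⟨q, rfl⟩ (RedSection.eval a _) (RedSection.eval b _)).symm

lemma dirDeriv_secPairing_proj (a b d : L.RedSection) {m : M} (p : B.Fibre m) :
    dirDeriv (fun q => C.anchor q (a.1 q)) (fun q => C.pairing q (b.1 q) (d.1 q)) p.1 =
      dirDeriv (L.secAnchor a) (L.secPairing b d) m := by
  rw [L.secPairing_proj]
  exact dirDeriv_comp_proj p (L.isLift_anchor a m p) (L.contMDiff_redPairing b d)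

lemma secAnchor_redBracket (a b : L.RedSection) :
    L.secAnchor (L.redBracket a b) = lieBr (L.secAnchor a) (L.secAnchor b) := by
  funext m
  let p := B.pt m
  rw [secAnchor, L.redAnchor_eq p]
  refine (congrArg (B.dproj p) (C.anchor_bracket a.1 b.1 p.1)).trans ?_
  exact B.dproj_lieBr (C.anchor_smooth a.1) (C.anchor_smooth b.1) (L.contMDiff_redAnchor a)
    (L.contMDiff_redAnchor b) (L.isLift_anchor a) (L.isLift_anchor b) p

lemma secPairing_compat (a b d : L.RedSection) (m : M) :
    dirDeriv (L.secAnchor a) (L.secPairing b d) m =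
      L.secPairing (L.redBracket a b) d m + L.secPairing b (L.redBracket a d) m := by
  let p := B.pt m
  rw [← L.dirDeriv_secPairing_proj a b d p, C.metric_compat, secPairing, secPairing,
    L.redPairing_eq p, L.redPairing_eq p]
  rfl

lemma secPairing_redBracket_symm (a b d : L.RedSection) (m : M) :
    L.secPairing (L.redBracket a b) d m + L.secPairing (L.redBracket b a) d m =
      dirDeriv (L.secAnchor d) (L.secPairing a b) m := by
  let p := B.pt m
  rw [← L.dirDeriv_secPairing_proj d a b p, ← C.bracket_symm, secPairing, secPairing,
    L.redPairing_eq p, L.redPairing_eq p]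
  rfl

lemma redBracket_jacobi (a b d : L.RedSection) :
    L.redBracket a (L.redBracket b d) =
      L.redBracket (L.redBracket a b) d + L.redBracket b (L.redBracket a d) :=
  Subtype.ext (C.jacobi a.1 b.1 d.1)

namespace IsotropicSplitting

variable {L} (l : L.IsotropicSplitting)

/-- The splitting on smooth vector fields. -/
def liftSec : Cₛ^∞⟮𝓘(ℝ, EM); EM, fun m : M => TangentSpace 𝓘(ℝ, EM) m⟯ →ₗ[ℝ] L.RedSection where
  toFun X := (l.smooth (fun m => X m) X.contMDiff).choose
  -- Smoothness of a splitting only asserts that a section exists; its values determine it, which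
  -- makes the choice linear.
  map_add' X Y := RedSection.ext_eval fun m => by
    have h := fun X : Cₛ^∞⟮𝓘(ℝ, EM); EM, fun m : M => TangentSpace 𝓘(ℝ, EM) m⟯ =>
      (l.smooth (fun m => X m) X.contMDiff).choose_spec m
    rw [RedSection.eval_add, h, h, h, ← map_add]
    rfl
  map_smul' r X := RedSection.ext_eval fun m => by
    have h := fun X : Cₛ^∞⟮𝓘(ℝ, EM); EM, fun m : M => TangentSpace 𝓘(ℝ, EM) m⟯ =>
      (l.smooth (fun m => X m) X.contMDiff).choose_spec m
    rw [RedSection.eval_smul, h, h, RingHom.id_apply, ← map_smul]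
    rfl

lemma eval_liftSec (X : Cₛ^∞⟮𝓘(ℝ, EM); EM, fun m : M => TangentSpace 𝓘(ℝ, EM) m⟯) (m : M) :
    RedSection.eval (l.liftSec X) m = l.toFun m (X m) :=
  (l.smooth (fun m => X m) X.contMDiff).choose_spec m

lemma secAnchor_liftSec (X : Cₛ^∞⟮𝓘(ℝ, EM); EM, fun m : M => TangentSpace 𝓘(ℝ, EM) m⟯) :
    L.secAnchor (l.liftSec X) = fun m => X m :=
  funext fun m => by rw [secAnchor, eval_liftSec, l.anchor_toFun]

lemma secPairing_liftSec (X Y : Cₛ^∞⟮𝓘(ℝ, EM); EM, fun m : M => TangentSpace 𝓘(ℝ, EM) m⟯) :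
    L.secPairing (l.liftSec X) (l.liftSec Y) = fun _ => 0 :=
  funext fun m => by rw [secPairing, eval_liftSec, eval_liftSec, l.isotropic]

lemma cotPart_eval (a : L.RedSection)
    (Z : Cₛ^∞⟮𝓘(ℝ, EM); EM, fun m : M => TangentSpace 𝓘(ℝ, EM) m⟯) (m : M) :
    l.cotPart m (RedSection.eval a m) (Z m) = 2 * L.secPairing a (l.liftSec Z) m := by
  rw [secPairing, eval_liftSec]; rfl

/-- `2⟨[λX, λY], λZ⟩`. -/
def torsion (X Y Z : Cₛ^∞⟮𝓘(ℝ, EM); EM, fun m : M => TangentSpace 𝓘(ℝ, EM) m⟯) (m : M) : ℝ :=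
  2 * L.secPairing (L.redBracket (l.liftSec X) (l.liftSec Y)) (l.liftSec Z) m

/-- The symmetric part of the bracket is the differential of `⟨λX, λY⟩ = 0`. -/
lemma torsion_swap_left (X Y Z : Cₛ^∞⟮𝓘(ℝ, EM); EM, fun m : M => TangentSpace 𝓘(ℝ, EM) m⟯) (m : M) :
    l.torsion Y X Z m = -l.torsion X Y Z m := by
  have h := L.secPairing_redBracket_symm (l.liftSec X) (l.liftSec Y) (l.liftSec Z) m
  rw [secPairing_liftSec, dirDeriv_const] at h
  unfold torsion
  linarith

/-- Metric compatibility, applied to the constant function `⟨λY, λZ⟩ = 0`. -/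
lemma torsion_swap_right (X Y Z : Cₛ^∞⟮𝓘(ℝ, EM); EM, fun m : M => TangentSpace 𝓘(ℝ, EM) m⟯) (m : M) :
    l.torsion X Z Y m = -l.torsion X Y Z m := by
  have h := L.secPairing_compat (l.liftSec X) (l.liftSec Y) (l.liftSec Z) m
  rw [secPairing_liftSec, dirDeriv_const, L.secPairing_symm (l.liftSec Y)] at h
  unfold torsion
  linarith

/-- Dependence on `Z` is through a product, hence pointwise; skew-symmetry moves each of the other
arguments into that slot. -/
lemma torsion_congr {X Y Z X' Y' Z' : Cₛ^∞⟮𝓘(ℝ, EM); EM, fun m : M => TangentSpace 𝓘(ℝ, EM) m⟯}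
    {m : M} (hX : X m = X' m) (hY : Y m = Y' m) (hZ : Z m = Z' m) :
    l.torsion X Y Z m = l.torsion X' Y' Z' m := by
  have key : ∀ {X Y Z Z' : Cₛ^∞⟮𝓘(ℝ, EM); EM, fun m : M => TangentSpace 𝓘(ℝ, EM) m⟯},
      Z m = Z' m → l.torsion X Y Z m = l.torsion X Y Z' m := by
    intro X Y Z Z' h
    rw [torsion, torsion, secPairing, secPairing, eval_liftSec, eval_liftSec, h]
  rw [key hZ, ← neg_neg (l.torsion X Y Z' m), ← torsion_swap_right, key hY, torsion_swap_right,
    neg_neg, ← neg_neg (l.torsion X Y' Z' m), ← torsion_swap_left, ← neg_neg (l.torsion Y' X Z' m),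
    ← torsion_swap_right, key hX, torsion_swap_right, neg_neg, torsion_swap_left, neg_neg]

/-- The 3-form `H(X, Y, Z) = 2⟨[λX, λY], λZ⟩` of a splitting. -/
lemma exists_threeForm : ∃ H : ThreeForm EM M,
    ∀ (X Y Z : Cₛ^∞⟮𝓘(ℝ, EM); EM, fun m : M => TangentSpace 𝓘(ℝ, EM) m⟯) m,
      H.toFun m ![X m, Y m, Z m] = l.torsion X Y Z m := by
  -- Tangent vectors are extended to fields linearly, so that multilinearity is inherited from the
  -- bracket; by `torsion_congr` the extension does not matter.
  have hext : ∀ m : M, ∃ S : TangentSpace 𝓘(ℝ, EM) m →ₗ[ℝ]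
      Cₛ^∞⟮𝓘(ℝ, EM); EM, fun m : M => TangentSpace 𝓘(ℝ, EM) m⟯, ∀ v, S v m = v := by
    intro m
    obtain ⟨S, hS⟩ := (evalSection (E := EM) (F := EM)
      (V := fun m : M => TangentSpace 𝓘(ℝ, EM) m) m).exists_rightInverse_of_surjective
      (LinearMap.range_eq_top.2 fun v => exists_section_eq m v)
    exact ⟨S, fun v => LinearMap.congr_fun hS v⟩
  choose S hS using hext
  have hne : (0 : Fin 3) ≠ 1 ∧ (0 : Fin 3) ≠ 2 ∧ (1 : Fin 3) ≠ 0 ∧ (1 : Fin 3) ≠ 2 ∧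
      (2 : Fin 3) ≠ 0 ∧ (2 : Fin 3) ≠ 1 := by decide
  have hcases : ∀ i : Fin 3, i = 0 ∨ i = 1 ∨ i = 2 := by decide
  let τ : (m : M) → (TangentSpace 𝓘(ℝ, EM) m) [⋀^Fin 3]→ₗ[ℝ] ℝ := fun m =>
    { toFun := fun v => l.torsion (S m (v 0)) (S m (v 1)) (S m (v 2)) m
      map_update_add' := by
        intro _ v i x y
        obtain rfl | rfl | rfl : i = 0 ∨ i = 1 ∨ i = 2 := hcases i
        all_goals simp only [Function.update_self, Function.update_of_ne hne.1,
          Function.update_of_ne hne.2.1, Function.update_of_ne hne.2.2.1,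
          Function.update_of_ne hne.2.2.2.1, Function.update_of_ne hne.2.2.2.2.1,
          Function.update_of_ne hne.2.2.2.2.2, torsion, map_add, redBracket_add_left,
          redBracket_add_right, secPairing_add_left, secPairing_add_right, mul_add]
      map_update_smul' := by
        intro _ v i r x
        obtain rfl | rfl | rfl : i = 0 ∨ i = 1 ∨ i = 2 := hcases i
        all_goals simp only [Function.update_self, Function.update_of_ne hne.1,
          Function.update_of_ne hne.2.1, Function.update_of_ne hne.2.2.1,
          Function.update_of_ne hne.2.2.2.1, Function.update_of_ne hne.2.2.2.2.1,
          Function.update_of_ne hne.2.2.2.2.2, torsion, map_smul, redBracket_smul_left,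
          redBracket_smul_right, secPairing_smul_left, secPairing_smul_right, smul_eq_mul,
          mul_left_comm]
      map_eq_zero_of_eq' := by
        intro v i j hij hne
        have h1 : ∀ X Y, l.torsion X X Y m = 0 := fun X Y => by
          have := l.torsion_swap_left X X Y m; linarith
        have h2 : ∀ X Y, l.torsion X Y Y m = 0 := fun X Y => by
          have := l.torsion_swap_right X Y Y m; linarith
        have h3 : ∀ X Y, l.torsion X Y X m = 0 := fun X Y => by
          rw [torsion_swap_left, h2, neg_zero]
        obtain rfl | rfl | rfl : i = 0 ∨ i = 1 ∨ i = 2 := hcases i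
        all_goals
          obtain rfl | rfl | rfl : j = 0 ∨ j = 1 ∨ j = 2 := hcases j
        all_goals first
          | exact absurd rfl hne
          | simp only [hij, h1, h2, h3] }
  have hτ : ∀ (X Y Z : Cₛ^∞⟮𝓘(ℝ, EM); EM, fun m : M => TangentSpace 𝓘(ℝ, EM) m⟯) m,
      τ m ![X m, Y m, Z m] = l.torsion X Y Z m := fun X Y Z m =>
    l.torsion_congr (hS m _) (hS m _) (hS m _)
  refine ⟨⟨τ, fun X hX => ?_⟩, hτ⟩
  have h : (fun m => τ m (fun i => X i m)) = l.torsion ⟨X 0, hX 0⟩ ⟨X 1, hX 1⟩ ⟨X 2, hX 2⟩ := by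
    funext m
    rw [← hτ]
    congr 1
    funext i
    fin_cases i <;> rfl
  rw [h]
  exact contMDiff_const.mul (L.contMDiff_redPairing _ _)

variable {l}

/-- The product in the splitting, for an element of `Ker π`. -/
lemma Induces.redPairing_eq_of_redAnchor_eq_zero (hc : L.IsQuadraticForm c) {A : Connection B}
    (hA : l.Induces A) {m : M} (p : B.Fibre m) {s : L.RedFibre m} (hs : L.redAnchor m s = 0)
    (e : L.RedFibre m) :
    L.redPairing m s e = L.redPairing m s (l.toFun m (L.redAnchor m e)) +
      c (A.toFun p.1 (C.anchor p.1 (s.1 p))) (A.toFun p.1 (C.anchor p.1 (e.1 p))) := by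
  rw [L.redAnchor_eq p] at hs
  obtain ⟨z, hz⟩ := B.exists_fund_of_dproj_eq_zero p _ hs
  rw [hz, A.apply_fund]
  -- Over `p`, the element `s` is `ρ(z)` plus a covector `½π*α` on `P`, as both have anchor `Y_z`.
  -- Only the covector pairs with `K^⊥`.
  obtain ⟨α, hα⟩ := C.exists_cot (e := s.1 p - L.ρ z p.1)
    (by rw [map_sub, L.anchor_ρ, hz, sub_self])
  have hs' : s.1 p = L.ρ z p.1 + C.cot p.1 α := by rw [← hα]; abel
  have h1 : ∀ e : L.RedFibre m, L.redPairing m s e = (1 / 2 : ℝ) * α (C.anchor p.1 (e.1 p)) := by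
    intro e
    rw [L.redPairing_eq p, hs', map_add, LinearMap.add_apply, C.pairing_symm p.1 (L.ρ z p.1),
      e.2.1 p z, C.pairing_cot, zero_add]
  -- Since `⟨ρ(z), ρ(w)⟩ = -c(z, w)`, orthogonality of `s` to `K` fixes `α` on vertical vectors; the
  -- sign in the definition of `c` makes this product positive.
  have h2 : ∀ w, (1 / 2 : ℝ) * α (B.fund w p.1) = c z w := by
    intro w
    have h3 := s.2.1 p w
    rw [hs', map_add, LinearMap.add_apply, L.pairing_ρ_ρ hc, C.pairing_cot, L.anchor_ρ] at h3
    linarith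
  have h4 : C.anchor p.1 (e.1 p) = C.anchor p.1 ((l.toFun m (L.redAnchor m e)).1 p) +
      B.fund (A.toFun p.1 (C.anchor p.1 (e.1 p))) p.1 := by
    refine A.tangent_ext p ?_ ?_
    · rw [map_add, hA, zero_add, A.apply_fund]
    · rw [map_add, B.dproj_fund, add_zero, ← L.redAnchor_eq p, ← L.redAnchor_eq p, l.anchor_toFun]
  rw [h1, h1, ← h2, ← mul_add, ← map_add, ← h4]

/-- The product of `E` in the splitting. -/
lemma Induces.redPairing_eq (hc : L.IsQuadraticForm c) {A : Connection B} (hA : l.Induces A)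
    {m : M} (p : B.Fibre m) (e e' : L.RedFibre m) :
    L.redPairing m e e' = (1 / 2 : ℝ) * (l.cotPart m e (L.redAnchor m e') +
      l.cotPart m e' (L.redAnchor m e)) +
      c (A.toFun p.1 (C.anchor p.1 (e.1 p))) (A.toFun p.1 (C.anchor p.1 (e'.1 p))) := by
  -- Subtracting `λ(πe)` from `e` reduces to an element of `Ker π` and leaves the value of `A`
  -- unchanged.
  have h := hA.redPairing_eq_of_redAnchor_eq_zero hc p
    (s := e - l.toFun m (L.redAnchor m e)) (by rw [map_sub, l.anchor_toFun, sub_self]) e'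
  have h1 : (e - l.toFun m (L.redAnchor m e)).1 p = e.1 p - (l.toFun m (L.redAnchor m e)).1 p := rfl
  rw [h1, map_sub (C.anchor p.1), map_sub (A.toFun p.1), hA, sub_zero, map_sub,
    LinearMap.sub_apply, LinearMap.sub_apply, l.isotropic,
    L.redPairing_symm m (l.toFun m (L.redAnchor m e)) e'] at h
  simp only [cotPart, LinearMap.smul_apply, LinearMap.comp_apply, smul_eq_mul]
  linarith

end IsotropicSplitting

end Bracket

end LiftedAction

/-! ## The bracket of `E` in a splitting -/

namespace LiftedAction.IsotropicSplitting

section BracketFormula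

variable {EG : Type*} [NormedAddCommGroup EG] [NormedSpace ℝ EG] [FiniteDimensional ℝ EG]
  {G : Type*} [TopologicalSpace G] [ChartedSpace EG G] [Group G] [LieGroup 𝓘(ℝ, EG) ∞ G]
  {EM : Type*} [NormedAddCommGroup EM] [NormedSpace ℝ EM] [FiniteDimensional ℝ EM]
  {M : Type*} [TopologicalSpace M] [T2Space M] [ChartedSpace EM M] [IsManifold 𝓘(ℝ, EM) ∞ M]
  {EP : Type*} [NormedAddCommGroup EP] [NormedSpace ℝ EP] [FiniteDimensional ℝ EP]
  {P : Type*} [TopologicalSpace P] [T2Space P] [ChartedSpace EP P] [IsManifold 𝓘(ℝ, EP) ∞ P]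
  {F : Type*} [NormedAddCommGroup F] [NormedSpace ℝ F] [FiniteDimensional ℝ F]
  {Eh : P → Type*} [TopologicalSpace (TotalSpace F Eh)]
  [∀ p, AddCommGroup (Eh p)] [∀ p, Module ℝ (Eh p)] [∀ p, TopologicalSpace (Eh p)]
  [FiberBundle F Eh] [VectorBundle ℝ F Eh] [ContMDiffVectorBundle ∞ F Eh 𝓘(ℝ, EP)]
variable {B : PrincipalBundle EG G EM M EP P} {C : ExactCourantAlgebroid EP P F Eh}
  {L : LiftedAction B C} {c : LinearMap.BilinForm ℝ (LieAlg EG G)} {l : L.IsotropicSplitting}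

/-- The components of a section of `E` in a splitting are smooth. -/
lemma exists_decomposition (l : L.IsotropicSplitting) (e : L.RedSection) :
    ∃ (X : Cₛ^∞⟮𝓘(ℝ, EM); EM, fun m : M => TangentSpace 𝓘(ℝ, EM) m⟯) (s x : L.RedSection),
      e = l.liftSec X + s + x ∧ (fun m => X m) = L.secAnchor e ∧
      (∀ m, RedSection.eval s m ∈ l.adPart m) ∧
      ∀ m, RedSection.eval x m = L.redCot m (l.cotPart m (RedSection.eval e m)) := by
  let X : Cₛ^∞⟮𝓘(ℝ, EM); EM, fun m : M => TangentSpace 𝓘(ℝ, EM) m⟯ :=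
    ⟨L.secAnchor e, L.contMDiff_redAnchor e⟩
  obtain ⟨x, hx⟩ := L.exists_redSection_redCot (ξ := fun m => l.cotPart m (RedSection.eval e m))
    (fun Z hZ => by
      have h : (fun m => l.cotPart m (RedSection.eval e m) (Z m)) =
          fun m => 2 * L.secPairing e (l.liftSec ⟨Z, hZ⟩) m :=
        funext fun m => l.cotPart_eval e ⟨Z, hZ⟩ m
      rw [h]
      exact contMDiff_const.mul (L.contMDiff_redPairing _ _))
  refine ⟨X, e - l.liftSec X - x, x, by abel, rfl, fun m => ?_, hx⟩
  rw [RedSection.eval_sub, RedSection.eval_sub, eval_liftSec, hx]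
  refine ⟨?_, fun Y => ?_⟩
  · rw [map_sub, map_sub, l.anchor_toFun, L.redAnchor_redCot, sub_zero]
    exact sub_self _
  · rw [map_sub, map_sub, LinearMap.sub_apply, LinearMap.sub_apply, l.isotropic,
      L.redPairing_redCot, l.anchor_toFun]
    simp only [cotPart, LinearMap.smul_apply, LinearMap.comp_apply, smul_eq_mul]
    ring

lemma dirDeriv_zero_field (f : M → ℝ) (m : M) :
    dirDeriv (fun _ => 0 : RoughField EM M) f m = 0 :=
  map_zero (mfderiv 𝓘(ℝ, EM) 𝓘(ℝ, ℝ) f m)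

lemma lieBr_zero_left {E : Type*} [NormedAddCommGroup E] [NormedSpace ℝ E] {N : Type*}
    [TopologicalSpace N] [ChartedSpace E N] (Z : RoughField E N) (m : N) :
    lieBr (fun _ => 0 : RoughField E N) Z m = 0 :=
  congrFun mlieBracket_zero_left m

lemma secAnchor_of_mem_adPart {s : L.RedSection} (hs : ∀ m, RedSection.eval s m ∈ l.adPart m) :
    L.secAnchor s = fun _ => 0 :=
  funext fun m => (hs m).1

lemma secPairing_of_mem_adPart {s : L.RedSection} (hs : ∀ m, RedSection.eval s m ∈ l.adPart m)
    (Z : Cₛ^∞⟮𝓘(ℝ, EM); EM, fun m : M => TangentSpace 𝓘(ℝ, EM) m⟯) :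
    L.secPairing s (l.liftSec Z) = fun _ => 0 :=
  funext fun m => by rw [secPairing, eval_liftSec]; exact (hs m).2 _

lemma secAnchor_of_eq_redCot {x : L.RedSection}
    {ξ : (m : M) → Module.Dual ℝ (TangentSpace 𝓘(ℝ, EM) m)}
    (hx : ∀ m, RedSection.eval x m = L.redCot m (ξ m)) : L.secAnchor x = fun _ => 0 :=
  funext fun m => by rw [secAnchor, hx, L.redAnchor_redCot]

lemma anchor_of_eq_redCot {x : L.RedSection}
    {ξ : (m : M) → Module.Dual ℝ (TangentSpace 𝓘(ℝ, EM) m)}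
    (hx : ∀ m, RedSection.eval x m = L.redCot m (ξ m)) (q : P) : C.anchor q (x.1 q) = 0 := by
  have h : x.1 q = (L.redCot (B.proj q) (ξ (B.proj q))).1 ⟨q, rfl⟩ :=
    congrFun (congrArg Subtype.val (hx (B.proj q))) ⟨q, rfl⟩
  rw [h]
  exact L.anchor_redCot (B := B) _ ⟨q, rfl⟩

lemma secPairing_of_eq_redCot {x : L.RedSection}
    {ξ : (m : M) → Module.Dual ℝ (TangentSpace 𝓘(ℝ, EM) m)}
    (hx : ∀ m, RedSection.eval x m = L.redCot m (ξ m)) (b : L.RedSection) :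
    L.secPairing x b = fun m => (1 / 2 : ℝ) * ξ m (L.secAnchor b m) :=
  funext fun m => by rw [secPairing, hx, L.redPairing_redCot]; rfl

/-- The horizontal part of a lift depends only on the field below, and `λ` gives the horizontal lift
of that field. -/
lemma Induces.hor_eq {A : Connection B} (hA : l.Induces A)
    {X : Cₛ^∞⟮𝓘(ℝ, EM); EM, fun m : M => TangentSpace 𝓘(ℝ, EM) m⟯} {X' : RoughField EP P}
    (h : B.IsLift X' (fun m => X m)) :
    A.hor X' = fun q => C.anchor q ((l.liftSec X).1 q) := by
  funext q
  rw [A.hor_eq_horLift (B := B) ⟨q, rfl⟩ (h _ ⟨q, rfl⟩), ← hA.anchorLift_eq]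
  change C.anchor q ((l.toFun (B.proj q) (X (B.proj q))).1 ⟨q, rfl⟩) = _
  rw [← eval_liftSec]
  rfl

lemma Induces.apply_liftSec {A : Connection B} (hA : l.Induces A)
    (X : Cₛ^∞⟮𝓘(ℝ, EM); EM, fun m : M => TangentSpace 𝓘(ℝ, EM) m⟯) (q : P) :
    A.toFun q (C.anchor q ((l.liftSec X).1 q)) = 0 := by
  have h := hA (B.proj q) (X (B.proj q)) ⟨q, rfl⟩
  rw [← eval_liftSec] at h
  exact h

/-- The curvature is the `ad P`-component of the bracket of horizontal sections. -/
lemma Induces.curv_eq {A : Connection B} (hA : l.Induces A)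
    {X Y : Cₛ^∞⟮𝓘(ℝ, EM); EM, fun m : M => TangentSpace 𝓘(ℝ, EM) m⟯} {X' Y' : RoughField EP P}
    (hX : B.IsLift X' (fun m => X m)) (hY : B.IsLift Y' (fun m => Y m)) (q : P) :
    A.curv X' Y' q =
      -A.toFun q (C.anchor q ((L.redBracket (l.liftSec X) (l.liftSec Y)).1 q)) := by
  rw [Connection.curv, hA.hor_eq hX, hA.hor_eq hY]
  exact congrArg (fun v => -A.toFun q v) (C.anchor_bracket _ _ q).symm

variable {A : Connection B} (hA : l.Induces A) (hc : L.IsQuadraticForm c)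
include hA hc

lemma Induces.secPairing_ad_bracket {s : L.RedSection}
    (hs : ∀ m, RedSection.eval s m ∈ l.adPart m)
    (b : L.RedSection) {m : M} (p : B.Fibre m) :
    L.secPairing s b m =
      c (A.toFun p.1 (C.anchor p.1 (s.1 p.1))) (A.toFun p.1 (C.anchor p.1 (b.1 p.1))) := by
  have h := hA.redPairing_eq_of_redAnchor_eq_zero hc p (hs m).1 (RedSection.eval b m)
  rw [(hs m).2, zero_add] at h
  exact h

/-- The component in `T*` is read off as `2⟨[e₁, e₂], λZ⟩`. The bracket is expanded along the
splitting, and in each term metric compatibility moves `λZ` into the bracket; when the first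
argument is to act as the second one, the symmetric part of the bracket is used as well. -/
theorem Induces.bracketFormula {H : ThreeForm EM M}
    (hH : ∀ (X Y Z : Cₛ^∞⟮𝓘(ℝ, EM); EM, fun m : M => TangentSpace 𝓘(ℝ, EM) m⟯) m,
      H.toFun m ![X m, Y m, Z m] = l.torsion X Y Z m) : l.BracketFormula A c H := by
  intro e₁ e₂ X Y pX pY ξ η AX AY
  refine ⟨fun p => C.anchor_bracket _ _ p, fun Z Z' hZ hZ' hlZ m p => ?_⟩
  obtain ⟨X₁, s₁, x₁, he₁, hX₁, hs₁, hx₁⟩ := l.exists_decomposition e₁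
  obtain ⟨X₂, s₂, x₂, he₂, hX₂, hs₂, hx₂⟩ := l.exists_decomposition e₂
  let Zs : Cₛ^∞⟮𝓘(ℝ, EM); EM, fun m : M => TangentSpace 𝓘(ℝ, EM) m⟯ := ⟨Z, hZ⟩
  change ∀ m, RedSection.eval x₁ m = L.redCot m (ξ m) at hx₁
  change ∀ m, RedSection.eval x₂ m = L.redCot m (η m) at hx₂
  have hXl : B.IsLift X (fun m => X₁ m) := by rw [hX₁]; exact L.isLift_anchor e₁
  have hYl : B.IsLift Y (fun m => X₂ m) := by rw [hX₂]; exact L.isLift_anchor e₂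
  -- the `ad P`-components
  have hAs : ∀ (e : L.RedSection) (X : Cₛ^∞⟮𝓘(ℝ, EM); EM, fun m : M => TangentSpace 𝓘(ℝ, EM) m⟯)
      (s x : L.RedSection) (ζ : (m : M) → Module.Dual ℝ (TangentSpace 𝓘(ℝ, EM) m)),
      e = l.liftSec X + s + x → (∀ m, RedSection.eval x m = L.redCot m (ζ m)) →
      ∀ q, A.toFun q (C.anchor q (s.1 q)) = A.toFun q (C.anchor q (e.1 q)) := by
    rintro e X s x ζ rfl hx q
    have h0 : (l.liftSec X + s + x).1 q = (l.liftSec X).1 q + s.1 q + x.1 q := rfl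
    rw [h0, map_add, map_add, map_add, map_add, anchor_of_eq_redCot hx, map_zero, add_zero,
      hA.apply_liftSec, zero_add]
  have hA₁ : ∀ q, A.toFun q (C.anchor q (s₁.1 q)) = AX q := hAs _ _ _ _ _ he₁ hx₁
  have hA₂ : ∀ q, A.toFun q (C.anchor q (s₂.1 q)) = AY q := hAs _ _ _ _ _ he₂ hx₂
  -- The vertical field of `AX` is the anchor of `s₁` and the horizontal part of `Z'` is the anchor
  -- of `λZ`; the minus sign comes from exchanging them in the Lie bracket.
  have hcov : A.cov Z' AX p.1 =
      -A.toFun p.1 (C.anchor p.1 ((L.redBracket s₁ (l.liftSec Zs)).1 p.1)) := by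
    have h1 : B.vert AX = fun q => C.anchor q (s₁.1 q) := by
      funext q
      have h2 := (L.isLift_anchor s₁ _ ⟨q, rfl⟩).trans (congrFun (secAnchor_of_mem_adPart hs₁) _)
      obtain ⟨z, hz⟩ := B.exists_fund_of_dproj_eq_zero _ _ h2
      change B.fund (AX q) q = _
      rw [← hA₁]
      change C.anchor q (s₁.1 q) = B.fund z q at hz
      rw [hz, A.apply_fund]
    rw [Connection.cov, h1, hA.hor_eq (X := Zs) hlZ, ← map_neg]
    refine congrArg (A.toFun p.1) ?_
    refine (congrFun mlieBracket_swap p.1).trans (congrArg Neg.neg ?_)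
    exact (C.anchor_bracket _ _ _).symm
  -- the nine terms of the bracket
  have t₁₁ : 2 * L.secPairing (L.redBracket (l.liftSec X₁) (l.liftSec X₂)) (l.liftSec Zs) m =
      H.toFun m ![pX m, pY m, Z m] := by
    have h1 : pX m = X₁ m := (congrFun hX₁ m).symm
    have h2 : pY m = X₂ m := (congrFun hX₂ m).symm
    rw [h1, h2]
    exact (hH X₁ X₂ Zs m).symm
  -- As `⟨s₂, λZ⟩ = 0`, this is `-⟨s₂, [λX₁, λZ]⟩`, and the `ad P`-component of that bracket is
  -- `-F`.
  have t₁₂ : L.secPairing (L.redBracket (l.liftSec X₁) s₂) (l.liftSec Zs) m =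
      c (A.curv X Z' p.1) (AY p.1) := by
    have h := L.secPairing_compat (l.liftSec X₁) s₂ (l.liftSec Zs) m
    rw [secPairing_of_mem_adPart hs₂, dirDeriv_const, hA.secPairing_ad_bracket hc hs₂ _ p, hA₂,
      hc.1] at h
    rw [hA.curv_eq hXl (Y := Zs) hlZ, map_neg, LinearMap.neg_apply]
    linarith
  have t₂₁ : L.secPairing (L.redBracket s₁ (l.liftSec X₂)) (l.liftSec Zs) m =
      -c (A.curv Y Z' p.1) (AX p.1) := by
    have h := L.secPairing_compat (l.liftSec X₂) s₁ (l.liftSec Zs) m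
    have h' := L.secPairing_redBracket_symm s₁ (l.liftSec X₂) (l.liftSec Zs) m
    rw [secPairing_of_mem_adPart hs₁, dirDeriv_const] at h'
    rw [secPairing_of_mem_adPart hs₁, dirDeriv_const, hA.secPairing_ad_bracket hc hs₁ _ p, hA₁,
      hc.1] at h
    rw [hA.curv_eq hYl (Y := Zs) hlZ, map_neg, LinearMap.neg_apply]
    linarith
  have t₂₂ : L.secPairing (L.redBracket s₁ s₂) (l.liftSec Zs) m =
      c (A.cov Z' AX p.1) (AY p.1) := by
    have h := L.secPairing_compat s₁ s₂ (l.liftSec Zs) m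
    rw [secPairing_of_mem_adPart hs₂, dirDeriv_const, hA.secPairing_ad_bracket hc hs₂ _ p, hA₂,
      hc.1] at h
    rw [hcov, map_neg, LinearMap.neg_apply]
    linarith
  have hZm : L.secAnchor (l.liftSec Zs) = Z := l.secAnchor_liftSec Zs
  have ha₁ : L.secAnchor (l.liftSec X₁) = pX := (l.secAnchor_liftSec X₁).trans hX₁
  have ha₂ : L.secAnchor (l.liftSec X₂) = pY := (l.secAnchor_liftSec X₂).trans hX₂
  have hsmul : ∀ (W : RoughField EM M) {f : M → ℝ}, IsSmoothFun (EM := EM) (fun m => 1 / 2 * f m) →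
      dirDeriv W (fun m => (1 / 2 : ℝ) * f m) m = 1 / 2 * dirDeriv W f m := by
    intro W f hf
    have hf' : IsSmoothFun (EM := EM) f := by
      have h2 := contMDiff_const (c := (2 : ℝ)).mul hf
      have h3 : (fun m => 2 * (1 / 2 * f m)) = f := funext fun m => by ring
      exact h3 ▸ h2
    exact dirDeriv_const_mul W hf' _ m
  have hsm : ∀ (x : L.RedSection) (ζ : (m : M) → Module.Dual ℝ (TangentSpace 𝓘(ℝ, EM) m)),
      (∀ m, RedSection.eval x m = L.redCot m (ζ m)) → ∀ b : L.RedSection,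
      IsSmoothFun (EM := EM) (fun m => 1 / 2 * ζ m (L.secAnchor b m)) := by
    intro x ζ hx b
    rw [← secPairing_of_eq_redCot hx]
    exact L.contMDiff_redPairing x b
  have t₁₃ : 2 * L.secPairing (L.redBracket (l.liftSec X₁) x₂) (l.liftSec Zs) m =
      lieDerivOneForm pX η Z m := by
    have h := L.secPairing_compat (l.liftSec X₁) x₂ (l.liftSec Zs) m
    rw [secPairing_of_eq_redCot hx₂, hsmul _ (hsm _ _ hx₂ _), secPairing_of_eq_redCot hx₂,
      L.secAnchor_redBracket, ha₁, hZm] at h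
    rw [lieDerivOneForm]
    linarith
  -- Exchanging the arguments costs the differential of `⟨x₁, λX₂⟩ = ½ξ(pY)`, which supplies the
  -- term `Z(ξ(pY))` of `dξ`.
  have t₃₁ : 2 * L.secPairing (L.redBracket x₁ (l.liftSec X₂)) (l.liftSec Zs) m =
      -extDerivOneForm ξ pY Z m := by
    have h := L.secPairing_compat (l.liftSec X₂) x₁ (l.liftSec Zs) m
    have h' := L.secPairing_redBracket_symm x₁ (l.liftSec X₂) (l.liftSec Zs) m
    rw [secPairing_of_eq_redCot hx₁, hsmul _ (hsm _ _ hx₁ _), ha₂, hZm] at h'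
    rw [secPairing_of_eq_redCot hx₁, hsmul _ (hsm _ _ hx₁ _), secPairing_of_eq_redCot hx₁,
      L.secAnchor_redBracket, ha₂, hZm] at h
    rw [extDerivOneForm]
    linarith
  have t₂₃ : L.secPairing (L.redBracket s₁ x₂) (l.liftSec Zs) m = 0 := by
    have h := L.secPairing_compat s₁ x₂ (l.liftSec Zs) m
    rw [secAnchor_of_mem_adPart hs₁, dirDeriv_zero_field, secPairing_of_eq_redCot hx₂,
      L.secAnchor_redBracket, secAnchor_of_mem_adPart hs₁] at h
    simp only [lieBr_zero_left, map_zero] at h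
    linarith
  have t₃₃ : L.secPairing (L.redBracket x₁ x₂) (l.liftSec Zs) m = 0 := by
    have h := L.secPairing_compat x₁ x₂ (l.liftSec Zs) m
    rw [secAnchor_of_eq_redCot hx₁, dirDeriv_zero_field, secPairing_of_eq_redCot hx₂,
      L.secAnchor_redBracket, secAnchor_of_eq_redCot hx₁] at h
    simp only [lieBr_zero_left, map_zero] at h
    linarith
  -- The anchor of `x₁` in `TP`, not only in `T`, is zero, so `[x₁, λZ]` has no `ad P`-component to
  -- pair with `s₂`.
  have t₃₂ : L.secPairing (L.redBracket x₁ s₂) (l.liftSec Zs) m = 0 := by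
    have h := L.secPairing_compat x₁ s₂ (l.liftSec Zs) m
    have h1 : C.anchor p.1 ((L.redBracket x₁ (l.liftSec Zs)).1 p.1) = 0 := by
      have h2 : (fun q => C.anchor q (x₁.1 q)) = fun _ => 0 :=
        funext fun q => anchor_of_eq_redCot hx₁ q
      refine (C.anchor_bracket _ _ _).trans ?_
      rw [h2]
      exact lieBr_zero_left _ _
    rw [secAnchor_of_eq_redCot hx₁, dirDeriv_zero_field, hA.secPairing_ad_bracket hc hs₂ _ p, h1,
      map_zero, map_zero] at h
    linarith
  rw [show Z m = Zs m from rfl, l.cotPart_eval, he₁, he₂]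
  simp only [L.redBracket_add_left, L.redBracket_add_right, L.secPairing_add_left]
  rw [show Zs m = Z m from rfl]
  linarith

end BracketFormula

end LiftedAction.IsotropicSplitting

/-! ### Uniqueness of the 3-form and its exterior derivative -/

namespace LiftedAction.IsotropicSplitting

section StructureEquation

variable {EG : Type*} [NormedAddCommGroup EG] [NormedSpace ℝ EG] [FiniteDimensional ℝ EG]
  {G : Type*} [TopologicalSpace G] [ChartedSpace EG G] [Group G] [LieGroup 𝓘(ℝ, EG) ∞ G]
  {EM : Type*} [NormedAddCommGroup EM] [NormedSpace ℝ EM] [FiniteDimensional ℝ EM]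
  {M : Type*} [TopologicalSpace M] [T2Space M] [ChartedSpace EM M] [IsManifold 𝓘(ℝ, EM) ∞ M]
  {EP : Type*} [NormedAddCommGroup EP] [NormedSpace ℝ EP] [FiniteDimensional ℝ EP]
  {P : Type*} [TopologicalSpace P] [T2Space P] [ChartedSpace EP P] [IsManifold 𝓘(ℝ, EP) ∞ P]
  {F : Type*} [NormedAddCommGroup F] [NormedSpace ℝ F] [FiniteDimensional ℝ F]
  {Eh : P → Type*} [TopologicalSpace (TotalSpace F Eh)]
  [∀ p, AddCommGroup (Eh p)] [∀ p, Module ℝ (Eh p)] [∀ p, TopologicalSpace (Eh p)]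
  [FiberBundle F Eh] [VectorBundle ℝ F Eh] [ContMDiffVectorBundle ∞ F Eh 𝓘(ℝ, EP)]
variable {B : PrincipalBundle EG G EM M EP P} {C : ExactCourantAlgebroid EP P F Eh}
  {L : LiftedAction B C} {c : LinearMap.BilinForm ℝ (LieAlg EG G)} {l : L.IsotropicSplitting}

/-- Compare the two formulas on sections `λX`, `λY` and a field `Z` through three given tangent
vectors; every term other than that of the 3-form is common to both. -/
lemma BracketFormula.unique {A : Connection B} {H H' : ThreeForm EM M}
    (h : l.BracketFormula A c H) (h' : l.BracketFormula A c H') : H = H' := by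
  refine ThreeForm.ext (funext fun m => AlternatingMap.ext fun v => ?_)
  obtain ⟨X, hX⟩ := exists_section_eq (E := EM) (F := EM)
    (V := fun m : M => TangentSpace 𝓘(ℝ, EM) m) m (v 0)
  obtain ⟨Y, hY⟩ := exists_section_eq (E := EM) (F := EM)
    (V := fun m : M => TangentSpace 𝓘(ℝ, EM) m) m (v 1)
  obtain ⟨Z, hZ⟩ := exists_section_eq (E := EM) (F := EM)
    (V := fun m : M => TangentSpace 𝓘(ℝ, EM) m) m (v 2)
  have hZl : B.IsLift (fun q => C.anchor q ((l.liftSec Z).1 q)) (fun m => Z m) := by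
    rw [← l.secAnchor_liftSec]; exact L.isLift_anchor _
  have h1 := (h (l.liftSec X) (l.liftSec Y)).2 (fun m => Z m) _ Z.contMDiff
    (C.anchor_smooth (l.liftSec Z).1) hZl m (B.pt m)
  have h2 := (h' (l.liftSec X) (l.liftSec Y)).2 (fun m => Z m) _ Z.contMDiff
    (C.anchor_smooth (l.liftSec Z).1) hZl m (B.pt m)
  have hv : v = ![L.redAnchor m (RedSection.eval (l.liftSec X) m),
      L.redAnchor m (RedSection.eval (l.liftSec Y) m), Z m] := by
    rw [eval_liftSec, eval_liftSec, l.anchor_toFun, l.anchor_toFun, hX, hY, hZ]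
    funext i
    fin_cases i <;> rfl
  rw [hv]
  linarith

variable {A : Connection B}

/-- The three-form of a splitting and its curvature satisfy `dH = c(F ∧ F)`. -/
theorem Induces.structureEq (hA : l.Induces A) (hc : L.IsQuadraticForm c) {H : ThreeForm EM M}
    (hH : ∀ (X Y Z : Cₛ^∞⟮𝓘(ℝ, EM); EM, fun m : M => TangentSpace 𝓘(ℝ, EM) m⟯) m,
      H.toFun m ![X m, Y m, Z m] = l.torsion X Y Z m) : StructureEq B A c H := by
  intro X X' hX hX' hl q
  let Xs : Fin 4 → Cₛ^∞⟮𝓘(ℝ, EM); EM, fun m : M => TangentSpace 𝓘(ℝ, EM) m⟯ :=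
    fun i => ⟨X i, hX i⟩
  let u : Fin 4 → L.RedSection := fun i => l.liftSec (Xs i)
  let K : Fin 4 → Fin 4 → L.RedSection := fun i j => L.redBracket (u i) (u j)
  let m := B.proj q
  have hu : ∀ i, L.secAnchor (u i) = X i := fun i => l.secAnchor_liftSec (Xs i)
  have hHK : ∀ i j k, L.secPairing (K i j) (u k) =
      fun m => 1 / 2 * H.toFun m ![X i m, X j m, X k m] := by
    intro i j k
    funext m
    have h := hH (Xs i) (Xs j) (Xs k) m
    rw [torsion] at h
    change _ = 1 / 2 * H.toFun m ![Xs i m, Xs j m, Xs k m]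
    rw [h]
    ring
  have hsm : ∀ i j k, IsSmoothFun (EM := EM) (fun m => H.toFun m ![X i m, X j m, X k m]) := by
    intro i j k
    have h : (fun m => H.toFun m ![X i m, X j m, X k m]) =
        fun m => 2 * L.secPairing (K i j) (u k) m := by
      funext m; rw [hHK]; ring
    rw [h]
    exact contMDiff_const.mul (L.contMDiff_redPairing _ _)
  have hd : ∀ n i j k, dirDeriv (L.secAnchor (u n)) (L.secPairing (K i j) (u k)) m =
      1 / 2 * dirDeriv (X n) (fun m => H.toFun m ![X i m, X j m, X k m]) m := by
    intro n i j k
    rw [hHK, hu, dirDeriv_const_mul _ (hsm i j k)]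
  -- The `T*`-component of `[λXᵢ, λXⱼ]` is `H(Xᵢ, Xⱼ, ·)`; the last argument is cycled to the front
  -- to match the convention for `dH`.
  have hcot : ∀ i j k n, l.cotPart m (RedSection.eval (K i j) m)
      (L.redAnchor m (RedSection.eval (K k n) m)) =
      H.toFun m ![lieBr (X k) (X n) m, X i m, X j m] := by
    intro i j k n
    have h1 : L.redAnchor m (RedSection.eval (K k n) m) = lieBr (X k) (X n) m := by
      have h2 := congrFun (L.secAnchor_redBracket (u k) (u n)) m
      rw [hu, hu] at h2
      exact h2
    obtain ⟨W, hW⟩ := exists_section_eq (E := EM) (F := EM)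
      (V := fun m : M => TangentSpace 𝓘(ℝ, EM) m) m (lieBr (X k) (X n) m)
    rw [h1, ← hW, l.cotPart_eval]
    have h3 := hH W (Xs i) (Xs j) m
    rw [torsion_swap_left, torsion_swap_right, neg_neg] at h3
    exact h3.symm
  -- The metric in the splitting, for two brackets of horizontal sections: their `ad P`-components
  -- are `-F` each, so the signs cancel in `c`.
  have hpair : ∀ i j k n, L.secPairing (K i j) (K k n) m =
      1 / 2 * (H.toFun m ![lieBr (X k) (X n) m, X i m, X j m] +
        H.toFun m ![lieBr (X i) (X j) m, X k m, X n m]) +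
      c (A.curv (X' i) (X' j) q) (A.curv (X' k) (X' n) q) := by
    intro i j k n
    have h := hA.redPairing_eq hc (m := m) ⟨q, rfl⟩ (RedSection.eval (K i j) m)
      (RedSection.eval (K k n) m)
    rw [hcot, hcot] at h
    rw [hA.curv_eq (X := Xs i) (hl i) (Y := Xs j) (hl j),
      hA.curv_eq (X := Xs k) (hl k) (Y := Xs n) (hl n), map_neg, map_neg, LinearMap.neg_apply,
      neg_neg]
    exact h
  have hJ := congrArg (fun e => L.secPairing e (u 3) m) (L.redBracket_jacobi (u 0) (u 1) (u 2))
  simp only [L.secPairing_add_left] at hJ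
  -- Each double bracket in the Jacobi identity becomes a derivative of `H` minus a product of
  -- brackets. For `[[u₀, u₁], u₂]` the arguments are first exchanged by `e₃`, which produces the
  -- derivative along `X₃`.
  have e₀ := L.secPairing_compat (u 0) (K 1 2) (u 3) m
  have e₁ := L.secPairing_compat (u 1) (K 0 2) (u 3) m
  have e₂ := L.secPairing_compat (u 2) (K 0 1) (u 3) m
  have e₃ := L.secPairing_redBracket_symm (K 0 1) (u 2) (u 3) m
  rw [hd] at e₀ e₁ e₂ e₃
  have p₀ := hpair 1 2 0 3
  have p₁ := hpair 0 2 1 3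
  have p₂ := hpair 0 1 2 3
  have hcs := hc.1 (A.curv (X' 1) (X' 2) q) (A.curv (X' 0) (X' 3) q)
  -- The general alternating sums, written out: four derivative terms and six bracket terms.
  have hlhs : H.extDeriv X m =
      dirDeriv (X 0) (fun m => H.toFun m ![X 1 m, X 2 m, X 3 m]) m
      - dirDeriv (X 1) (fun m => H.toFun m ![X 0 m, X 2 m, X 3 m]) m
      + dirDeriv (X 2) (fun m => H.toFun m ![X 0 m, X 1 m, X 3 m]) m
      - dirDeriv (X 3) (fun m => H.toFun m ![X 0 m, X 1 m, X 2 m]) m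
      - (H.toFun m ![lieBr (X 0) (X 1) m, X 2 m, X 3 m]
        - H.toFun m ![lieBr (X 0) (X 2) m, X 1 m, X 3 m]
        + H.toFun m ![lieBr (X 0) (X 3) m, X 1 m, X 2 m]
        + H.toFun m ![lieBr (X 1) (X 2) m, X 0 m, X 3 m]
        - H.toFun m ![lieBr (X 1) (X 3) m, X 0 m, X 2 m]
        + H.toFun m ![lieBr (X 2) (X 3) m, X 0 m, X 1 m]) := by
    have I₀ : Finset.Ici (0 : Fin 3) = {0, 1, 2} := by decide
    have I₁ : Finset.Ici (1 : Fin 3) = {1, 2} := by decide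
    have I₂ : Finset.Ici (2 : Fin 3) = {2} := by decide
    have r₀ : ∀ m, (0 : Fin 4).removeNth (fun k => X k m) = ![X 1 m, X 2 m, X 3 m] :=
      fun m => by funext i; fin_cases i <;> rfl
    have r₁ : ∀ m, (1 : Fin 4).removeNth (fun k => X k m) = ![X 0 m, X 2 m, X 3 m] :=
      fun m => by funext i; fin_cases i <;> rfl
    have r₂ : ∀ m, (2 : Fin 4).removeNth (fun k => X k m) = ![X 0 m, X 1 m, X 3 m] :=
      fun m => by funext i; fin_cases i <;> rfl
    have r₃ : ∀ m, (3 : Fin 4).removeNth (fun k => X k m) = ![X 0 m, X 1 m, X 2 m] :=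
      fun m => by funext i; fin_cases i <;> rfl
    have q₀ : ∀ a b d : TangentSpace 𝓘(ℝ, EM) m, (0 : Fin 3).removeNth ![a, b, d] = ![b, d] :=
      fun a b d => by funext i; fin_cases i <;> rfl
    have q₁ : ∀ a b d : TangentSpace 𝓘(ℝ, EM) m, (1 : Fin 3).removeNth ![a, b, d] = ![a, d] :=
      fun a b d => by funext i; fin_cases i <;> rfl
    have q₂ : ∀ a b d : TangentSpace 𝓘(ℝ, EM) m, (2 : Fin 3).removeNth ![a, b, d] = ![a, b] :=
      fun a b d => by funext i; fin_cases i <;> rfl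
    have k₀ : (0 : Fin 3).castSucc = (0 : Fin 4) := rfl
    have k₁ : (1 : Fin 3).castSucc = (1 : Fin 4) := rfl
    have k₂ : (2 : Fin 3).castSucc = (2 : Fin 4) := rfl
    have c₀ : (0 : Fin 3).succ = (1 : Fin 4) := rfl
    have c₁ : (1 : Fin 3).succ = (2 : Fin 4) := rfl
    have c₂ : (2 : Fin 3).succ = (3 : Fin 4) := rfl
    rw [ThreeForm.extDeriv, Fin.sum_univ_four, Fin.sum_univ_three, I₀, I₁, I₂,
      Finset.sum_insert (by decide), Finset.sum_insert (by decide), Finset.sum_singleton,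
      Finset.sum_insert (by decide), Finset.sum_singleton, Finset.sum_singleton]
    simp only [k₀, k₁, k₂, c₀, c₁, c₂, r₀, r₁, r₂, r₃]
    rw [q₀, q₁, q₂, q₁, q₂, q₂]
    norm_num
    ring
  change H.extDeriv X m = _
  rw [hlhs, Connection.curvSq]
  simp only [K] at *
  linarith

end StructureEquation

end LiftedAction.IsotropicSplitting

/-! ## Splittings with a given connection -/

namespace LiftedAction

section Splittings

variable {EG : Type*} [NormedAddCommGroup EG] [NormedSpace ℝ EG] [FiniteDimensional ℝ EG]
  {G : Type*} [TopologicalSpace G] [ChartedSpace EG G] [Group G] [LieGroup 𝓘(ℝ, EG) ∞ G]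
  {EM : Type*} [NormedAddCommGroup EM] [NormedSpace ℝ EM] [FiniteDimensional ℝ EM]
  {M : Type*} [TopologicalSpace M] [T2Space M] [ChartedSpace EM M] [IsManifold 𝓘(ℝ, EM) ∞ M]
  {EP : Type*} [NormedAddCommGroup EP] [NormedSpace ℝ EP] [FiniteDimensional ℝ EP]
  {P : Type*} [TopologicalSpace P] [T2Space P] [ChartedSpace EP P] [IsManifold 𝓘(ℝ, EP) ∞ P]
  {F : Type*} [NormedAddCommGroup F] [NormedSpace ℝ F] [FiniteDimensional ℝ F]
  {Eh : P → Type*} [TopologicalSpace (TotalSpace F Eh)]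
  [∀ p, AddCommGroup (Eh p)] [∀ p, Module ℝ (Eh p)] [∀ p, TopologicalSpace (Eh p)]
  [FiberBundle F Eh] [VectorBundle ℝ F Eh] [ContMDiffVectorBundle ∞ F Eh 𝓘(ℝ, EP)]
variable {B : PrincipalBundle EG G EM M EP P} {C : ExactCourantAlgebroid EP P F Eh}
  (L : LiftedAction B C) {c : LinearMap.BilinForm ℝ (LieAlg EG G)} (A : Connection B)

lemma exists_section_ρ {r : P → LieAlg EG G} (hr : IsSmoothFun (EM := EP) (W := EG) r) :
    ∃ a : Cₛ^∞⟮𝓘(ℝ, EP); F, Eh⟯, ∀ p, a p = L.ρ (r p) p := by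
  refine ⟨⟨fun p => L.ρ (r p) p, C.contMDiff_of_pairing fun b => ?_⟩, fun _ => rfl⟩
  let β := Module.finBasis ℝ (LieAlg EG G)
  have h : (fun p => C.pairing p (L.ρ (r p) p) (b p)) =
      fun p => ∑ i, β.repr (r p) i * C.pairing p (L.ρ (β i) p) (b p) := by
    funext p
    let φ : LieAlg EG G →ₗ[ℝ] ℝ := ((C.pairing p).flip (b p)).comp ((evalSection p).comp L.ρ)
    have h1 := congrArg φ (β.sum_repr (r p))
    rw [map_sum] at h1
    simp only [map_smul, smul_eq_mul] at h1
    exact h1.symm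
  rw [h]
  refine fun p => contMDiffAt_finsetSum fun i _ => ?_
  have h2 : IsSmoothFun (EM := EP) (fun p => β.repr (r p) i) := by
    let φ : EG →L[ℝ] ℝ := LinearMap.toContinuousLinearMap (β.coord i : EG →ₗ[ℝ] ℝ)
    exact φ.contMDiff.comp hr
  exact (h2 p).mul (C.pairing_smooth _ _ p)

/-- The map `e ↦ e - π*⟨e, ρ(A)⟩` to `K^⊥`, compatible with the anchor. -/
def correction (p : P) : Eh p →ₗ[ℝ] Eh p :=
  LinearMap.id + (C.cot p).comp
    ({ toFun := fun e =>
          -- The `2` compensates the `½` of `cot`.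
          (-2 : ℝ) • ((C.pairing p e).comp ((evalSection p).comp L.ρ)).comp (A.toFun p)
       map_add' := fun e e' => by
         refine LinearMap.ext fun v => ?_
         simp only [LinearMap.smul_apply, LinearMap.comp_apply, map_add, LinearMap.add_apply,
           smul_add]
       map_smul' := fun r e => by
         refine LinearMap.ext fun v => ?_
         simp only [LinearMap.smul_apply, LinearMap.comp_apply, map_smul, RingHom.id_apply,
           smul_eq_mul]
         ring } : Eh p →ₗ[ℝ] Module.Dual ℝ (TangentSpace 𝓘(ℝ, EP) p))

lemma pairing_correction (p : P) (e b : Eh p) :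
    C.pairing p (L.correction A p e) b =
      C.pairing p e b - C.pairing p e (L.ρ (A.toFun p (C.anchor p b)) p) := by
  have h : C.pairing p (L.correction A p e) b = C.pairing p e b +
      (1 / 2 : ℝ) * (-2 * C.pairing p e (L.ρ (A.toFun p (C.anchor p b)) p)) := by
    rw [correction, LinearMap.add_apply, map_add, LinearMap.add_apply, LinearMap.comp_apply,
      C.pairing_cot]
    rfl
  rw [h]
  ring

lemma anchor_correction (p : P) (e : Eh p) :
    C.anchor p (L.correction A p e) = C.anchor p e := by
  rw [correction, LinearMap.add_apply, map_add, LinearMap.comp_apply, C.anchor_cot, add_zero]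
  rfl

/-- Since `A(Y_z) = z`, the correction subtracts exactly `⟨e, ρ(z)⟩`. -/
lemma pairing_correction_ρ (p : P) (e : Eh p) (z : LieAlg EG G) :
    C.pairing p (L.correction A p e) (L.ρ z p) = 0 := by
  rw [pairing_correction, L.anchor_ρ, A.apply_fund, sub_self]

lemma R_correction (g : G) (p : P) (e : Eh p) :
    L.R g p (L.correction A p e) = L.correction A (B.act p g) (L.R g p e) := by
  refine C.ext_pairing fun b => ?_
  obtain ⟨b, rfl⟩ := (L.R g p).surjective b
  rw [L.R_pairing, pairing_correction, pairing_correction, L.R_pairing, L.R_anchor, A.equivariant,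
    L.ρ_act, adjoint_adjoint_inv, L.R_pairing]

lemma contMDiff_correction (a : Cₛ^∞⟮𝓘(ℝ, EP); F, Eh⟯) :
    ContMDiff 𝓘(ℝ, EP) (𝓘(ℝ, EP).prod 𝓘(ℝ, F)) ∞
      (fun p => (⟨p, L.correction A p (a p)⟩ : TotalSpace F Eh)) := by
  refine C.contMDiff_of_pairing fun b => ?_
  obtain ⟨d, hd⟩ := L.exists_section_ρ (A.smooth _ (C.anchor_smooth b))
  have h : (fun p => C.pairing p (L.correction A p (a p)) (b p)) =
      fun p => C.pairing p (a p) (b p) - C.pairing p (a p) (d p) :=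
    funext fun p => by rw [pairing_correction, hd]
  rw [h]
  exact (C.pairing_smooth a b).sub (C.pairing_smooth a d)

/-- Every connection is induced by an isotropic splitting. -/
theorem exists_induces (hL : L.HasEquivariantSplitting) :
    ∃ l : L.IsotropicSplitting, l.Induces A := by
  obtain ⟨l₀, h1, h2, h3, h4⟩ := hL
  -- Equivariance of the horizontal lift, of `l₀` and of the correction makes this an element of
  -- `K^⊥/G`.
  let v : (m : M) → TangentSpace 𝓘(ℝ, EM) m → (p : B.Fibre m) → Eh p.1 := fun m X p =>
    L.correction A p.1 (l₀ p.1 (A.horLift p X))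
  have hv : ∀ m X, v m X ∈ L.RedFibre m := by
    intro m X
    refine ⟨fun p z => L.pairing_correction_ρ A _ _ _, fun p g => ?_⟩
    change L.correction A (B.act p.1 g) (l₀ (B.act p.1 g) (A.horLift (B.actFibre p g) X)) = _
    rw [← A.dact_horLift, h3, ← L.R_correction]
  have hanchor : ∀ m X (p : B.Fibre m), C.anchor p.1 (v m X p) = A.horLift p X :=
    fun m X p => (L.anchor_correction A _ _).trans (h1 _ _)
  refine ⟨⟨fun m =>
    { toFun := fun X => ⟨v m X, hv m X⟩
      map_add' := fun X Y => Subtype.ext (funext fun p => ?_)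
      map_smul' := fun r X => Subtype.ext (funext fun p => ?_) }, fun m X => ?_, fun m X Y => ?_,
      fun X hX => ?_⟩, fun m X p => ?_⟩
  · change v m (X + Y) p = v m X p + v m Y p
    simp only [v, map_add]
  · change v m (r • X) p = r • v m X p
    simp only [v, map_smul]
  · rw [L.redAnchor_eq (B.pt m)]
    exact (congrArg _ (hanchor _ _ _)).trans (A.dproj_horLift _ _)
  · rw [L.redPairing_eq (B.pt m)]
    change C.pairing _ (v m X (B.pt m)) (v m Y (B.pt m)) = 0
    -- On horizontal vectors `A` vanishes, so the correction terms drop out of the product and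
    -- isotropy is that of `l₀`.
    have h5 : ∀ X, A.toFun _ (C.anchor _ (v m X (B.pt m))) = 0 := fun X => by
      rw [hanchor, A.apply_horLift]
    have h6 : ∀ e, C.pairing (B.pt m).1 e (L.ρ 0 (B.pt m).1) = 0 := fun e => by
      rw [map_zero]; exact map_zero _
    rw [L.pairing_correction, h5, h6, sub_zero, C.pairing_symm, L.pairing_correction, h1,
      A.apply_horLift, h6, sub_zero, h2]
  · obtain ⟨a, ha⟩ := h4 _ (A.contMDiff_horLift hX)
    refine L.exists_redSection (fun m => (⟨v m (X m), hv m (X m)⟩ : L.RedFibre m)) ?_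
    have h5 := L.contMDiff_correction A a
    simp only [ha] at h5
    exact h5
  · refine (congrArg _ (hanchor m X p)).trans (A.apply_horLift p X)

/-! ## The bundle `ad P` -/

lemma exists_adElem {m : M} (p : B.Fibre m) :
    ∃ S : LieAlg EG G →ₗ[ℝ] L.RedFibre m, ∀ z, (S z).1 p = L.correction A p.1 (L.ρ z p.1) := by
  have h : ∀ z, ∃ a : L.RedFibre m, a.1 p = L.correction A p.1 (L.ρ z p.1) := fun z =>
    L.exists_redFibre_eq p (L.pairing_correction_ρ A _ _)
  choose S hS using h
  refine ⟨{ toFun := S, map_add' := fun z w => L.redFibre_ext p ?_,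
            map_smul' := fun r z => L.redFibre_ext p ?_ }, hS⟩
  · change _ = (S z).1 p + (S w).1 p
    rw [hS, hS, hS, map_add, ContMDiffSection.coe_add, Pi.add_apply, map_add]
  · change _ = r • (S z).1 p
    rw [hS, hS, map_smul, ContMDiffSection.coe_smul, Pi.smul_apply, map_smul]

/-- The element of `ad P ⊂ E` given by a point of the fibre and an element of `𝔤`. -/
def adElem {m : M} (p : B.Fibre m) : LieAlg EG G →ₗ[ℝ] L.RedFibre m :=
  (L.exists_adElem A p).choose

lemma adElem_apply {m : M} (p : B.Fibre m) (z : LieAlg EG G) :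
    (L.adElem A p z).1 p = L.correction A p.1 (L.ρ z p.1) :=
  (L.exists_adElem A p).choose_spec z

lemma adElem_actFibre {m : M} (p : B.Fibre m) (g : G) (z : LieAlg EG G) :
    (L.adElem A p z).1 (B.actFibre p g) =
      L.correction A (B.act p.1 g) (L.ρ (adjoint g⁻¹ z) (B.act p.1 g)) := by
  refine ((L.adElem A p z).2.2 p g).trans ?_
  rw [adElem_apply, R_correction, L.ρ_act, adjoint_adjoint_inv]

lemma anchor_adElem {m : M} (p : B.Fibre m) (z : LieAlg EG G) :
    C.anchor p.1 ((L.adElem A p z).1 p) = B.fund z p.1 := by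
  rw [adElem_apply, anchor_correction, L.anchor_ρ]

lemma adElem_injective {m : M} (p : B.Fibre m) : Function.Injective (L.adElem A p) := by
  refine (injective_iff_map_eq_zero _).2 fun z hz => ?_
  have h := L.anchor_adElem A p z
  rw [hz] at h
  rw [← A.apply_fund p.1 z, ← h]
  exact (congrArg _ (map_zero (C.anchor p.1))).trans (map_zero _)

variable {A} {L} {l : L.IsotropicSplitting}

/-- Zero anchor in `TP` puts `s` in `T*`, and a covector orthogonal to the image of `λ` is zero. -/
lemma IsotropicSplitting.eq_zero_of_mem_adPart (hc : L.IsQuadraticForm c) (hnd : c.Nondegenerate)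
    {m : M} {p : B.Fibre m} {s : L.RedFibre m} (hs : s ∈ l.adPart m)
    (h : C.anchor p.1 (s.1 p) = 0) : s = 0 := by
  obtain ⟨ξ, rfl⟩ := L.exists_redCot_of_anchor_eq_zero hc hnd p h
  have hξ : ξ = 0 := LinearMap.ext fun X => by
    have h1 := hs.2 X
    rw [L.redPairing_redCot, l.anchor_toFun] at h1
    simpa using h1
  rw [hξ, map_zero]

/-- Orthogonality to `λX` has two reasons: `λX` lies in `K^⊥`, and the correction term vanishes
because the anchor of `λX` is horizontal. -/
lemma adElem_mem_adPart (hA : l.Induces A) {m : M} (p : B.Fibre m) (z : LieAlg EG G) :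
    L.adElem A p z ∈ l.adPart m := by
  refine ⟨?_, fun X => ?_⟩
  · rw [L.redAnchor_eq p, anchor_adElem, B.dproj_fund]
  · rw [L.redPairing_eq p, adElem_apply, pairing_correction, hA, C.pairing_symm,
      (l.toFun m X).2.1 p z, map_zero, zero_sub, neg_eq_zero]
    exact map_zero _

lemma exists_adElem_eq (hc : L.IsQuadraticForm c) (hnd : c.Nondegenerate) (hA : l.Induces A) {m : M}
    (p : B.Fibre m) {s : L.RedFibre m} (hs : s ∈ l.adPart m) : ∃ z, s = L.adElem A p z := by
  have h0 := hs.1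
  rw [L.redAnchor_eq p] at h0
  obtain ⟨z, hz⟩ := B.exists_fund_of_dproj_eq_zero p _ h0
  refine ⟨z, sub_eq_zero.1 (l.eq_zero_of_mem_adPart hc hnd (p := p)
    (sub_mem hs (adElem_mem_adPart hA p z)) ?_)⟩
  change C.anchor p.1 (s.1 p - (L.adElem A p z).1 p) = 0
  rw [map_sub, anchor_adElem, hz, sub_self]

variable (L A)

/-- Around every point there is a smooth frame of `ad P`, consisting of global sections. -/
lemma exists_ad_frame (m₀ : M) : ∃ (S : LieAlg EG G → L.RedSection) (U : Set M)
    (σ : (m : M) → B.Fibre m), IsOpen U ∧ m₀ ∈ U ∧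
    ∀ m ∈ U, ∀ z, RedSection.eval (S z) m = L.adElem A (σ m) z := by
  classical
  obtain ⟨p₀, rfl⟩ := B.pt m₀
  obtain ⟨U, σ, k, hU, hm, hσ, hk, hσ0, hσp, hact, hk0, hkg⟩ := B.exists_local_section p₀
  obtain ⟨χ, hχ, hχs, hχ1⟩ := exists_bump (E := EM) (hU.mem_nhds hm)
  -- The value outside `U` is arbitrary: there the cut-off `χ` vanishes.
  let τ : (m : M) → B.Fibre m := fun m => if h : m ∈ U then ⟨σ m, hσp m h⟩ else B.pt m
  have hτ : ∀ m, m ∈ U → (τ m).1 = σ m := fun m h => by simp only [τ, dif_pos h]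
  -- The equivariant function on `P` that is `χ z` along the local section `σ`; equivariance forces
  -- the factor `Ad(k⁻¹)`.
  let r : LieAlg EG G → P → LieAlg EG G := fun z q => χ (B.proj q) • adjoint (k q)⁻¹ z
  have hr : ∀ z, IsSmoothFun (EM := EP) (W := EG) (r z) := by
    intro z q
    by_cases hq : B.proj q ∈ U
    · have h1 : ContMDiffAt 𝓘(ℝ, EP) 𝓘(ℝ, EG) ∞ k q :=
        hk.contMDiffAt ((hU.preimage B.contMDiff_proj.continuous).mem_nhds hq)
      have h2 : ContMDiffAt 𝓘(ℝ, EP) 𝓘(ℝ, EG) ∞ (fun q => (k q)⁻¹) q := ContMDiffAt.inv h1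
      have h3 := ContMDiffAt.comp q (contMDiff_adjoint z _) h2
      have h4 := ContMDiffAt.comp q (hχ _) (B.contMDiff_proj q)
      let ψ : P → EG := fun q => adjoint (k q)⁻¹ z
      have h5 : ContMDiffAt 𝓘(ℝ, EP) 𝓘(ℝ, EG) ∞ ψ q := h3
      have h6 := h4.smul h5
      exact h6
    · have h1 : B.proj q ∈ (tsupport χ)ᶜ := fun h => hq (hχs h)
      have h2 : r z =ᶠ[𝓝 q] fun _ => (0 : EG) := by
        filter_upwards [((isClosed_tsupport χ).isOpen_compl.preimage
          B.contMDiff_proj.continuous).mem_nhds h1] with q' hq'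
        have h3 : χ (B.proj q') = 0 := image_eq_zero_of_notMem_tsupport hq'
        change χ (B.proj q') • adjoint (k q')⁻¹ z = 0
        rw [h3, zero_smul]
      exact contMDiffAt_const.congr_of_eventuallyEq h2
  have hS : ∀ z, ∃ a : L.RedSection, ∀ m, RedSection.eval a m = χ m • L.adElem A (τ m) z := by
    intro z
    refine L.exists_redSection (fun m => χ m • L.adElem A (τ m) z) ?_
    obtain ⟨a, ha⟩ := L.exists_section_ρ (hr z)
    have h : ∀ q, (χ (B.proj q) • L.adElem A (τ (B.proj q)) z : L.RedFibre (B.proj q)).1 ⟨q, rfl⟩ =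
        L.correction A q (a q) := by
      intro q
      change χ (B.proj q) • (L.adElem A (τ (B.proj q)) z).1 ⟨q, rfl⟩ = _
      have h5 : L.ρ (χ (B.proj q) • adjoint (k q)⁻¹ z) q =
          χ (B.proj q) • L.ρ (adjoint (k q)⁻¹ z) q := by rw [map_smul]; rfl
      rw [ha, h5, map_smul]
      by_cases hq : B.proj q ∈ U
      · congr 1
        have h6 : (⟨q, rfl⟩ : B.Fibre (B.proj q)) = B.actFibre (τ (B.proj q)) (k q) :=
          Subtype.ext (by change q = B.act _ _; rw [hτ _ hq, hact _ hq])
        have h7 : ∀ q' : B.Fibre (B.proj q), q' = B.actFibre (τ (B.proj q)) (k q) →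
            (L.adElem A (τ (B.proj q)) z).1 q' =
              L.correction A q'.1 (L.ρ (adjoint (k q)⁻¹ z) q'.1) := by
          rintro _ rfl
          exact L.adElem_actFibre A _ _ _
        exact h7 _ h6
      · have h3 : χ (B.proj q) = 0 := image_eq_zero_of_notMem_tsupport fun h => hq (hχs h)
        rw [h3, zero_smul, zero_smul]
    have h1 := L.contMDiff_correction A a
    simp only [← h] at h1
    exact h1
  choose S hS using hS
  obtain ⟨U', hU', hU'o, hm'⟩ := mem_nhds_iff.1 hχ1
  refine ⟨S, U', τ, hU'o, hm', fun m hm z => ?_⟩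
  have h1 : χ m = 1 := hU' hm
  rw [hS, h1, one_smul]

end Splittings

end LiftedAction

/-! ## Admissible metrics with given metric and connection -/

lemma frame_of_injective {W E : Type*} [AddCommGroup W] [Module ℝ W] [AddCommGroup E] [Module ℝ E]
    {T : W →ₗ[ℝ] E} (hT : Function.Injective T) {V : Submodule ℝ E}
    (hV : ∀ e, e ∈ V ↔ ∃ w, T w = e) {ι : Type*} (b : Module.Basis ι ℝ W) :
    LinearIndependent ℝ (fun i => T (b i)) ∧ Submodule.span ℝ (Set.range fun i => T (b i)) = V := by
  refine ⟨b.linearIndependent.map' T (LinearMap.ker_eq_bot.2 hT), ?_⟩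
  rw [Set.range_comp' T b, ← Submodule.map_span, b.span_eq, Submodule.map_top]
  exact Submodule.ext fun e => (hV e).symm

lemma finrank_add_of_forall {E D : Type*} [AddCommGroup E] [Module ℝ E] [FiniteDimensional ℝ E]
    [AddCommGroup D] [Module ℝ D] {V : Submodule ℝ E} {T : D →ₗ[ℝ] E} (hT : Function.Injective T)
    (h0 : ∀ e ∈ V, ∀ d, e = T d → e = 0) (h1 : ∀ e, ∃ v ∈ V, ∃ d, e = v + T d) :
    V ⊓ LinearMap.range T = ⊥ ∧ Module.finrank ℝ V + Module.finrank ℝ D = Module.finrank ℝ E := by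
  have hbot : V ⊓ LinearMap.range T = ⊥ := by
    refine (Submodule.eq_bot_iff _).2 ?_
    rintro e ⟨he, d, rfl⟩
    exact h0 _ he d rfl
  refine ⟨hbot, ?_⟩
  have htop : V ⊔ LinearMap.range T = ⊤ := by
    refine Submodule.eq_top_iff'.2 fun e => ?_
    obtain ⟨v, hv, d, rfl⟩ := h1 e
    exact Submodule.add_mem_sup hv ⟨d, rfl⟩
  rw [← LinearMap.finrank_range_of_inj hT]
  exact Submodule.finrank_add_eq_of_isCompl ⟨disjoint_iff.2 hbot, codisjoint_iff.2 htop⟩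

lemma restrict_nondegenerate {E : Type*} [AddCommGroup E] [Module ℝ E]
    {b : LinearMap.BilinForm ℝ E} (hb : ∀ x y, b x y = b y x) {V : Submodule ℝ E}
    (h : ∀ v ∈ V, (∀ w ∈ V, b v w = 0) → v = 0) : (b.restrict V).Nondegenerate := by
  constructor
  · intro v hv
    exact Subtype.ext (h v.1 v.2 fun w hw => hv ⟨w, hw⟩)
  · intro v hv
    exact Subtype.ext (h v.1 v.2 fun w hw => (hb _ _).trans (hv ⟨w, hw⟩))

namespace LiftedAction

section Graphs

variable {EG : Type*} [NormedAddCommGroup EG] [NormedSpace ℝ EG] [FiniteDimensional ℝ EG]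
  {G : Type*} [TopologicalSpace G] [ChartedSpace EG G] [Group G] [LieGroup 𝓘(ℝ, EG) ∞ G]
  {EM : Type*} [NormedAddCommGroup EM] [NormedSpace ℝ EM] [FiniteDimensional ℝ EM]
  {M : Type*} [TopologicalSpace M] [T2Space M] [ChartedSpace EM M] [IsManifold 𝓘(ℝ, EM) ∞ M]
  {EP : Type*} [NormedAddCommGroup EP] [NormedSpace ℝ EP] [FiniteDimensional ℝ EP]
  {P : Type*} [TopologicalSpace P] [T2Space P] [ChartedSpace EP P] [IsManifold 𝓘(ℝ, EP) ∞ P]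
  {F : Type*} [NormedAddCommGroup F] [NormedSpace ℝ F] [FiniteDimensional ℝ F]
  {Eh : P → Type*} [TopologicalSpace (TotalSpace F Eh)]
  [∀ p, AddCommGroup (Eh p)] [∀ p, Module ℝ (Eh p)] [∀ p, TopologicalSpace (Eh p)]
  [FiberBundle F Eh] [VectorBundle ℝ F Eh] [ContMDiffVectorBundle ∞ F Eh 𝓘(ℝ, EP)]
variable {B : PrincipalBundle EG G EM M EP P} {C : ExactCourantAlgebroid EP P F Eh}
  {L : LiftedAction B C} {c : LinearMap.BilinForm ℝ (LieAlg EG G)} {A : Connection B}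
  {l : L.IsotropicSplitting} {g : PseudoMetric EM M} {V : (m : M) → Submodule ℝ (L.RedFibre m)}

lemma redPairing_graphVec_of_mem_adPart {m : M} (X : TangentSpace 𝓘(ℝ, EM) m) {s : L.RedFibre m}
    (hs : s ∈ l.adPart m) : L.redPairing m (L.graphVec g l m X) s = 0 := by
  rw [redPairing_graphVec, L.redPairing_symm, hs.2, hs.1, map_zero, mul_zero, add_zero]

lemma IsGraph.graphVec_mem (h : L.IsGraph V g l) (m : M) (X : TangentSpace 𝓘(ℝ, EM) m) :
    L.graphVec g l m X ∈ V m :=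
  (h m _).2 ⟨X, 0, zero_mem _, (add_zero _).symm⟩

lemma graphVec_zero (m : M) : L.graphVec g l m 0 = 0 := by
  rw [graphVec, map_zero, map_zero, map_zero, add_zero]

lemma IsGraph.mem_of_mem_adPart (h : L.IsGraph V g l) {m : M} {s : L.RedFibre m}
    (hs : s ∈ l.adPart m) : s ∈ V m :=
  (h m _).2 ⟨0, s, hs, by rw [graphVec_zero, zero_add]⟩

lemma IsGraph.isDeterminedPair (h : L.IsGraph V g l) : L.IsDeterminedPair V g l := by
  refine fun m => ⟨fun X => ⟨h.graphVec_mem m X, fun v hv hv0 => ?_⟩, fun X Y =>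
    (L.redPairing_graphVec_graphVec g l m X Y).symm⟩
  obtain ⟨Y, s, hs, rfl⟩ := (h m v).1 hv
  rw [map_add, redAnchor_graphVec, hs.1, add_zero] at hv0
  rw [hv0, graphVec_zero, zero_add, redPairing_graphVec_of_mem_adPart X hs]

/-- A local frame of `T`, lifted by `λ + g`, together with a local frame of `ad P` is a frame of
`V`. -/
lemma IsGraph.isSubbundle (hc : L.IsQuadraticForm c) (hnd : c.Nondegenerate) (hA : l.Induces A)
    (h : L.IsGraph V g l) : L.IsSubbundle V := by
  intro m₀
  obtain ⟨S, U, σ, hU, hm₀, hS⟩ := L.exists_ad_frame A m₀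
  obtain ⟨X, hX⟩ := exists_frame (E := EM) (F := EM)
    (V := fun m : M => TangentSpace 𝓘(ℝ, EM) m) m₀
  obtain ⟨U', hU', hU'o, hm₀'⟩ := mem_nhds_iff.1 hX
  have hcot : ∀ x, ∃ a : L.RedSection, ∀ m, RedSection.eval a m = L.redCot m (g.toFun m (X x m)) :=
    fun x => L.exists_redSection_redCot fun Z hZ => g.smooth _ Z (X x).contMDiff hZ
  choose a ha using hcot
  let T : (m : M) → (EM × LieAlg EG G) →ₗ[ℝ] L.RedFibre m := fun m =>
    LinearMap.coprod ((l.toFun m + (L.redCot m).comp (g.toFun m)).comp ((evalSection m).comp X))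
      (L.adElem A (σ m))
  have hT : ∀ m w, T m w = L.graphVec g l m (X w.1 m) + L.adElem A (σ m) w.2 := fun _ _ => rfl
  let β := Module.finBasis ℝ (EM × LieAlg EG G)
  let s : Fin (Module.finrank ℝ (EM × LieAlg EG G)) → L.RedSection := fun i =>
    l.liftSec (X (β i).1) + a (β i).1 + S (β i).2
  refine ⟨_, s, U ∩ U', hU.inter hU'o, ⟨hm₀, hm₀'⟩, fun m hm => ?_⟩
  have hs : ∀ i, RedSection.eval (s i) m = T m (β i) := by
    intro i
    rw [RedSection.eval_add, RedSection.eval_add, IsotropicSplitting.eval_liftSec, ha, hS m hm.1, hT]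
    rfl
  have hXm := hU' hm.2
  simp only [hs]
  refine frame_of_injective ((injective_iff_map_eq_zero _).2 fun w hw => ?_) (fun e => ?_) β
  · rw [hT] at hw
    have h1 := congrArg (L.redAnchor m) hw
    rw [map_add, redAnchor_graphVec, (adElem_mem_adPart hA (σ m) w.2).1, add_zero, map_zero,
      hXm.2] at h1
    have h2 : w.1 = 0 := by
      rw [← coordAt_symm hXm.1 w.1, h1, map_zero]
    have h3 : X w.1 m = 0 := by rw [h2, map_zero]; rfl
    rw [h3, graphVec_zero, zero_add] at hw
    exact Prod.ext h2 ((injective_iff_map_eq_zero _).1 (L.adElem_injective A (σ m)) _ hw)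
  · rw [h m e]
    constructor
    · rintro ⟨Y, s, hs, rfl⟩
      obtain ⟨z, rfl⟩ := exists_adElem_eq hc hnd hA (σ m) hs
      refine ⟨(coordAt EM m₀ m Y, z), ?_⟩
      rw [hT, hXm.2, symm_coordAt hXm.1]
    · rintro ⟨w, rfl⟩
      exact ⟨X w.1 m, _, adElem_mem_adPart hA (σ m) w.2, hT m w⟩

/-- The summands `(λ + g)(T)` and `ad P` are orthogonal, with metrics `g` and `c`, so the metric is
nondegenerate on `V`. Replacing `λ` by `λ + g` changes it only within `T*`, so `V` is still a
complement of `T*`, which gives both the intersection and the rank. -/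
lemma IsGraph.isAdmissible (hc : L.IsQuadraticForm c) (hnd : c.Nondegenerate) (hA : l.Induces A)
    (h : L.IsGraph V g l) : L.IsAdmissible V := by
  refine ⟨⟨h.isSubbundle hc hnd hA, fun m => ?_⟩, fun m => ?_⟩
  · refine restrict_nondegenerate (L.redPairing_symm m) fun e he h0 => ?_
    obtain ⟨X, s, hs, rfl⟩ := (h m e).1 he
    have hX : X = 0 := by
      refine (g.nondeg m).1 X fun Y => ?_
      have h1 := h0 _ (h.graphVec_mem m Y)
      rwa [map_add, LinearMap.add_apply, redPairing_graphVec_graphVec, L.redPairing_symm m s,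
        redPairing_graphVec_of_mem_adPart Y hs, add_zero] at h1
    rw [hX, graphVec_zero, zero_add] at h0 ⊢
    obtain ⟨z, rfl⟩ := exists_adElem_eq hc hnd hA (B.pt m) hs
    have hz : z = 0 := by
      refine hnd.1 z fun w => ?_
      have h1 := h0 _ (h.mem_of_mem_adPart (adElem_mem_adPart hA (B.pt m) w))
      rwa [hA.redPairing_eq_of_redAnchor_eq_zero hc (B.pt m) hs.1, hs.2, zero_add, anchor_adElem,
        anchor_adElem, A.apply_fund, A.apply_fund] at h1
    rw [hz, map_zero]
  · have hfin := L.finiteDimensional_redFibre m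
    have hdim : Module.finrank ℝ EM =
        Module.finrank ℝ (Module.Dual ℝ (TangentSpace 𝓘(ℝ, EM) m)) :=
      (Subspace.dual_finrank_eq (K := ℝ) (V := EM)).symm
    rw [hdim]
    refine finrank_add_of_forall (L.redCot_injective hc hnd m) ?_ fun e => ?_
    · rintro e he ξ rfl
      obtain ⟨X, s, hs, hX⟩ := (h m _).1 he
      have h1 := congrArg (L.redAnchor m) hX
      rw [L.redAnchor_redCot, map_add, redAnchor_graphVec, hs.1, add_zero] at h1
      rw [← h1, graphVec_zero, zero_add] at hX
      rw [hX]
      exact l.eq_zero_of_mem_adPart hc hnd (p := B.pt m) hs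
        (by rw [← hX]; exact L.anchor_redCot ξ (B.pt m))
    · let X := L.redAnchor m e
      let ξ := l.cotPart m e
      have hs : e - l.toFun m X - L.redCot m ξ ∈ l.adPart m := by
        refine ⟨?_, fun Y => ?_⟩
        · rw [map_sub, map_sub, l.anchor_toFun, L.redAnchor_redCot, sub_zero]
          exact sub_self _
        · rw [map_sub, map_sub, LinearMap.sub_apply, LinearMap.sub_apply, l.isotropic,
            L.redPairing_redCot, l.anchor_toFun]
          simp only [ξ, IsotropicSplitting.cotPart, LinearMap.smul_apply, LinearMap.comp_apply,
            smul_eq_mul]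
          ring
      -- The `g(X)` included in the vector of `V` is taken off the `T*`-component.
      refine ⟨_, (h m _).2 ⟨X, _, hs, rfl⟩, ξ - g.toFun m X, ?_⟩
      rw [graphVec, map_sub]
      abel

lemma exists_isGraph (g : PseudoMetric EM M) (l : L.IsotropicSplitting) :
    ∃ V : (m : M) → Submodule ℝ (L.RedFibre m), L.IsGraph V g l := by
  refine ⟨fun m => LinearMap.range (l.toFun m + (L.redCot m).comp (g.toFun m)) ⊔ l.adPart m,
    fun m e => ?_⟩
  rw [Submodule.mem_sup]
  constructor
  · rintro ⟨_, ⟨X, rfl⟩, s, hs, rfl⟩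
    exact ⟨X, s, hs, rfl⟩
  · rintro ⟨X, s, hs, rfl⟩
    exact ⟨_, ⟨X, rfl⟩, s, hs, rfl⟩

/-! ### Transformations by 2-forms -/

section TwoForms

variable {l' : L.IsotropicSplitting} {b : TwoForm EM M}
  (hb : ∀ m X, l'.toFun m X = l.toFun m X + L.redCot m (b.toFun m X))
include hb

lemma mem_adPart_iff_of_eq_add {m : M} (s : L.RedFibre m) : s ∈ l'.adPart m ↔ s ∈ l.adPart m := by
  refine and_congr_right fun h0 => forall_congr' fun X => ?_
  rw [hb, map_add, L.redPairing_redCot_right, h0, map_zero, mul_zero, add_zero]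

lemma bTransform_graphVec {m : M} (X : TangentSpace 𝓘(ℝ, EM) m) :
    L.bTransform b m (L.graphVec g l m X) = L.graphVec g l' m X := by
  change L.graphVec g l m X + L.redCot m (b.toFun m (L.redAnchor m (L.graphVec g l m X))) = _
  rw [redAnchor_graphVec, graphVec, graphVec, hb]
  abel

lemma bTransform_of_mem_adPart {m : M} {s : L.RedFibre m} (hs : s ∈ l.adPart m) :
    L.bTransform b m s = s := by
  change s + L.redCot m (b.toFun m (L.redAnchor m s)) = s
  rw [hs.1, map_zero, map_zero, add_zero]

/-- The transformation by `b` fixes `ad P ⊂ Ker π` and carries `λ + g` to `λ' + g`; the two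
splittings have the same `ad P`, since `Ker π` is orthogonal to `T*`. -/
lemma IsGraph.iff_map (h : L.IsGraph V g l) {V' : (m : M) → Submodule ℝ (L.RedFibre m)} :
    L.IsGraph V' g l' ↔ ∀ m, V' m = (V m).map (L.bTransform b m) := by
  have key : ∀ m e, e ∈ (V m).map (L.bTransform b m) ↔
      ∃ X, ∃ s ∈ l'.adPart m, e = L.graphVec g l' m X + s := by
    intro m e
    constructor
    · rintro ⟨v, hv, rfl⟩
      obtain ⟨X, s, hs, rfl⟩ := (h m v).1 hv
      refine ⟨X, s, (mem_adPart_iff_of_eq_add hb s).2 hs, ?_⟩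
      rw [map_add, bTransform_graphVec hb, bTransform_of_mem_adPart hb hs]
    · rintro ⟨X, s, hs, rfl⟩
      have hs' := (mem_adPart_iff_of_eq_add hb s).1 hs
      refine ⟨_, (h m _).2 ⟨X, s, hs', rfl⟩, ?_⟩
      rw [map_add, bTransform_graphVec hb, bTransform_of_mem_adPart hb hs']
  constructor
  · exact fun h' m => Submodule.ext fun e => (h' m e).trans (key m e).symm
  · exact fun h' m e => by rw [h' m]; exact key m e

end TwoForms

/-- Two splittings that induce the same connection differ by a 2-form. -/
lemma IsotropicSplitting.Induces.exists_twoForm (hc : L.IsQuadraticForm c) (hnd : c.Nondegenerate)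
    {l' : L.IsotropicSplitting} (hA : l.Induces A) (hA' : l'.Induces A) :
    ∃ b : TwoForm EM M, ∀ m X, l'.toFun m X = l.toFun m X + L.redCot m (b.toFun m X) := by
  -- The difference `λ' - λ` takes values in `T*`, and pairing it with `λY` leaves `⟨λ'X, λY⟩`,
  -- which must be half the form.
  let b : (m : M) → LinearMap.BilinForm ℝ (TangentSpace 𝓘(ℝ, EM) m) := fun m =>
    (2 : ℝ) • (L.redPairing m).compl₁₂ (l'.toFun m) (l.toFun m)
  have hb0 : ∀ m X Y, b m X Y = 2 * L.redPairing m (l'.toFun m X) (l.toFun m Y) :=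
    fun _ _ _ => rfl
  have hb : ∀ m X, l'.toFun m X = l.toFun m X + L.redCot m (b m X) := by
    intro m X
    have h0 : C.anchor (B.pt m).1 ((l'.toFun m X - l.toFun m X : L.RedFibre m).1 (B.pt m)) = 0 := by
      change C.anchor (B.pt m).1 ((l'.toFun m X).1 (B.pt m) - (l.toFun m X).1 (B.pt m)) = 0
      rw [map_sub, sub_eq_zero]
      exact (hA'.anchorLift_eq (B.pt m) X).trans (hA.anchorLift_eq (B.pt m) X).symm
    obtain ⟨ξ, hξ⟩ := L.exists_redCot_of_anchor_eq_zero hc hnd (B.pt m) h0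
    have h1 : ξ = b m X := by
      refine LinearMap.ext fun Y => ?_
      have h2 := L.redPairing_redCot m ξ (l.toFun m Y)
      rw [← hξ, map_sub, LinearMap.sub_apply, l.isotropic, l.anchor_toFun] at h2
      rw [hb0]
      linarith
    rw [← h1, ← hξ]
    abel
  refine ⟨⟨b, fun m X => ?_, fun X Y hX hY => ?_⟩, hb⟩
  -- Isotropy of both splittings turns `⟨λ'X, λ'X⟩ = 0` into the vanishing of `b(X, X)`.
  · have h1 := l'.isotropic m X X
    have h2 := hb0 m X X
    rw [hb m X, map_add, map_add, LinearMap.add_apply, LinearMap.add_apply, l.isotropic,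
      L.redPairing_redCot, L.redPairing_redCot_right, L.redPairing_redCot, L.redAnchor_redCot,
      l.anchor_toFun, map_zero] at h1
    linarith
  · obtain ⟨a, ha⟩ := l'.smooth X hX
    obtain ⟨d, hd⟩ := l.smooth Y hY
    have h1 : (fun m => b m (X m) (Y m)) = fun m => 2 * L.secPairing a d m :=
      funext fun m => by rw [hb0, secPairing, ha, hd]
    rw [h1]
    exact contMDiff_const.mul (L.contMDiff_redPairing a d)

lemma exists_splitting_add (l : L.IsotropicSplitting) (b : TwoForm EM M) :
    ∃ l' : L.IsotropicSplitting, ∀ m X, l'.toFun m X = l.toFun m X + L.redCot m (b.toFun m X) := by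
  refine ⟨⟨fun m => l.toFun m + (L.redCot m).comp (b.toFun m), fun m X => ?_, fun m X Y => ?_,
    fun X hX => ?_⟩, fun _ _ => rfl⟩
  · change L.redAnchor m (l.toFun m X + L.redCot m (b.toFun m X)) = X
    rw [map_add, l.anchor_toFun, L.redAnchor_redCot, add_zero]
  · change L.redPairing m (l.toFun m X + L.redCot m (b.toFun m X))
      (l.toFun m Y + L.redCot m (b.toFun m Y)) = 0
    have h1 := b.alt m (X + Y)
    rw [map_add, map_add, LinearMap.add_apply, LinearMap.add_apply, b.alt, b.alt] at h1
    rw [map_add, map_add, LinearMap.add_apply, LinearMap.add_apply, l.isotropic,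
      L.redPairing_redCot, L.redPairing_redCot_right, L.redPairing_redCot, L.redAnchor_redCot,
      l.anchor_toFun, l.anchor_toFun, map_zero]
    linarith
  · obtain ⟨a, ha⟩ := l.smooth X hX
    obtain ⟨d, hd⟩ := L.exists_redSection_redCot (ξ := fun m => b.toFun m (X m))
      fun Z hZ => b.smooth X Z hX hZ
    exact ⟨a + d, fun m => by rw [RedSection.eval_add, ha, hd]; rfl⟩

lemma IsotropicSplitting.Induces.of_eq_add {l' : L.IsotropicSplitting} {b : TwoForm EM M}
    (hA : l.Induces A) (hb : ∀ m X, l'.toFun m X = l.toFun m X + L.redCot m (b.toFun m X)) :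
    l'.Induces A := by
  intro m X p
  rw [hb]
  change A.toFun p.1 (C.anchor p.1 ((l.toFun m X).1 p + (L.redCot m (b.toFun m X)).1 p)) = 0
  rw [map_add, L.anchor_redCot, add_zero, hA]

/-- The splittings with connection `A` are the translates of any one of them by 2-forms, and
translating the splitting transforms the graph. -/
theorem IsAssociated.iff_exists_map (hc : L.IsQuadraticForm c) (hnd : c.Nondegenerate)
    (h : L.IsAssociated V g A) (V' : (m : M) → Submodule ℝ (L.RedFibre m)) :
    L.IsAssociated V' g A ↔ ∃ b : TwoForm EM M, ∀ m, V' m = (V m).map (L.bTransform b m) := by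
  obtain ⟨l, hA, hG⟩ := h
  constructor
  · rintro ⟨l', hA', hG'⟩
    obtain ⟨b, hb⟩ := hA.exists_twoForm hc hnd hA'
    exact ⟨b, (hG.iff_map hb).1 hG'⟩
  · rintro ⟨b, hV'⟩
    obtain ⟨l', hb⟩ := exists_splitting_add l b
    exact ⟨l', hA.of_eq_add hb, (hG.iff_map hb).2 hV'⟩

end Graphs

end LiftedAction

end TransitiveCourant

end

theorem mainTheorem9
    {EG : Type*} [NormedAddCommGroup EG] [NormedSpace ℝ EG] [FiniteDimensional ℝ EG]
    {G : Type*} [TopologicalSpace G] [ChartedSpace EG G] [Group G] [LieGroup 𝓘(ℝ, EG) ∞ G]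
    {EM : Type*} [NormedAddCommGroup EM] [NormedSpace ℝ EM] [FiniteDimensional ℝ EM]
    {M : Type*} [TopologicalSpace M] [T2Space M] [SecondCountableTopology M]
    [ChartedSpace EM M] [IsManifold 𝓘(ℝ, EM) ∞ M]
    {EP : Type*} [NormedAddCommGroup EP] [NormedSpace ℝ EP] [FiniteDimensional ℝ EP]
    {P : Type*} [TopologicalSpace P] [T2Space P] [SecondCountableTopology P]
    [ChartedSpace EP P] [IsManifold 𝓘(ℝ, EP) ∞ P]
    {F : Type*} [NormedAddCommGroup F] [NormedSpace ℝ F] [FiniteDimensional ℝ F]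
    {Eh : P → Type*} [TopologicalSpace (Bundle.TotalSpace F Eh)]
    [∀ p, AddCommGroup (Eh p)] [∀ p, Module ℝ (Eh p)] [∀ p, TopologicalSpace (Eh p)]
    [FiberBundle F Eh] [VectorBundle ℝ F Eh] [ContMDiffVectorBundle ∞ F Eh 𝓘(ℝ, EP)]
    (B : TransitiveCourant.PrincipalBundle EG G EM M EP P)
    (C : TransitiveCourant.ExactCourantAlgebroid EP P F Eh)
    (L : TransitiveCourant.LiftedAction B C) (hL : L.HasEquivariantSplitting)
    (c : LinearMap.BilinForm ℝ (TransitiveCourant.LieAlg EG G))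
    (hc : L.IsQuadraticForm c) (hnd : c.Nondegenerate) :
    (∀ V : (m : M) → Submodule ℝ (L.RedFibre m), L.IsAdmissible V →
      (∃! q : TransitiveCourant.PseudoMetric EM M × L.IsotropicSplitting,
        L.IsDeterminedPair V q.1 q.2) ∧
      ∀ (g : TransitiveCourant.PseudoMetric EM M) (l : L.IsotropicSplitting),
        L.IsDeterminedPair V g l →
        L.IsGraph V g l ∧
        (∃! A : TransitiveCourant.Connection B, l.Induces A) ∧
        ∀ A : TransitiveCourant.Connection B, l.Induces A →
          (∃! H : TransitiveCourant.ThreeForm EM M, l.BracketFormula A c H) ∧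
          ∀ H : TransitiveCourant.ThreeForm EM M, l.BracketFormula A c H →
            TransitiveCourant.StructureEq B A c H) ∧
    (∀ (g : TransitiveCourant.PseudoMetric EM M) (A : TransitiveCourant.Connection B),
      (∃ V : (m : M) → Submodule ℝ (L.RedFibre m), L.IsAssociated V g A) ∧
      (∀ V : (m : M) → Submodule ℝ (L.RedFibre m), L.IsAssociated V g A ↔
        L.IsAdmissible V ∧
          ∃ l : L.IsotropicSplitting, L.IsDeterminedPair V g l ∧ l.Induces A) ∧
      ∀ V : (m : M) → Submodule ℝ (L.RedFibre m), L.IsAssociated V g A →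
        ∀ V' : (m : M) → Submodule ℝ (L.RedFibre m), L.IsAssociated V' g A ↔
          ∃ b : TransitiveCourant.TwoForm EM M,
            ∀ m, V' m = (V m).map (L.bTransform b m)) := by
  refine ⟨fun V hV => ⟨?_, fun g l hgl => ⟨hgl.isGraph hc hnd hV, l.existsUnique_connection,
    fun A hA => ?_⟩⟩, fun g A => ⟨?_, fun V => ⟨?_, ?_⟩, fun V hV V' =>
      hV.iff_exists_map hc hnd V'⟩⟩
  · obtain ⟨g, l, hgl⟩ := TransitiveCourant.LiftedAction.exists_isDeterminedPair hc hnd hV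
    exact ⟨(g, l), hgl, fun q hq =>
      Prod.ext (hq.unique hc hnd hV hgl).1 (hq.unique hc hnd hV hgl).2⟩
  · obtain ⟨H, hH⟩ := l.exists_threeForm
    have hb := hA.bracketFormula hc hH
    refine ⟨⟨H, hb, fun H' h' => h'.unique hb⟩, fun H' h' => ?_⟩
    -- Any 3-form in the bracket formula is the one constructed from `2⟨[λX, λY], λZ⟩`, for which
    -- the structure equation is available.
    rw [h'.unique hb]
    exact hA.structureEq hc hH
  · obtain ⟨l, hA⟩ := L.exists_induces A hL
    obtain ⟨V, hV⟩ := TransitiveCourant.LiftedAction.exists_isGraph g l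
    exact ⟨V, l, hA, hV⟩
  · rintro ⟨l, hA, hG⟩
    exact ⟨hG.isAdmissible hc hnd hA, l, hG.isDeterminedPair, hA⟩
  · rintro ⟨hV, l, hgl, hA⟩
    exact ⟨l, hA, hgl.isGraph hc hnd hV⟩
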